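/- Let $d\ge 2$, let $\gamma_d(t)=(t,t^2,\dots,t^d)$ and $\Gamma_d=\{\gamma_d(t):t\in[0,1]\}\subset\mathbb{R}^d$. For $0<\alpha<1$ put $$p_\alpha=\frac{4}{\alpha}\ \text{ if } d=2,\qquad p_\alpha=\frac{d^2+d+2\alpha}{2\alpha}\ \text{ if } d\ge 3 .$$ Let $(m_j)_{j\ge 1}$ be a nondecreasing sequence of integers $m_j\ge 2$, and put $M_j=m_1m_2\cdots m_j$ (so $M_0=1$). Assume that for every $\varepsilon>0$ there is a constant $C_\varepsilon$ with $m_{j+1}\le C_\varepsilon M_j^{\varepsilon}$ for all $j$. Let $\mathcal{I}_j=\{[k/M_j,(k+1)/M_j): 0\le k\le M_j-1\}$. Let $(\beta_j)_{j\ge0}$ be a deterministic nondecreasing sequence of real numbers with $\beta_0=1$, and let $(E_j)_{j\ge0}$ be random sets on a probability space, with $\mu_j=\beta_j\mathbf{1}_{E_j}$, such that - $E_0=[0,1)$, and each $E_j$ is a union of intervals in $\mathcal{I}_j$; - $\mathbb{E}(\mu_{j+1}(x)\mid E_j)=\mu_j(x)$ almost surely, for all $j$ and all $x\in[0,1]$;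 - for each $j$, conditioned on $E_j$, the sets $I\cap E_{j+1}$, $I\in\mathcal{I}_j$, are independent. Assume that $\lim_{j\to\infty}\frac{\log\beta_j}{\log M_j}=1-\alpha$. Let $\nu_j$ be the measure on $\Gamma_d$ with $\int f\,d\nu_j=\int_0^1 f(\gamma_d(t))\,\mu_j(t)\,dt$. Let $p_\alpha<p\le\infty$. Then almost surely the measures $\nu_j$ converge weakly to a finite measure $\nu$ with $\nu(\mathbb{R}^d\setminus\Gamma_d)=0$, and its Fourier transform $\widehat{\nu}(\xi)=\int e^{-2\pi i\langle x,\xi\rangle}\,d\nu(x)$ belongs to $L^p(\mathbb{R}^d)$, that is, $\|\widehat{\nu}\|_p<\infty$ (with a bound that may depend on the realization of $\nu$). -/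

import Mathlib

open MeasureTheory ProbabilityTheory Filter Set
open scoped Topology ENNReal

noncomputable section

namespace MomentCantor

/-- The moment curve `γ_d(t) = (t, t², …, t^d)` in Euclidean space. -/
def momentCurve (d : ℕ) (t : ℝ) : EuclideanSpace ℝ (Fin d) :=
  WithLp.toLp 2 (fun i => t ^ ((i : ℕ) + 1))

/-- The set `Γ_d = {γ_d(t) : t ∈ [0,1]}`. -/
def momentArc (d : ℕ) : Set (EuclideanSpace ℝ (Fin d)) :=
  momentCurve d '' Icc 0 1

/-- The exponent `p_α`: `4/α` for `d = 2` and `(d² + d + 2α)/(2α)` for `d ≥ 3`. -/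
def criticalExponent (d : ℕ) (α : ℝ) : ℝ :=
  if d = 2 then 4 / α else ((d : ℝ) ^ 2 + d + 2 * α) / (2 * α)

/-- `M_j = m_1 m_2 ⋯ m_j`, so `M_0 = 1`; the value `m 0` is never used. -/
def scale (m : ℕ → ℕ) (j : ℕ) : ℕ := ∏ i ∈ Finset.Icc 1 j, m i

/-- The conditions on the sequence `(m_j)_{j ≥ 1}`: nondecreasing, `m_j ≥ 2`, and
`m_{j+1} ≲_ε (m_1 ⋯ m_j)^ε` for every `ε > 0`. -/
structure IsAdmissible (m : ℕ → ℕ) : Prop where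
  two_le : ∀ j, 1 ≤ j → 2 ≤ m j
  le_succ : ∀ j, 1 ≤ j → m j ≤ m (j + 1)
  growth : ∀ ε : ℝ, 0 < ε → ∃ C : ℝ, ∀ j, (m (j + 1) : ℝ) ≤ C * (scale m j : ℝ) ^ ε

/-- The `k`-th interval `M_j⁻¹ (k + [0,1))` of the collection `𝓘_j`, `0 ≤ k ≤ M_j - 1`. -/
def cell (m : ℕ → ℕ) (j : ℕ) (k : Fin (scale m j)) : Set ℝ :=
  Ico ((k : ℝ) / scale m j) (((k : ℝ) + 1) / scale m j)

/-- The function `b 𝟏_A`; with `b = β_j` and `A = E_j` this is `μ_j`. -/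
def density (b : ℝ) (A : Set ℝ) : ℝ → ℝ := A.indicator (fun _ => b)

/-- The random Cantor construction with scales `m`, heights `β` and random sets `E_j`.
A random set is a map `Ω → Set ℝ`; the σ-algebra on `Set ℝ = (ℝ → Prop)` is the product one, so
`E j` is measurable iff every event `{x ∈ E_j}` is, and `σ(E_j)` is generated by these events. -/
structure IsRandomCantor {Ω : Type*} [MeasurableSpace Ω] (P : Measure Ω)
    (m : ℕ → ℕ) (β : ℕ → ℝ) (E : ℕ → Ω → Set ℝ) : Prop where
  measurable : ∀ j, Measurable (E j)
  /-- the deterministic sequence `β` is nondecreasing -/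
  mono : Monotone β
  /-- `μ_0 = β_0 𝟏_{E_0}` is the indicator function of the unit interval -/
  beta_zero : β 0 = 1
  set_zero : ∀ ω, E 0 ω = Ico 0 1
  /-- `E_j` is a union of intervals in `𝓘_j` -/
  union : ∀ j ω, ∃ S : Set (Fin (scale m j)), E j ω = ⋃ k ∈ S, cell m j k
  /-- `𝔼(μ_{j+1}(x) | E_j) = μ_j(x)` almost surely, for every `x ∈ [0,1]` -/
  condExp_eq : ∀ j, ∀ x ∈ Icc (0 : ℝ) 1,
    P[fun ω => density (β (j + 1)) (E (j + 1) ω) x | MeasurableSpace.comap (E j) inferInstance]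
      =ᵐ[P] fun ω => density (β j) (E j ω) x
  /-- Conditioned on `E_j`, the sets `I ∩ E_{j+1}`, `I ∈ 𝓘_j`, are independent. As `E_j` takes
  finitely many values, this is independence under `P( · | E_j = S)` for each value `S` that
  `E_j` takes with positive probability. -/
  indep : ∀ j (S : Set ℝ), P {ω | E j ω = S} ≠ 0 →
    iIndepFun (fun (k : Fin (scale m j)) ω => cell m j k ∩ E (j + 1) ω) P[|{ω | E j ω = S}]

/-- The measure `b 𝟏_A(t) dt` on `[0,1]`. -/
def lineMeasure (b : ℝ) (A : Set ℝ) : FiniteMeasure ℝ :=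
  ⟨(volume.restrict (Icc (0 : ℝ) 1)).withDensity (fun t => ENNReal.ofReal (density b A t)), by
    refine isFiniteMeasure_withDensity (ne_of_lt ?_)
    calc ∫⁻ t in Icc (0 : ℝ) 1, ENNReal.ofReal (density b A t)
        ≤ ∫⁻ _ in Icc (0 : ℝ) 1, ENNReal.ofReal b := by
          refine lintegral_mono fun t => ?_
          by_cases h : t ∈ A <;> simp [density, h]
      _ < ∞ := by simp⟩

/-- The push-forward of `b 𝟏_A(t) dt` under the moment curve; with `b = β_j` and `A = E_j` this
is `ν_j`, i.e. `∫ f dν_j = ∫ f(γ_d(t)) dμ_j(t)`. -/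
def curveMeasure (d : ℕ) (b : ℝ) (A : Set ℝ) : FiniteMeasure (EuclideanSpace ℝ (Fin d)) :=
  (lineMeasure b A).map (momentCurve d)

/-- The Fourier transform `ν̂(ξ) = ∫ e^{-2πi⟨x,ξ⟩} dν(x)` of a finite measure. -/
def fourierMeasure {d : ℕ} (ν : FiniteMeasure (EuclideanSpace ℝ (Fin d)))
    (ξ : EuclideanSpace ℝ (Fin d)) : ℂ :=
  ∫ x, Complex.exp (-(2 * Real.pi * (inner ℝ x ξ : ℝ) : ℝ) * Complex.I)
    ∂(ν : Measure (EuclideanSpace ℝ (Fin d)))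

end MomentCantor

end

/-!
The increments `Δ_j = ν̂_{j+1} - ν̂_j` are summed in `L^p`. Conditioned on `E_j`, the number `Δ_j(ξ)`
is a sum of independent centred terms, one for each cell `k` of `E_j`, and the term of `k` is at most
`β_{j+1} ∑_{l ⊆ k} |ĉ_l(ξ)|`, where `ĉ_l` is the Fourier transform of the `l`-th cell of level `j + 1`
on the moment curve. Hoeffding's inequality bounds the conditional `p`-th moment of `Δ_j(ξ)` by the
`p / 2`-th power of the square function `squareSum`, the sum of the squares of these bounds
(`IsRandomCantor.lintegral_increment_le`).

A cell contributes substantially at `ξ` only if it *resonates*, that is, contains a point at which no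
derivative of the phase `t ↦ ⟨γ_d(t), ξ⟩` is large; otherwise `ĉ_l(ξ)` is small, by the first
derivative test between the sign changes (`norm_integral_osc_le_of_large`). So the square function is
at most a weighted sum over `n` of the numbers of cells that resonate at frequency `2ⁿ M_j`
(`sum_sq_le_resonanceSum`), and powers of these numbers have to be integrated in `ξ`. If more than a
fixed number of cells of side `1 / ρ` resonate with `ξ`, then a polynomial that is small at many
separated points has small derivatives at one of them, which confines `ξ` to a box of sides
comparable to `ρ^{e-1} h`, `1 ≤ e ≤ d`, attached to one of these cells. Take the last level `i` of the
tree of cells at which the resonating cells have only boundedly many ancestors: their number is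
at most a constant times the maximal number of descendants of one level `i` cell, about
`(M_j / M_i)^α`, while `ξ` lies in one of about `M_{i+1}^α` boxes (`card_resonates_le`). Summing the
volumes over `i`, only the two extreme levels matter (`exists_lintegral_resonanceSum_le`), and they
give exactly the two conditions `d < α p / 2` and `α + d (d + 1) / 2 < α p`, which hold for
`p > p_α` (`lt_of_criticalExponent_lt`).

That `E_j` has about `(M_j / M_i)^α` cells in each of its level `i` cells is a random statement. The same
moment inequality, applied to the masses of cells, gives a recursion that bounds all moments of the
number of descendants with a loss `M_j^{O(ε)}` (`IsRandomCantor.lintegral_descCount_le`), and a union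
bound with high moments controls all cells at once (`IsRandomCantor.lintegral_regConst_le`).
Together, `E ‖Δ_j‖_p^p ≤ C M_j^{-η}` for some `η > 0`
(`IsRandomCantor.lintegral_lintegral_increment_le`), so `∑ ‖Δ_j‖_p < ∞` almost surely. The case of
level `0` of the same deterministic estimate puts `ν̂_0` in `L^p`.

For weak convergence, the same moment inequality with exponent `2` makes `ν̂_j(ξ)` converge almost
surely for each `ξ` of a countable dense set. As the measures `ν_j` live on a fixed compact set and
have bounded mass, they have cluster points, and a cluster point is determined by its Fourier
transform on a dense set (`exists_tendsto_of_tendsto_fourierMeasure`). The Fourier transform of the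
limit is the pointwise limit of the `ν̂_j`, and Fatou's lemma puts it in `L^p`; for `p = ∞` it is
bounded by the mass.
-/

noncomputable section

namespace MomentCantor

/-! ### Oscillatory integrals with polynomial phase -/

/-- The oscillating factor `exp(-2πi p(t))` with polynomial phase `p`. -/
def osc (p : Polynomial ℝ) (t : ℝ) : ℂ :=
  Complex.exp (-((2 * Real.pi * p.eval t : ℝ) : ℂ) * Complex.I)

lemma continuous_osc (p : Polynomial ℝ) : Continuous (osc p) := by
  unfold osc; fun_prop

lemma norm_osc (p : Polynomial ℝ) (t : ℝ) : ‖osc p t‖ = 1 := by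
  unfold osc
  rw [← Complex.ofReal_neg]
  exact Complex.norm_exp_ofReal_mul_I _

lemma norm_integral_osc_le (p : Polynomial ℝ) {a b : ℝ} (hab : a ≤ b) :
    ‖∫ t in a..b, osc p t‖ ≤ b - a := by
  have := intervalIntegral.norm_integral_le_of_norm_le_const (a := a) (b := b) (f := osc p) (C := 1)
    (fun t _ => (norm_osc p t).le)
  rwa [abs_of_nonneg (sub_nonneg.2 hab), one_mul] at this

/-- An integral that is at most `B` on each interval without a point of `Z` is at most `2 ^ #Z * B`:
every point of `Z` at most doubles the bound. -/
lemma norm_integral_le_of_cut {f : ℝ → ℂ} (hf : Continuous f) {B : ℝ} (Z : Finset ℝ) :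
    ∀ a b : ℝ, a < b → (∀ a' b', a ≤ a' → a' < b' → b' ≤ b → (∀ z ∈ Z, z ∉ Ioo a' b') →
      ‖∫ t in a'..b', f t‖ ≤ B) → ‖∫ t in a..b, f t‖ ≤ 2 ^ Z.card * B := by
  classical
  induction Z using Finset.induction_on with
  | empty =>
    intro a b hab H
    simpa using H a b le_rfl hab le_rfl (by simp)
  | insert z Z hz ih =>
    intro a b hab H
    rw [Finset.card_insert_of_notMem hz, pow_succ, mul_assoc]
    have hB : 0 ≤ 2 ^ Z.card * B := by
      obtain ⟨a', b', h1, h2, h3, h4⟩ : ∃ a' b', a ≤ a' ∧ a' < b' ∧ b' ≤ b ∧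
          ∀ w ∈ insert z Z, w ∉ Ioo a' b' := by
        obtain ⟨c, hc, hc'⟩ : ∃ c > a, ∀ w ∈ insert z Z, w ∉ Ioo a c := by
          have : ∀ᶠ c in 𝓝[>] a, ∀ w ∈ insert z Z, w ∉ Ioo a c := by
            rw [Filter.eventually_all_finset]
            intro w _
            rcases le_or_gt w a with h | h
            · exact Eventually.of_forall fun c hc => absurd hc.1 (not_lt.2 h)
            · filter_upwards [Ioo_mem_nhdsGT h] with c hc hw
              exact absurd hw.2 (not_lt.2 hc.2.le)
          obtain ⟨c, h1, h2⟩ := (this.and self_mem_nhdsWithin).exists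
          exact ⟨c, h2, h1⟩
        refine ⟨a, min b c, le_rfl, lt_min hab hc, min_le_left _ _, fun w hw h => hc' w hw ?_⟩
        exact ⟨h.1, h.2.trans_le (min_le_right _ _)⟩
      exact mul_nonneg (by positivity) ((norm_nonneg _).trans (H a' b' h1 h2 h3 h4))
    by_cases hzab : z ∈ Ioo a b
    · rw [← intervalIntegral.integral_add_adjacent_intervals (b := z)
        (hf.intervalIntegrable _ _) (hf.intervalIntegrable _ _)]
      refine (norm_add_le _ _).trans ?_
      have e1 := ih a z hzab.1 fun a' b' h1 h2 h3 h4 => H a' b' h1 h2 (h3.trans hzab.2.le) ?_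
      · have e2 := ih z b hzab.2 fun a' b' h1 h2 h3 h4 => H a' b' (hzab.1.le.trans h1) h2 h3 ?_
        · linarith
        · intro w hw
          rcases Finset.mem_insert.1 hw with rfl | hw
          · exact fun h => absurd h.1 (not_lt.2 h1)
          · exact h4 w hw
      · intro w hw
        rcases Finset.mem_insert.1 hw with rfl | hw
        · exact fun h => absurd h.2 (not_lt.2 h3)
        · exact h4 w hw
    · have e1 := ih a b hab fun a' b' h1 h2 h3 h4 => H a' b' h1 h2 h3 ?_
      · linarith
      · intro w hw
        rcases Finset.mem_insert.1 hw with rfl | hw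
        · exact fun h => hzab ⟨h1.trans_lt h.1, h.2.trans_le h3⟩
        · exact h4 w hw

/-- The first derivative test of van der Corput. -/
lemma norm_integral_osc_le_of_deriv (p : Polynomial ℝ) {a b h : ℝ} (hab : a < b) (hh : 0 < h)
    (h1 : ∀ t ∈ Icc a b, h ≤ |p.derivative.eval t|)
    (h2 : (∀ t ∈ Icc a b, 0 ≤ p.derivative.derivative.eval t) ∨
      (∀ t ∈ Icc a b, p.derivative.derivative.eval t ≤ 0)) :
    ‖∫ t in a..b, osc p t‖ ≤ 1 / h := by
  set u : ℝ → ℝ := fun t => (p.derivative.eval t)⁻¹ with hu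
  set u' : ℝ → ℝ := fun t => -p.derivative.derivative.eval t / (p.derivative.eval t) ^ 2 with hu'
  have hne : ∀ t ∈ Icc a b, p.derivative.eval t ≠ 0 := fun t ht h0 => by
    have := h1 t ht
    rw [h0, abs_zero] at this
    linarith
  have hub : ∀ t ∈ Icc a b, |u t| ≤ 1 / h := fun t ht => by
    rw [hu]; simp only [abs_inv]
    rw [one_div]
    exact inv_anti₀ hh (h1 t ht)
  have hIcc : uIcc a b = Icc a b := uIcc_of_le hab.le
  have du : ∀ t ∈ uIcc a b, HasDerivAt u (u' t) t := fun t ht => by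
    rw [hIcc] at ht
    exact (p.derivative.hasDerivAt t).inv (hne t ht)
  have cu' : ContinuousOn u' (uIcc a b) := by
    rw [hIcc]
    refine ContinuousOn.div (by fun_prop) (by fun_prop) fun t ht => pow_ne_zero _ (hne t ht)
  have iu' : IntervalIntegrable u' volume a b := cu'.intervalIntegrable
  have de : ∀ t, HasDerivAt (osc p)
      (osc p t * (-((2 * Real.pi * p.derivative.eval t : ℝ) : ℂ) * Complex.I)) t := fun t => by
    have : HasDerivAt (fun t : ℝ => -((2 * Real.pi * p.eval t : ℝ) : ℂ) * Complex.I)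
        (-((2 * Real.pi * p.derivative.eval t : ℝ) : ℂ) * Complex.I) t :=
      (((p.hasDerivAt t).const_mul (2 * Real.pi)).ofReal_comp.neg).mul_const _
    exact this.cexp
  set κ : ℂ := Complex.I / ((2 * Real.pi : ℝ) : ℂ) with hκ
  have hpi : ((2 * Real.pi : ℝ) : ℂ) ≠ 0 := by
    rw [Ne, Complex.ofReal_eq_zero]; positivity
  have dF : ∀ t ∈ uIcc a b, HasDerivAt (fun t => osc p t * (u t : ℂ) * κ)
      (osc p t + osc p t * (u' t : ℂ) * κ) t := fun t ht => by
    have := (((de t).mul (du t ht).ofReal_comp)).mul_const κ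
    refine this.congr_deriv ?_
    rw [hIcc] at ht
    have h0 : ((p.derivative.eval t : ℝ) : ℂ) ≠ 0 := by
      rw [Ne, Complex.ofReal_eq_zero]; exact hne t ht
    have : ((u t : ℝ) : ℂ) = ((p.derivative.eval t : ℝ) : ℂ)⁻¹ := by simp [hu]
    rw [this, hκ]
    push_cast at hpi ⊢
    have hI := Complex.I_mul_I
    have hpi' : (Real.pi : ℂ) ≠ 0 := by simp
    field_simp
    linear_combination (-2 : ℂ) * Real.pi * osc p t * hI
  have ie : IntervalIntegrable (osc p) volume a b := (continuous_osc p).intervalIntegrable _ _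
  have ieu : IntervalIntegrable (fun t => osc p t * (u' t : ℂ) * κ) volume a b := by
    apply ContinuousOn.intervalIntegrable
    exact ((continuous_osc p).continuousOn.mul
      (Complex.continuous_ofReal.comp_continuousOn cu')).mul continuousOn_const
  have FTC := intervalIntegral.integral_eq_sub_of_hasDerivAt dF (ie.add ieu)
  rw [intervalIntegral.integral_add ie ieu] at FTC
  have nκ : ‖κ‖ = 1 / (2 * Real.pi) := by
    rw [hκ, norm_div, Complex.norm_I, Complex.norm_real, Real.norm_of_nonneg (by positivity)]
  have ma : a ∈ Icc a b := left_mem_Icc.2 hab.le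
  have mb : b ∈ Icc a b := right_mem_Icc.2 hab.le
  have bF : ∀ t ∈ Icc a b, ‖osc p t * (u t : ℂ) * κ‖ ≤ 1 / h * (1 / (2 * Real.pi)) := fun t ht => by
    rw [norm_mul, norm_mul, norm_osc, nκ, one_mul, Complex.norm_real]
    exact mul_le_mul_of_nonneg_right (hub t ht) (by positivity)
  have abs_u' : ∫ t in a..b, |u' t| ≤ 2 / h := by
    have key : ∫ t in a..b, u' t = u b - u a := intervalIntegral.integral_eq_sub_of_hasDerivAt du iu'
    have ha := abs_le.1 (hub a ma)
    have hb := abs_le.1 (hub b mb)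
    have e2 : 2 / h = 1 / h + 1 / h := by ring
    rcases h2 with h2 | h2
    · have : ∫ t in a..b, |u' t| = ∫ t in a..b, -u' t := by
        refine intervalIntegral.integral_congr fun t ht => ?_
        rw [hIcc] at ht
        refine abs_of_nonpos ?_
        exact div_nonpos_of_nonpos_of_nonneg (neg_nonpos.2 (h2 t ht)) (sq_nonneg _)
      rw [this, intervalIntegral.integral_neg, key]
      linarith [ha.1, ha.2, hb.1, hb.2]
    · have : ∫ t in a..b, |u' t| = ∫ t in a..b, u' t := by
        refine intervalIntegral.integral_congr fun t ht => ?_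
        rw [hIcc] at ht
        refine abs_of_nonneg ?_
        exact div_nonneg (neg_nonneg.2 (h2 t ht)) (sq_nonneg _)
      rw [this, key]
      linarith [ha.1, ha.2, hb.1, hb.2]
  have bI : ‖∫ t in a..b, osc p t * (u' t : ℂ) * κ‖ ≤ 2 / h * (1 / (2 * Real.pi)) := by
    refine (intervalIntegral.norm_integral_le_integral_norm hab.le).trans ?_
    have : ∫ t in a..b, ‖osc p t * (u' t : ℂ) * κ‖ = (∫ t in a..b, |u' t|) * (1 / (2 * Real.pi)) := by
      rw [← intervalIntegral.integral_mul_const]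
      refine intervalIntegral.integral_congr fun t _ => ?_
      simp only [norm_mul, norm_osc, nκ, one_mul, Complex.norm_real, Real.norm_eq_abs]
    rw [this]
    exact mul_le_mul_of_nonneg_right abs_u' (by positivity)
  have E : ∫ t in a..b, osc p t = osc p b * (u b : ℂ) * κ - osc p a * (u a : ℂ) * κ -
      ∫ t in a..b, osc p t * (u' t : ℂ) * κ := by
    rw [← FTC]; ring
  rw [E]
  refine (norm_sub_le _ _).trans ?_
  have := (norm_sub_le (osc p b * (u b : ℂ) * κ) (osc p a * (u a : ℂ) * κ))
  have e3 := bF a ma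
  have e4 := bF b mb
  have hpi3 := Real.pi_gt_three
  have : 1 / h * (1 / (2 * Real.pi)) + 1 / h * (1 / (2 * Real.pi)) + 2 / h * (1 / (2 * Real.pi)) ≤
      1 / h := by
    have : 1 / h * (1 / (2 * Real.pi)) + 1 / h * (1 / (2 * Real.pi)) + 2 / h * (1 / (2 * Real.pi))
      = 1 / h * (2 / Real.pi) := by field_simp; ring
    rw [this]
    have : 2 / Real.pi ≤ 1 := by rw [div_le_one (by positivity)]; linarith
    exact mul_le_of_le_one_right (by positivity) this
  linarith

lemma eval_nonneg_of_no_root (q : Polynomial ℝ) {a b t₀ : ℝ} (hab : a < b)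
    (hq : ∀ z ∈ q.roots.toFinset, z ∉ Ioo a b) (ht : t₀ ∈ Ioo a b) (h0 : 0 ≤ q.eval t₀) :
    ∀ t ∈ Icc a b, 0 ≤ q.eval t := by
  by_cases hq0 : q = 0
  · simp [hq0]
  have hne : ∀ t ∈ Ioo a b, q.eval t ≠ 0 := fun t ht' h =>
    hq t (by simp [hq0, Polynomial.IsRoot, h]) ht'
  have hIoo : ∀ t ∈ Ioo a b, 0 ≤ q.eval t := by
    intro t ht'
    by_contra! hneg
    have hpc : IsPreconnected ((fun t => q.eval t) '' Ioo a b) :=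
      isPreconnected_Ioo.image _ q.continuous.continuousOn
    have := hpc.Icc_subset (mem_image_of_mem _ ht') (mem_image_of_mem _ ht)
    obtain ⟨z, hz, hz0⟩ := this ⟨hneg.le, h0⟩
    exact hne z hz hz0
  intro t ht'
  rw [← closure_Ioo hab.ne] at ht'
  exact closure_minimal (t := {t | 0 ≤ q.eval t}) hIoo
    (isClosed_le continuous_const q.continuous) ht'

lemma eval_nonpos_of_no_root (q : Polynomial ℝ) {a b t₀ : ℝ} (hab : a < b)
    (hq : ∀ z ∈ q.roots.toFinset, z ∉ Ioo a b) (ht : t₀ ∈ Ioo a b) (h0 : q.eval t₀ ≤ 0) :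
    ∀ t ∈ Icc a b, q.eval t ≤ 0 := by
  intro t ht'
  have := eval_nonneg_of_no_root (-q) hab (by rwa [Polynomial.roots_neg]) ht (by simpa using h0) t ht'
  simpa using this

lemma natDegree_iterate_derivative_le (p : Polynomial ℝ) (e : ℕ) :
    (Polynomial.derivative^[e] p).natDegree ≤ p.natDegree :=
  (Polynomial.natDegree_iterate_derivative p e).trans (Nat.sub_le _ _)

/-- The polynomial `(p⁽ᵉ⁾)² - c²`, whose roots are the points where `|p⁽ᵉ⁾|` crosses `|c|`. -/
def levelPoly (p : Polynomial ℝ) (e : ℕ) (c : ℝ) : Polynomial ℝ :=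
  (Polynomial.derivative^[e] p) ^ 2 - Polynomial.C (c ^ 2)

lemma eval_levelPoly (p : Polynomial ℝ) (e : ℕ) (c t : ℝ) :
    (levelPoly p e c).eval t = ((Polynomial.derivative^[e] p).eval t) ^ 2 - c ^ 2 := by
  simp [levelPoly]

lemma card_roots_levelPoly_le {p : Polynomial ℝ} {d : ℕ} (hp : p.natDegree ≤ d) (e : ℕ) (c : ℝ) :
    (levelPoly p e c).roots.toFinset.card ≤ 2 * d := by
  refine (Multiset.toFinset_card_le _).trans ((Polynomial.card_roots' _).trans ?_)
  refine (Polynomial.natDegree_sub_le _ _).trans (max_le ?_ (by simp))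
  refine Polynomial.natDegree_pow_le.trans ?_
  exact Nat.mul_le_mul_left 2 ((natDegree_iterate_derivative_le p e).trans hp)

/-- If at each point of `[a, b]` some derivative of the phase satisfies `|p⁽ᵉ⁾| > hᵉ`, then the
oscillatory integral is `O(1 / h)`. On an interval where no `|p⁽ᵉ⁾|` crosses `hᵉ`, take the least `e`
with `|p⁽ᵉ⁾| ≥ hᵉ`: for `e = 1` the first derivative test applies, and for `e ≥ 2` the bound
`|p⁽ᵉ⁻¹⁾| ≤ hᵉ⁻¹` makes the interval short. -/
lemma norm_integral_osc_le_of_large {d : ℕ} {p : Polynomial ℝ} (hp : p.natDegree ≤ d)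
    {a b h : ℝ} (hab : a < b) (hh : 0 < h)
    (H : ∀ t ∈ Icc a b, ∃ e, 1 ≤ e ∧ e ≤ d ∧ h ^ e < |(Polynomial.derivative^[e] p).eval t|) :
    ‖∫ t in a..b, osc p t‖ ≤ 2 ^ (d + d * (2 * d)) * (2 / h) := by
  classical
  set Z : Finset ℝ := (Polynomial.derivative^[2] p).roots.toFinset ∪
    (Finset.Icc 1 d).biUnion fun e => (levelPoly p e (h ^ e)).roots.toFinset with hZ
  have hcard : Z.card ≤ d + d * (2 * d) := by
    refine (Finset.card_union_le _ _).trans (add_le_add ?_ ?_)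
    · refine (Multiset.toFinset_card_le _).trans ((Polynomial.card_roots' _).trans ?_)
      exact (natDegree_iterate_derivative_le p 2).trans hp
    · refine Finset.card_biUnion_le.trans ?_
      refine (Finset.sum_le_card_nsmul _ _ _ fun e _ => card_roots_levelPoly_le hp e _).trans ?_
      simp
  refine (norm_integral_le_of_cut (continuous_osc p) (B := 2 / h) Z a b hab ?_).trans ?_
  swap
  · gcongr
    norm_num
  intro a' b' ha' hab' hb' hZ'
  have ht0 : (a' + b') / 2 ∈ Ioo a' b' := ⟨by linarith, by linarith⟩
  set t₀ := (a' + b') / 2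
  have hex := H t₀ ⟨ha'.trans ht0.1.le, ht0.2.le.trans hb'⟩
  have hlev : ∀ e, 1 ≤ e → e ≤ d → ∀ z ∈ (levelPoly p e (h ^ e)).roots.toFinset, z ∉ Ioo a' b' := by
    intro e h1 h2 z hz
    refine hZ' z (Finset.mem_union_right _ (Finset.mem_biUnion.2 ⟨e, Finset.mem_Icc.2 ⟨h1, h2⟩, hz⟩))
  obtain ⟨he1, hed, helt⟩ := Nat.find_spec hex
  have hmin := fun k => Nat.find_min hex (m := k)
  set e := Nat.find hex
  have hbig : ∀ t ∈ Icc a' b', h ^ e ≤ |(Polynomial.derivative^[e] p).eval t| := by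
    intro t ht
    have := eval_nonneg_of_no_root _ hab' (hlev e he1 hed) ht0 (by
      rw [eval_levelPoly, sub_nonneg, ← sq_abs ((Polynomial.derivative^[e] p).eval t₀)]
      gcongr) t ht
    rw [eval_levelPoly, sub_nonneg] at this
    exact (abs_of_pos (pow_pos hh e)).symm.le.trans (sq_le_sq.1 this)
  rcases Nat.lt_or_ge 1 e with he | he
  · -- the interval is short
    have hsmall : ∀ t ∈ Icc a' b', |(Polynomial.derivative^[e - 1] p).eval t| ≤ h ^ (e - 1) := by
      intro t ht
      have h0 : |(Polynomial.derivative^[e - 1] p).eval t₀| ≤ h ^ (e - 1) := by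
        by_contra! hcon
        exact hmin (e - 1) (by omega) ⟨by omega, by omega, hcon⟩
      have := eval_nonpos_of_no_root _ hab' (hlev (e - 1) (by omega) (by omega)) ht0 (by
        rw [eval_levelPoly, sub_nonpos, ← sq_abs ((Polynomial.derivative^[e - 1] p).eval t₀)]
        gcongr) t ht
      rw [eval_levelPoly, sub_nonpos] at this
      exact (sq_le_sq.1 this).trans (abs_of_pos (pow_pos hh _)).le
    obtain ⟨c, hc, hceq⟩ := exists_deriv_eq_slope
      (fun t => (Polynomial.derivative^[e - 1] p).eval t) hab'
      (Polynomial.continuous _).continuousOn (Polynomial.differentiable _).differentiableOn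
    rw [Polynomial.deriv, ← Function.iterate_succ_apply' Polynomial.derivative,
      show (e - 1).succ = e by omega, eq_div_iff (by linarith)] at hceq
    have hbc := hbig c (Ioo_subset_Icc_self hc)
    have e1 := hsmall a' (left_mem_Icc.2 hab'.le)
    have e2 := hsmall b' (right_mem_Icc.2 hab'.le)
    have e3 : h ^ e * (b' - a') ≤ 2 * h ^ (e - 1) := by
      calc h ^ e * (b' - a') ≤ |(Polynomial.derivative^[e] p).eval c| * (b' - a') := by
            gcongr
        _ = |(Polynomial.derivative^[e] p).eval c * (b' - a')| := by
            rw [abs_mul, abs_of_pos (by linarith : 0 < b' - a')]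
        _ ≤ _ := by
            rw [hceq]
            refine (abs_sub _ _).trans ?_
            linarith
    have e4 : b' - a' ≤ 2 / h := by
      rw [le_div_iff₀ hh]
      have hpe : h ^ e = h ^ (e - 1) * h := by rw [← pow_succ]; congr 1; omega
      rw [hpe] at e3
      have := pow_pos hh (e - 1)
      nlinarith
    exact (norm_integral_osc_le p hab'.le).trans e4
  · have he : e = 1 := le_antisymm he he1
    rw [he] at hbig
    have := norm_integral_osc_le_of_deriv p hab' hh (by simpa using hbig) (by
      have hr : ∀ z ∈ (Polynomial.derivative^[2] p).roots.toFinset, z ∉ Ioo a' b' := fun z hz =>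
        hZ' z (Finset.mem_union_left _ hz)
      rcases le_total 0 ((Polynomial.derivative^[2] p).eval t₀) with h | h
      · exact Or.inl (eval_nonneg_of_no_root _ hab' hr ht0 h)
      · exact Or.inr (eval_nonpos_of_no_root _ hab' hr ht0 h))
    refine this.trans ?_
    gcongr
    norm_num

/-! ### Polynomials that are small at many separated points -/

/-- Mean values of the derivative over `2ᵉ⁻¹` disjoint pairs of neighbouring points are again
separated; iterating gives a point where the `e`-th derivative is small. -/
lemma exists_iterate_derivative_le {r : ℝ} (hr : 0 < r) (e : ℕ) :
    ∀ (q : Polynomial ℝ) (y : ℕ → ℝ) (H : ℝ), (∀ a, a + 1 < 2 ^ e → y a + r ≤ y (a + 1)) →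
      (∀ a < 2 ^ e, |q.eval (y a)| ≤ H) →
      ∃ z ∈ Icc (y 0) (y (2 ^ e - 1)), |(Polynomial.derivative^[e] q).eval z| ≤ (2 / r) ^ e * H := by
  induction e with
  | zero =>
    intro q y H _ h2
    exact ⟨y 0, by simp, by simpa using h2 0 (by simp)⟩
  | succ e ih =>
    intro q y H h1 h2
    have hH : 0 ≤ H := (abs_nonneg _).trans (h2 0 (by positivity))
    have hpow : 2 ^ (e + 1) = 2 * 2 ^ e := by ring
    have hz : ∀ a, ∃ z, a < 2 ^ e →
        z ∈ Ioo (y (2 * a)) (y (2 * a + 1)) ∧ |q.derivative.eval z| ≤ 2 / r * H := by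
      intro a
      by_cases ha : a < 2 ^ e
      · have h3 := h1 (2 * a) (by omega)
        obtain ⟨c, hc, hceq⟩ := exists_deriv_eq_slope (fun t => q.eval t)
          (by linarith : y (2 * a) < y (2 * a + 1))
          q.continuous.continuousOn q.differentiable.differentiableOn
        refine ⟨c, fun _ => ⟨hc, ?_⟩⟩
        rw [Polynomial.deriv] at hceq
        rw [hceq, abs_div, abs_of_pos (by linarith : 0 < y (2 * a + 1) - y (2 * a)),
          div_le_iff₀ (by linarith)]
        have h4 := h2 (2 * a) (by omega)
        have h5 := h2 (2 * a + 1) (by omega)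
        have h6 : 2 / r * H * r ≤ 2 / r * H * (y (2 * a + 1) - y (2 * a)) := by
          gcongr
          linarith
        have h7 : 2 / r * H * r = 2 * H := by field_simp
        have := abs_sub (q.eval (y (2 * a + 1))) (q.eval (y (2 * a)))
        linarith
      · exact ⟨0, fun h => absurd h ha⟩
    choose z hz using hz
    obtain ⟨w, hw, hwle⟩ := ih q.derivative z (2 / r * H) (fun a ha => by
      have h3 := (hz a (by omega)).1.2
      have h4 := (hz (a + 1) ha).1.1
      have h5 := h1 (2 * a + 1) (by omega)
      rw [show 2 * (a + 1) = 2 * a + 1 + 1 by ring] at h4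
      linarith) (fun a ha => (hz a ha).2)
    have hpos : 0 < 2 ^ e := by positivity
    refine ⟨w, ⟨?_, ?_⟩, ?_⟩
    · exact ((hz 0 hpos).1.1.le).trans hw.1
    · refine hw.2.trans ((hz (2 ^ e - 1) (by omega)).1.2.le.trans (le_of_eq ?_))
      congr 1; omega
    · rw [Function.iterate_succ_apply]
      refine hwle.trans (le_of_eq ?_)
      ring

/-- A polynomial which is at most `H` at sufficiently many `r`-separated points has, at one of them,
all derivatives bounded as if it were bounded on an interval of length `r`. -/
lemma exists_forall_iterate_derivative_le {D : ℕ} {q : Polynomial ℝ} (hq : q.natDegree ≤ D)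
    {r H : ℝ} (hr : 0 < r) (X : Finset ℝ) (hX : ∀ x ∈ X, ∀ x' ∈ X, x < x' → x + r ≤ x')
    (hH : ∀ x ∈ X, |q.eval x| ≤ H) (hcard : ((D + 1) * (2 * D) + 1) * 2 ^ D < X.card) :
    ∃ x ∈ X, ∀ e ≤ D, |(Polynomial.derivative^[e] q).eval x| ≤ (2 / r) ^ e * H := by
  classical
  obtain ⟨x₁, hx₁⟩ := Finset.card_pos.1 (by exact lt_of_le_of_lt (Nat.zero_le _) hcard : 0 < X.card)
  have hH0 : 0 ≤ H := (abs_nonneg _).trans (hH x₁ hx₁)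
  set Z : Finset ℝ := (Finset.range (D + 1)).biUnion
    fun e => (levelPoly q e ((2 / r) ^ e * H)).roots.toFinset with hZ
  have hZcard : Z.card ≤ (D + 1) * (2 * D) := by
    refine Finset.card_biUnion_le.trans ?_
    refine (Finset.sum_le_card_nsmul _ _ _ fun e _ => card_roots_levelPoly_le hq e _).trans ?_
    simp
  obtain ⟨v, -, hv⟩ := Finset.exists_lt_card_fiber_of_mul_lt_card_of_maps_to
    (s := X) (t := Finset.range ((D + 1) * (2 * D) + 1)) (n := 2 ^ D)
    (f := fun x => (Z.filter (· ≤ x)).card) (fun x _ => by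
      rw [Finset.mem_range, Nat.lt_succ_iff]
      exact (Finset.card_filter_le _ _).trans hZcard) (by simpa using hcard)
  -- The points of `F` all lie in one interval between consecutive points of `Z`.
  set F := X.filter fun x => (Z.filter (· ≤ x)).card = v with hF
  have hFX : ∀ x ∈ F, x ∈ X := fun x hx => (Finset.mem_filter.1 hx).1
  have hFpos : 0 < F.card := (Nat.zero_le _).trans_lt hv
  set y : ℕ → ℝ := fun a => F.orderEmbOfFin rfl ⟨min a (F.card - 1), by omega⟩ with hy
  have hyF : ∀ a, y a ∈ F := fun a => Finset.orderEmbOfFin_mem _ _ _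
  refine ⟨y 0, hFX _ (hyF 0), fun e he => ?_⟩
  by_contra! hcon
  have h2e : 2 ^ e ≤ 2 ^ D := Nat.pow_le_pow_right (by norm_num) he
  obtain ⟨z, hz, hzle⟩ := exists_iterate_derivative_le hr e q y H (fun a ha => by
    refine hX _ (hFX _ (hyF a)) _ (hFX _ (hyF _)) ?_
    refine (F.orderEmbOfFin rfl).strictMono ?_
    rw [Fin.mk_lt_mk]
    omega) (fun a _ => hH _ (hFX _ (hyF a)))
  have hc0 : 0 ≤ (2 / r) ^ e * H := by positivity
  -- the level polynomial changes sign on `[y 0, z]`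
  have p0 : 0 < (levelPoly q e ((2 / r) ^ e * H)).eval (y 0) := by
    rw [eval_levelPoly, sub_pos, ← sq_abs ((Polynomial.derivative^[e] q).eval _)]
    gcongr
  have p1 : (levelPoly q e ((2 / r) ^ e * H)).eval z ≤ 0 := by
    rw [eval_levelPoly, sub_nonpos, ← sq_abs ((Polynomial.derivative^[e] q).eval _)]
    gcongr
  obtain ⟨w, hw, hw0⟩ := intermediate_value_Icc' hz.1
    (levelPoly q e ((2 / r) ^ e * H)).continuous.continuousOn ⟨p1, p0.le⟩
  have hwZ : w ∈ Z := by
    refine Finset.mem_biUnion.2 ⟨e, Finset.mem_range.2 (by omega), ?_⟩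
    rw [Multiset.mem_toFinset, Polynomial.mem_roots']
    exact ⟨fun h => by simp [h] at p0, hw0⟩
  have hwy : y 0 < w := lt_of_le_of_ne hw.1 fun h => by
    simp only at hw0
    rw [← h] at hw0; linarith
  have hwl : w ≤ y (2 ^ e - 1) := hw.2.trans hz.2
  have hlt : (Z.filter (· ≤ y 0)).card < (Z.filter (· ≤ y (2 ^ e - 1))).card := by
    refine Finset.card_lt_card ?_
    rw [Finset.ssubset_iff_of_subset]
    · exact ⟨w, Finset.mem_filter.2 ⟨hwZ, hwl⟩, fun h => by
        have := (Finset.mem_filter.1 h).2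
        linarith⟩
    · exact Finset.monotone_filter_right _ fun x _ h => h.trans (hwy.le.trans hwl)
  have f1 := (Finset.mem_filter.1 (hyF 0)).2
  have f2 := (Finset.mem_filter.1 (hyF (2 ^ e - 1))).2
  omega

/-! ### Boxes in frequency space -/

/-- The phase polynomial `⟨γ_d(t), ξ⟩ = ∑ᵢ ξᵢ tⁱ⁺¹`. -/
def phase {d : ℕ} (ξ : EuclideanSpace ℝ (Fin d)) : Polynomial ℝ :=
  ∑ i : Fin d, Polynomial.C (ξ i) * Polynomial.X ^ ((i : ℕ) + 1)

lemma natDegree_phase_le {d : ℕ} (ξ : EuclideanSpace ℝ (Fin d)) : (phase ξ).natDegree ≤ d := by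
  refine Polynomial.natDegree_sum_le_of_forall_le _ _ fun i _ => ?_
  exact (Polynomial.natDegree_C_mul_X_pow_le _ _).trans i.2

lemma eval_phase {d : ℕ} (ξ : EuclideanSpace ℝ (Fin d)) (t : ℝ) :
    (phase ξ).eval t = inner ℝ (momentCurve d t) ξ := by
  simp [phase, momentCurve, Polynomial.eval_finsetSum, PiLp.inner_apply]

/-- The frequencies `ξ` for which the derivatives of the phase at `t` satisfy
`|∂ᵉ⟨γ_d(t), ξ⟩| ≤ A ρᵉ`, `1 ≤ e ≤ d`. -/
def box (d : ℕ) (t A ρ : ℝ) : Set (EuclideanSpace ℝ (Fin d)) :=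
  {ξ | ∀ e, 1 ≤ e → e ≤ d → |(Polynomial.derivative^[e] (phase ξ)).eval t| ≤ A * ρ ^ e}

/-- The matrix of `ξ ↦ (∂ᵉ⟨γ_d(t), ξ⟩)_{1 ≤ e ≤ d}`. -/
def jetMatrix (d : ℕ) (t : ℝ) : Matrix (Fin d) (Fin d) ℝ :=
  fun i k => (Polynomial.derivative^[(i : ℕ) + 1] (Polynomial.X ^ ((k : ℕ) + 1) : Polynomial ℝ)).eval t

lemma jetMatrix_mulVec {d : ℕ} (t : ℝ) (ξ : EuclideanSpace ℝ (Fin d)) (i : Fin d) :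
    (jetMatrix d t).mulVec (fun k => ξ k) i =
      (Polynomial.derivative^[(i : ℕ) + 1] (phase ξ)).eval t := by
  simp only [Matrix.mulVec, dotProduct, jetMatrix, phase, Polynomial.iterate_derivative_sum,
    Polynomial.iterate_derivative_C_mul, Polynomial.eval_finsetSum, Polynomial.eval_mul,
    Polynomial.eval_C]
  exact Finset.sum_congr rfl fun k _ => mul_comm _ _

/-- The matrix is triangular, with the factorials `1!, …, d!` on the diagonal. -/
lemma one_le_det_jetMatrix (d : ℕ) (t : ℝ) : 1 ≤ (jetMatrix d t).det := by
  rw [Matrix.det_of_isUpperTriangular]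
  · refine Finset.prod_induction _ (fun x : ℝ => 1 ≤ x) (fun _ _ => one_le_mul_of_one_le_of_one_le)
      le_rfl fun i _ => ?_
    rw [jetMatrix, Polynomial.iterate_derivative_X_pow_eq_C_mul, Nat.sub_self, pow_zero, mul_one,
      Polynomial.eval_C, Nat.descFactorial_self]
    exact_mod_cast Nat.one_le_iff_ne_zero.2 (Nat.factorial_ne_zero _)
  · intro i k hik
    have : (Polynomial.derivative^[(i : ℕ) + 1] (Polynomial.X ^ ((k : ℕ) + 1) : Polynomial ℝ)) = 0 :=
      Polynomial.iterate_derivative_eq_zero (by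
        rw [Polynomial.natDegree_X_pow]
        have : (k : ℕ) < i := hik
        omega)
    simp [jetMatrix, this]

lemma continuous_iterate_derivative_phase (d e : ℕ) (t : ℝ) :
    Continuous fun ξ : EuclideanSpace ℝ (Fin d) =>
      (Polynomial.derivative^[e] (phase ξ)).eval t := by
  simp only [phase, Polynomial.iterate_derivative_sum,
    Polynomial.iterate_derivative_C_mul, Polynomial.eval_finsetSum, Polynomial.eval_mul,
    Polynomial.eval_C]
  fun_prop

lemma measurableSet_box (d : ℕ) (t A ρ : ℝ) : MeasurableSet (box d t A ρ) := by
  have : box d t A ρ = ⋂ e, ⋂ (_ : 1 ≤ e), ⋂ (_ : e ≤ d),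
      {ξ | |(Polynomial.derivative^[e] (phase ξ)).eval t| ≤ A * ρ ^ e} := by
    ext ξ; simp [box]
  rw [this]
  refine IsClosed.measurableSet ?_
  refine isClosed_iInter fun e => isClosed_iInter fun _ => isClosed_iInter fun _ => ?_
  exact isClosed_le (continuous_iterate_derivative_phase d e t).abs continuous_const

lemma sum_range_succ_eq (d : ℕ) : ∑ i : Fin d, ((i : ℕ) + 1) = d * (d + 1) / 2 := by
  rw [Fin.sum_univ_eq_sum_range (fun i => i + 1) d]
  have h1 := Finset.sum_range_succ' (fun i => i) d
  have h2 := Finset.sum_range_id (d + 1)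
  simp only [add_zero] at h1
  rw [← h1, h2, Nat.add_sub_cancel, mul_comm]

/-- The `e`-th derivative of the phase ranges over an interval of length `2 A ρᵉ`, and the linear map from
`ξ` to the derivatives has determinant at least `1`. -/
lemma volume_box_le (d : ℕ) (t : ℝ) {A ρ : ℝ} (hA : 0 ≤ A) (hρ : 0 ≤ ρ) :
    volume (box d t A ρ) ≤ ENNReal.ofReal ((2 * A) ^ d * ρ ^ (d * (d + 1) / 2)) := by
  set Q : Set (Fin d → ℝ) := Set.pi univ fun i => Icc (-(A * ρ ^ ((i : ℕ) + 1))) (A * ρ ^ ((i : ℕ) + 1))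
  have hdet := one_le_det_jetMatrix d t
  have e1 : volume (box d t A ρ) = volume ((jetMatrix d t).toLin' ⁻¹' Q) := by
    rw [← (PiLp.volume_preserving_toLp (Fin d)).measure_preimage
      (measurableSet_box d t A ρ).nullMeasurableSet]
    congr 1
    ext v
    have hmul : ∀ i, (jetMatrix d t).mulVec v i =
        (Polynomial.derivative^[(i : ℕ) + 1] (phase (WithLp.toLp 2 v))).eval t :=
      fun i => jetMatrix_mulVec t (WithLp.toLp 2 v) i
    simp only [mem_preimage, box, mem_ofPred_eq, Q, Matrix.toLin'_apply, mem_univ_pi, mem_Icc,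
      ← abs_le, hmul]
    constructor
    · exact fun h i => h _ (by omega) i.2
    · intro h e h1 h2
      have := h ⟨e - 1, by omega⟩
      simpa only [Nat.sub_add_cancel h1] using this
  rw [e1, Measure.addHaar_preimage_linearMap _ (by rw [LinearMap.det_toLin']; positivity),
    LinearMap.det_toLin']
  have e2 : volume Q = ENNReal.ofReal ((2 * A) ^ d * ρ ^ (d * (d + 1) / 2)) := by
    rw [volume_pi_pi]
    simp only [Real.volume_Icc]
    rw [← ENNReal.ofReal_prod_of_nonneg (fun i _ => by
      have : 0 ≤ A * ρ ^ ((i : ℕ) + 1) := by positivity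
      linarith)]
    congr 1
    rw [← sum_range_succ_eq, ← Finset.prod_pow_eq_pow_sum]
    calc _ = ∏ i : Fin d, ((2 * A) * ρ ^ ((i : ℕ) + 1)) := Finset.prod_congr rfl fun i _ => by ring
      _ = _ := by rw [Finset.prod_mul_distrib]; simp
  rw [e2]
  refine mul_le_of_le_one_left zero_le ?_
  rw [ENNReal.ofReal_le_one, abs_of_pos (by positivity)]
  exact inv_le_one_of_one_le₀ hdet

/-- Descending induction on `e`, by the mean value inequality from `t` to `t'`. -/
lemma abs_iterate_derivative_le_of_near {d : ℕ} {p : Polynomial ℝ} (hp : p.natDegree ≤ d)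
    {t A ρ : ℝ} (hA : 0 ≤ A) (hρ : 0 < ρ)
    (H : ∀ e, 1 ≤ e → e ≤ d → |(Polynomial.derivative^[e] p).eval t| ≤ A * ρ ^ e) (k : ℕ) :
    ∀ e, 1 ≤ e → e + k = d + 1 → ∀ t', |t' - t| ≤ 1 / ρ →
      |(Polynomial.derivative^[e] p).eval t'| ≤ k * (A * ρ ^ e) := by
  induction k with
  | zero =>
    intro e _ h2 t' _
    rw [Polynomial.iterate_derivative_eq_zero (by omega)]
    simp
  | succ k ih =>
    intro e h1 h2 t' ht'
    have hd : ∀ x ∈ uIcc t t', ‖deriv (fun s => (Polynomial.derivative^[e] p).eval s) x‖ ≤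
        k * (A * ρ ^ (e + 1)) := by
      intro x hx
      rw [Polynomial.deriv, ← Function.iterate_succ_apply' Polynomial.derivative, Real.norm_eq_abs]
      refine ih (e + 1) (by omega) (by omega) x ?_
      rw [abs_sub_comm] at ht' ⊢
      rw [abs_sub_comm]
      exact (abs_sub_left_of_mem_uIcc hx).trans (by rwa [abs_sub_comm])
    have := (convex_uIcc t t').norm_image_sub_le_of_norm_deriv_le
      (fun x _ => (Polynomial.differentiable _).differentiableAt) hd left_mem_uIcc right_mem_uIcc
    rw [Real.norm_eq_abs, Real.norm_eq_abs] at this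
    have h3 := H e h1 (by omega)
    have h4 : k * (A * ρ ^ (e + 1)) * |t' - t| ≤ k * (A * ρ ^ (e + 1)) * (1 / ρ) := by gcongr
    have h5 : k * (A * ρ ^ (e + 1)) * (1 / ρ) = k * (A * ρ ^ e) := by
      rw [pow_succ]; field_simp
    have h6 := abs_sub_abs_le_abs_sub ((Polynomial.derivative^[e] p).eval t')
      ((Polynomial.derivative^[e] p).eval t)
    push_cast
    linarith

lemma box_subset_of_near {d : ℕ} {t t' A ρ : ℝ} (hA : 0 ≤ A) (hρ : 0 < ρ)
    (ht : |t' - t| ≤ 1 / ρ) : box d t A ρ ⊆ box d t' (d * A) ρ := by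
  intro ξ hξ e h1 h2
  refine (abs_iterate_derivative_le_of_near (natDegree_phase_le ξ) hA hρ hξ (d + 1 - e) e h1
    (by omega) t' ht).trans ?_
  rw [mul_assoc]
  gcongr
  omega

/-! ### The tree of cells -/

lemma scale_zero (m : ℕ → ℕ) : scale m 0 = 1 := by simp [scale]

lemma scale_succ (m : ℕ → ℕ) (j : ℕ) : scale m (j + 1) = scale m j * m (j + 1) := by
  rw [scale, Finset.prod_Icc_succ_top (by omega)]; rfl

lemma scale_pos {m : ℕ → ℕ} (hm : IsAdmissible m) (j : ℕ) : 0 < scale m j :=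
  Finset.prod_pos fun i hi => lt_of_lt_of_le (by norm_num) (hm.two_le i (Finset.mem_Icc.1 hi).1)

lemma scale_pos_real {m : ℕ → ℕ} (hm : IsAdmissible m) (j : ℕ) : (0 : ℝ) < scale m j :=
  Nat.cast_pos.2 (scale_pos hm j)

lemma one_le_scale_real {m : ℕ → ℕ} (hm : IsAdmissible m) (j : ℕ) : (1 : ℝ) ≤ scale m j :=
  Nat.one_le_cast.2 (scale_pos hm j)

lemma scale_dvd (m : ℕ → ℕ) {i j : ℕ} (h : i ≤ j) : scale m i ∣ scale m j :=
  Finset.prod_dvd_prod_of_subset _ _ _ (Finset.Icc_subset_Icc_right h)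

lemma scale_mono {m : ℕ → ℕ} (hm : IsAdmissible m) {i j : ℕ} (h : i ≤ j) :
    scale m i ≤ scale m j := Nat.le_of_dvd (scale_pos hm j) (scale_dvd m h)

lemma two_pow_le_scale {m : ℕ → ℕ} (hm : IsAdmissible m) (j : ℕ) : 2 ^ j ≤ scale m j := by
  induction j with
  | zero => simp [scale_zero]
  | succ j ih =>
    rw [scale_succ, pow_succ]
    exact Nat.mul_le_mul ih (hm.two_le _ (by omega))

lemma le_of_le_admissible {m : ℕ → ℕ} (hm : IsAdmissible m) {i j : ℕ} (h0 : 1 ≤ i) (h : i ≤ j) :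
    m i ≤ m j := by
  induction j, h using Nat.le_induction with
  | base => exact le_rfl
  | succ j hj ih => exact ih.trans (hm.le_succ j (h0.trans hj))

/-- The index of the level `i` cell that contains the level `j` cell of index `l`. -/
def ancestor (m : ℕ → ℕ) (i j l : ℕ) : ℕ := l / (scale m j / scale m i)

lemma ancestor_self {m : ℕ → ℕ} (hm : IsAdmissible m) (j l : ℕ) : ancestor m j j l = l := by
  rw [ancestor, Nat.div_self (scale_pos hm j), Nat.div_one]

lemma ancestor_succ {m : ℕ → ℕ} {i j : ℕ} (h : i ≤ j) (l : ℕ) :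
    ancestor m i (j + 1) l = ancestor m i j (l / m (j + 1)) := by
  rw [ancestor, ancestor, Nat.div_div_eq_div_mul, scale_succ,
    Nat.mul_comm, Nat.mul_div_assoc _ (scale_dvd m h)]

lemma ancestor_zero {m : ℕ → ℕ} {j l : ℕ} (hl : l < scale m j) : ancestor m 0 j l = 0 := by
  rw [ancestor, scale_zero, Nat.div_one]
  exact Nat.div_eq_of_lt hl

lemma cell_subset_ancestor {m : ℕ → ℕ} (hm : IsAdmissible m) {i j : ℕ} (h : i ≤ j) (l : ℕ) :
    Icc ((l : ℝ) / scale m j) (((l : ℝ) + 1) / scale m j) ⊆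
      Icc ((ancestor m i j l : ℝ) / scale m i) (((ancestor m i j l : ℝ) + 1) / scale m i) := by
  obtain ⟨D, hD⟩ := scale_dvd m h
  have hi := scale_pos_real hm i
  have hD0 : 0 < D := Nat.pos_of_ne_zero fun h0 => by
    have := scale_pos hm j
    simp [hD, h0] at this
  have hDr : (0 : ℝ) < D := Nat.cast_pos.2 hD0
  have ha : ancestor m i j l = l / D := by
    rw [ancestor, hD, Nat.mul_div_cancel_left _ (scale_pos hm i)]
  rw [ha, hD]
  push_cast
  have h1 : ((l / D : ℕ) : ℝ) * D ≤ l := by exact_mod_cast Nat.div_mul_le_self l D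
  have h2 : (l : ℝ) + 1 ≤ ((l / D : ℕ) + 1) * D := by
    have := Nat.lt_div_mul_add hD0 (a := l)
    have h3 : l + 1 ≤ (l / D + 1) * D := by rw [add_mul, one_mul]; omega
    exact_mod_cast h3
  apply Icc_subset_Icc
  · rw [div_le_div_iff₀ hi (by positivity)]
    nlinarith
  · rw [div_le_div_iff₀ (by positivity) hi]
    nlinarith

/-- Families `S 0, …, S j` of cells, each cell of `S (i + 1)` lying in one of `S i`, that are
`α`-dimensional with constant `R` at all scales. -/
structure IsRegularTree (m : ℕ → ℕ) (α : ℝ) (S : ℕ → Finset ℕ) (j : ℕ) (R : ℝ) : Prop where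
  lt_scale : ∀ l ∈ S j, l < scale m j
  parent : ∀ i < j, ∀ l ∈ S (i + 1), l / m (i + 1) ∈ S i
  card_descendants : ∀ i ≤ j, ∀ a, (((S j).filter fun l => ancestor m i j l = a).card : ℝ) ≤
    R * ((scale m j : ℝ) / scale m i) ^ α
  card_le : ∀ i ≤ j, ((S i).card : ℝ) ≤ R * (scale m i : ℝ) ^ α

lemma IsRegularTree.ancestor_mem {m : ℕ → ℕ} (hm : IsAdmissible m) {α : ℝ} {S : ℕ → Finset ℕ}
    {j : ℕ} {R : ℝ} (hS : IsRegularTree m α S j R) {i l : ℕ} (h : i ≤ j) (hl : l ∈ S j) :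
    ancestor m i j l ∈ S i := by
  have : ∀ k, i ≤ k → k ≤ j → ∀ l ∈ S k, ancestor m i k l ∈ S i := by
    intro k hk
    induction k, hk using Nat.le_induction with
    | base => intro _ l hl; rwa [ancestor_self hm]
    | succ k hk ih =>
      intro hkj l hl
      rw [ancestor_succ hk]
      exact ih (by omega) _ (hS.parent k (by omega) l hl)
  exact this j h le_rfl l hl

/-! ### Counting the cells that resonate with a frequency -/

/-- Enough cells to apply `exists_forall_iterate_derivative_le` to points in every other cell. -/
def manyCells (d : ℕ) : ℕ := 2 * (((d + 1) * (2 * d) + 1) * 2 ^ d) + 1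

/-- If many cells of side `1 / ρ` contain a point at which all derivatives of the phase are at most `hᵉ`,
then the bound `h` for the first derivative alone, at these points, forces the derivatives of order
`e` to be of size `(h / ρ) ρᵉ` near one of the cells. -/
lemma exists_mem_box_of_card {d : ℕ} {ρ h : ℝ} (hρ : 0 < ρ) (hh : 0 < h)
    {ξ : EuclideanSpace ℝ (Fin d)} (hd : 1 ≤ d) (A : Finset ℕ)
    (hA : ∀ a ∈ A, ∃ t ∈ Icc ((a : ℝ) / ρ) (((a : ℝ) + 1) / ρ), ξ ∈ box d t 1 h)
    (hcard : manyCells d < A.card) :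
    ∃ a ∈ A, ξ ∈ box d (a / ρ) (d * 2 ^ d * (h / ρ)) ρ := by
  classical
  have : ∀ a, ∃ t, a ∈ A → t ∈ Icc ((a : ℝ) / ρ) (((a : ℝ) + 1) / ρ) ∧ ξ ∈ box d t 1 h := by
    intro a
    by_cases ha : a ∈ A
    · obtain ⟨t, h1, h2⟩ := hA a ha
      exact ⟨t, fun _ => ⟨h1, h2⟩⟩
    · exact ⟨0, fun h => absurd h ha⟩
  choose t ht using this
  obtain ⟨b, hb⟩ : ∃ b, ((d + 1) * (2 * d) + 1) * 2 ^ d < (A.filter fun a => a % 2 = b).card := by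
    obtain ⟨b, -, hb⟩ := Finset.exists_lt_card_fiber_of_mul_lt_card_of_maps_to
      (s := A) (t := Finset.range 2) (n := ((d + 1) * (2 * d) + 1) * 2 ^ d) (f := fun a => a % 2)
      (fun a _ => Finset.mem_range.2 (Nat.mod_lt _ (by norm_num)))
      (by rw [Finset.card_range]; unfold manyCells at hcard; omega)
    exact ⟨b, hb⟩
  set A' := A.filter fun a => a % 2 = b
  have hA' : ∀ a ∈ A', a ∈ A := fun a ha => (Finset.mem_filter.1 ha).1
  have hsep : ∀ a ∈ A', ∀ a' ∈ A', a < a' → t a + 1 / ρ ≤ t a' := by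
    intro a ha a' ha' hlt
    have h1 := (Finset.mem_filter.1 ha).2
    have h2 := (Finset.mem_filter.1 ha').2
    have h3 : ((a : ℝ) + 2) / ρ ≤ a' / ρ := by
      have : a + 2 ≤ a' := by omega
      have : (a : ℝ) + 2 ≤ a' := by exact_mod_cast this
      gcongr
    have h4 := (ht a (hA' a ha)).1.2
    have h5 := (ht a' (hA' a' ha')).1.1
    have h6 : ((a : ℝ) + 2) / ρ = ((a : ℝ) + 1) / ρ + 1 / ρ := by ring
    linarith
  have hρ' : 0 < 1 / ρ := by positivity
  have hinj : InjOn t A' := by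
    intro a ha a' ha' heq
    by_contra hne
    rcases lt_or_gt_of_ne hne with h | h
    · have := hsep a ha a' ha' h; linarith
    · have := hsep a' ha' a ha h; linarith
  obtain ⟨x, hx, hxle⟩ := exists_forall_iterate_derivative_le (D := d)
    (q := (phase ξ).derivative) (r := 1 / ρ) (H := h)
    ((Polynomial.natDegree_derivative_le _).trans ((Nat.sub_le _ _).trans (natDegree_phase_le ξ)))
    hρ' (A'.image t) (by
      intro x hx x' hx' hlt
      obtain ⟨a, ha, rfl⟩ := Finset.mem_image.1 hx
      obtain ⟨a', ha', rfl⟩ := Finset.mem_image.1 hx'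
      refine hsep a ha a' ha' ?_
      by_contra! hcon
      rcases hcon.lt_or_eq with h | h
      · have := hsep a' ha' a ha h; linarith
      · rw [h] at hlt; exact lt_irrefl _ hlt) (by
      intro x hx
      obtain ⟨a, ha, rfl⟩ := Finset.mem_image.1 hx
      have := (ht a (hA' a ha)).2 1 le_rfl hd
      simpa using this) (by rwa [Finset.card_image_of_injOn hinj])
  obtain ⟨a, ha, rfl⟩ := Finset.mem_image.1 hx
  refine ⟨a, hA' a ha, ?_⟩
  have hmem : ξ ∈ box d (t a) (2 ^ d * (h / ρ)) ρ := by
    intro e h1 h2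
    have := hxle (e - 1) (by omega)
    rw [← Function.iterate_succ_apply, Nat.succ_eq_add_one, Nat.sub_add_cancel h1] at this
    refine this.trans ?_
    have e1 : (2 / (1 / ρ)) ^ (e - 1) * h = 2 ^ (e - 1) * ((h / ρ) * ρ ^ e) := by
      have : ρ ^ e = ρ ^ (e - 1) * ρ := by rw [← pow_succ]; congr 1; omega
      rw [this]; field_simp; rw [mul_pow]
    rw [e1, mul_assoc]
    gcongr
    · norm_num
    · omega
  rw [mul_assoc]
  refine box_subset_of_near (by positivity) hρ ?_ hmem
  have h4 := (ht a (hA' a ha)).1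
  have h6 : ((a : ℝ) + 1) / ρ = (a : ℝ) / ρ + 1 / ρ := by ring
  rw [abs_le]
  constructor <;> linarith [h4.1, h4.2]

/-- The `l`-th cell of side `1 / ρ` contains a point at which the phase of frequency `ξ`
is stationary at scale `1 / h`. -/
def Resonates {d : ℕ} (ρ h : ℝ) (ξ : EuclideanSpace ℝ (Fin d)) (l : ℕ) : Prop :=
  ∃ t ∈ Icc ((l : ℝ) / ρ) (((l : ℝ) + 1) / ρ), ξ ∈ box d t 1 h

/-- Either there are few resonating cells, or at the last level where they have few ancestors, one
cell of the next level lies in a region where the whole phase is slowly varying. -/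
lemma card_resonates_le {d : ℕ} (hd : 1 ≤ d) {m : ℕ → ℕ} (hm : IsAdmissible m) {α : ℝ}
    {S : ℕ → Finset ℕ} {j : ℕ} {R : ℝ} (hS : IsRegularTree m α S j R) {h : ℝ} (hh : 0 < h)
    (ξ : EuclideanSpace ℝ (Fin d)) (B : Finset ℕ) (hBS : B ⊆ S j)
    (hB : ∀ l ∈ B, Resonates (scale m j) h ξ l) :
    B.card ≤ manyCells d ∨ ∃ i < j,
      (B.card : ℝ) ≤ manyCells d * (R * ((scale m j : ℝ) / scale m i) ^ α) ∧
      ∃ a ∈ S (i + 1), ξ ∈ box d (a / scale m (i + 1))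
        (d * 2 ^ d * (h / scale m (i + 1))) (scale m (i + 1)) := by
  classical
  set P : ℕ → Prop := fun i => (B.image (ancestor m i j)).card ≤ manyCells d with hP
  have hP0 : P 0 := by
    have : B.image (ancestor m 0 j) ⊆ {0} := by
      intro a ha
      obtain ⟨l, hl, rfl⟩ := Finset.mem_image.1 ha
      simp [ancestor_zero (hS.lt_scale l (hBS hl))]
    refine (Finset.card_le_card this).trans ?_
    simp [manyCells]
  set i := Nat.findGreatest P j with hi
  have hPi : P i := Nat.findGreatest_spec (Nat.zero_le j) hP0
  rcases (Nat.findGreatest_le j : i ≤ j).lt_or_eq with hij | hij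
  · right
    refine ⟨i, hij, ?_, ?_⟩
    · have h1 : B.card = ∑ a ∈ B.image (ancestor m i j),
          (B.filter fun l => ancestor m i j l = a).card := Finset.card_eq_sum_card_image _ _
      rw [h1]
      push_cast
      have h2 : ∀ a ∈ B.image (ancestor m i j), ((B.filter fun l => ancestor m i j l = a).card : ℝ) ≤
          R * ((scale m j : ℝ) / scale m i) ^ α := fun a _ => by
        refine le_trans ?_ (hS.card_descendants i hij.le a)
        exact_mod_cast Finset.card_le_card (Finset.filter_subset_filter _ hBS)
      refine (Finset.sum_le_card_nsmul _ _ _ h2).trans ?_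
      rw [nsmul_eq_mul]
      have h0 : 0 ≤ R * ((scale m j : ℝ) / scale m i) ^ α :=
        le_trans (Nat.cast_nonneg _) (hS.card_descendants i hij.le 0)
      exact mul_le_mul_of_nonneg_right (by exact_mod_cast hPi) h0
    · have hnot : ¬ P (i + 1) := Nat.findGreatest_is_greatest (Nat.lt_succ_self _) (by omega)
      obtain ⟨a, ha, hbox⟩ := exists_mem_box_of_card (scale_pos_real hm (i + 1)) hh (ξ := ξ) hd
        (B.image (ancestor m (i + 1) j)) (by
          intro a ha
          obtain ⟨l, hl, rfl⟩ := Finset.mem_image.1 ha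
          obtain ⟨t, ht, hbox⟩ := hB l hl
          exact ⟨t, cell_subset_ancestor hm (by omega) l ht, hbox⟩) (not_le.1 hnot)
      obtain ⟨l, hl, rfl⟩ := Finset.mem_image.1 ha
      exact ⟨_, hS.ancestor_mem hm (by omega) (hBS hl), hbox⟩
  · left
    have : B.image (ancestor m i j) = B := by
      rw [show i = j from hij]
      conv_rhs => rw [← Finset.image_id (s := B)]
      exact Finset.image_congr fun l _ => ancestor_self hm j l
    rw [hP] at hPi
    simpa only [this] using hPi

/-- The frequencies that resonate with a cell lie in a union of `2ⁿ + 1` boxes with fixed centres; the box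
in `Resonates` has a moving centre. -/
lemma Resonates.exists_mem_box {d : ℕ} {ρ : ℝ} (hρ : 0 < ρ) {n l : ℕ}
    {ξ : EuclideanSpace ℝ (Fin d)} (H : Resonates ρ (2 ^ n * ρ) ξ l) :
    ∃ u ∈ Finset.range (2 ^ n + 1), ξ ∈ box d (l / ρ + u / (2 ^ n * ρ)) d (2 ^ n * ρ) := by
  obtain ⟨t, ht, hbox⟩ := H
  have hh : 0 < 2 ^ n * ρ := by positivity
  have h0 : 0 ≤ (t - l / ρ) * (2 ^ n * ρ) := mul_nonneg (sub_nonneg.2 ht.1) hh.le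
  set u := ⌊(t - l / ρ) * (2 ^ n * ρ)⌋₊
  have hu1 : (u : ℝ) ≤ (t - l / ρ) * (2 ^ n * ρ) := Nat.floor_le h0
  have hu2 : (t - l / ρ) * (2 ^ n * ρ) < u + 1 := Nat.lt_floor_add_one _
  refine ⟨u, ?_, ?_⟩
  · rw [Finset.mem_range, Nat.lt_succ_iff]
    have h1 : t - l / ρ ≤ 1 / ρ := by
      have : ((l : ℝ) + 1) / ρ = l / ρ + 1 / ρ := by ring
      linarith [ht.2]
    have h2 : (t - l / ρ) * (2 ^ n * ρ) ≤ 1 / ρ * (2 ^ n * ρ) := by gcongr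
    have h3 : 1 / ρ * (2 ^ n * ρ) = 2 ^ n := by field_simp
    have : (u : ℝ) ≤ 2 ^ n := by linarith
    exact_mod_cast this
  · have := box_subset_of_near (t' := l / ρ + u / (2 ^ n * ρ)) zero_le_one hh (by
      rw [abs_le]
      have e1 : (u : ℝ) / (2 ^ n * ρ) ≤ t - l / ρ := by rwa [div_le_iff₀ hh]
      have e2 : t - l / ρ ≤ u / (2 ^ n * ρ) + 1 / (2 ^ n * ρ) := by
        rw [← add_div, le_div_iff₀ hh]; exact hu2.le
      constructor
      · linarith
      · have : 0 < 1 / (2 ^ n * ρ) := by positivity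
        linarith) hbox
    simpa using this

/-! ### Integrating powers of the number of resonating cells -/

open Classical in
/-- The number of cells of `S j` that resonate with `ξ` at frequency `2ⁿ M_j`. -/
def resonanceCount {d : ℕ} (m : ℕ → ℕ) (S : ℕ → Finset ℕ) (j n : ℕ)
    (ξ : EuclideanSpace ℝ (Fin d)) : ℕ :=
  ((S j).filter fun l => Resonates (scale m j) (2 ^ n * scale m j) ξ l).card

/-- A measurable majorant of the `s`-th power of `resonanceCount`. -/
def resonanceMajorant (d : ℕ) (m : ℕ → ℕ) (S : ℕ → Finset ℕ) (j n : ℕ) (α R s : ℝ)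
    (ξ : EuclideanSpace ℝ (Fin d)) : ℝ≥0∞ :=
  ENNReal.ofReal (manyCells d ^ s) * ∑ l ∈ S j, ∑ u ∈ Finset.range (2 ^ n + 1),
      (box d (l / scale m j + u / (2 ^ n * scale m j)) d (2 ^ n * scale m j)).indicator 1 ξ +
    ∑ i ∈ Finset.range j,
      ENNReal.ofReal ((manyCells d * (R * ((scale m j : ℝ) / scale m i) ^ α)) ^ s) *
        ∑ a ∈ S (i + 1), (box d (a / scale m (i + 1))
          (d * 2 ^ d * (2 ^ n * scale m j / scale m (i + 1))) (scale m (i + 1))).indicator 1 ξ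

lemma measurable_resonanceMajorant (d : ℕ) (m : ℕ → ℕ) (S : ℕ → Finset ℕ) (j n : ℕ) (α R s : ℝ) :
    Measurable (resonanceMajorant d m S j n α R s) := by
  unfold resonanceMajorant
  have : ∀ t A ρ : ℝ, Measurable
      ((box d t A ρ).indicator (1 : EuclideanSpace ℝ (Fin d) → ℝ≥0∞)) := fun t A ρ =>
    measurable_one.indicator (measurableSet_box d t A ρ)
  refine Measurable.add (Measurable.const_mul ?_ _) ?_
  · exact Finset.measurable_sum _ fun l _ => Finset.measurable_sum _ fun u _ => this _ _ _
  · exact Finset.measurable_sum _ fun l _ =>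
      (Finset.measurable_sum _ fun u _ => this _ _ _).const_mul _

/-- The two cases of `card_resonates_le` correspond to the two sums in the majorant: a bounded nonzero
number of resonating cells is counted by the first one. -/
lemma resonanceCount_rpow_le {d : ℕ} (hd : 1 ≤ d) {m : ℕ → ℕ} (hm : IsAdmissible m) {α : ℝ}
    {S : ℕ → Finset ℕ} {j : ℕ} {R s : ℝ} (hs : 0 < s)
    (hS : IsRegularTree m α S j R) (n : ℕ) (ξ : EuclideanSpace ℝ (Fin d)) :
    (resonanceCount m S j n ξ : ℝ≥0∞) ^ s ≤ resonanceMajorant d m S j n α R s ξ := by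
  classical
  have hM := scale_pos_real hm j
  unfold resonanceCount resonanceMajorant
  set B := (S j).filter fun l => Resonates (scale m j) (2 ^ n * scale m j) ξ l with hB
  have hcast : ∀ x : ℝ, (B.card : ℝ) ≤ x → (B.card : ℝ≥0∞) ^ s ≤ ENNReal.ofReal (x ^ s) := by
    intro x hx
    rw [← ENNReal.ofReal_rpow_of_nonneg ((Nat.cast_nonneg _).trans hx) hs.le]
    refine ENNReal.rpow_le_rpow ?_ hs.le
    rw [← ENNReal.ofReal_natCast]
    exact ENNReal.ofReal_le_ofReal hx
  rcases card_resonates_le hd hm hS (by positivity : 0 < 2 ^ n * (scale m j : ℝ)) ξ B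
    (Finset.filter_subset _ _) (fun l hl => (Finset.mem_filter.1 hl).2) with h | ⟨i, hij, h1, a, ha, h2⟩
  · rcases B.eq_empty_or_nonempty with h0 | ⟨l, hl⟩
    · rw [h0]; simp [hs]
    · refine le_add_right ?_
      refine (hcast _ (Nat.cast_le.2 h)).trans (le_mul_of_one_le_right zero_le ?_)
      obtain ⟨hlS, hlR⟩ := Finset.mem_filter.1 hl
      obtain ⟨u, hu, hbox⟩ := hlR.exists_mem_box hM
      refine le_trans ?_ (Finset.single_le_sum (f := fun l : ℕ => ∑ u ∈ Finset.range (2 ^ n + 1),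
        (box d (l / scale m j + u / (2 ^ n * scale m j)) d (2 ^ n * scale m j)).indicator
          (1 : EuclideanSpace ℝ (Fin d) → ℝ≥0∞) ξ) (fun _ _ => zero_le) hlS)
      refine le_trans ?_ (Finset.single_le_sum (f := fun u : ℕ =>
        (box d (l / scale m j + u / (2 ^ n * scale m j)) d (2 ^ n * scale m j)).indicator
          (1 : EuclideanSpace ℝ (Fin d) → ℝ≥0∞) ξ) (fun _ _ => zero_le) hu)
      rw [indicator_of_mem hbox]; rfl
  · refine le_add_left ?_
    refine le_trans ?_ (Finset.single_le_sum (f := fun i =>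
      ENNReal.ofReal ((manyCells d * (R * ((scale m j : ℝ) / scale m i) ^ α)) ^ s) *
        ∑ a ∈ S (i + 1), (box d (a / scale m (i + 1))
          (d * 2 ^ d * (2 ^ n * scale m j / scale m (i + 1))) (scale m (i + 1))).indicator
          (1 : EuclideanSpace ℝ (Fin d) → ℝ≥0∞) ξ)
      (fun _ _ => zero_le) (Finset.mem_range.2 hij))
    refine (hcast _ h1).trans (le_mul_of_one_le_right zero_le ?_)
    refine le_trans ?_ (Finset.single_le_sum (f := fun a : ℕ => (box d (a / scale m (i + 1))
          (d * 2 ^ d * (2 ^ n * scale m j / scale m (i + 1))) (scale m (i + 1))).indicator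
          (1 : EuclideanSpace ℝ (Fin d) → ℝ≥0∞) ξ) (fun _ _ => zero_le) ha)
    rw [indicator_of_mem h2]; rfl

lemma lintegral_resonanceMajorant_le_sum {d : ℕ} {m : ℕ → ℕ} (hm : IsAdmissible m) {α : ℝ}
    {S : ℕ → Finset ℕ} {j : ℕ} {R s : ℝ} (hR : 0 ≤ R) (n : ℕ) :
    ∫⁻ ξ, resonanceMajorant d m S j n α R s ξ ≤ ENNReal.ofReal (
      manyCells d ^ s * ((S j).card * ((2 ^ n + 1) *
        ((2 * d) ^ d * (2 ^ n * scale m j) ^ (d * (d + 1) / 2)))) +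
      ∑ i ∈ Finset.range j, (manyCells d * (R * ((scale m j : ℝ) / scale m i) ^ α)) ^ s *
        ((S (i + 1)).card * ((2 * (d * 2 ^ d * (2 ^ n * scale m j / scale m (i + 1)))) ^ d *
          (scale m (i + 1) : ℝ) ^ (d * (d + 1) / 2)))) := by
  have hM := scale_pos_real hm
  have hmeas : ∀ t A ρ : ℝ, Measurable
      ((box d t A ρ).indicator (1 : EuclideanSpace ℝ (Fin d) → ℝ≥0∞)) := fun t A ρ =>
    measurable_one.indicator (measurableSet_box d t A ρ)
  unfold resonanceMajorant
  rw [lintegral_add_left, lintegral_const_mul, lintegral_finsetSum, lintegral_finsetSum]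
  rotate_left
  · exact fun i _ => (Finset.measurable_sum _ fun u _ => hmeas _ _ _).const_mul _
  · exact fun i _ => Finset.measurable_sum _ fun u _ => hmeas _ _ _
  · exact Finset.measurable_sum _ fun l _ => Finset.measurable_sum _ fun u _ => hmeas _ _ _
  · exact (Finset.measurable_sum _ fun l _ =>
      Finset.measurable_sum _ fun u _ => hmeas _ _ _).const_mul _
  have hb : ∀ t A ρ : ℝ, 0 ≤ A → 0 ≤ ρ → ∫⁻ ξ, (box d t A ρ).indicator
      (1 : EuclideanSpace ℝ (Fin d) → ℝ≥0∞) ξ ≤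
        ENNReal.ofReal ((2 * A) ^ d * ρ ^ (d * (d + 1) / 2)) := by
    intro t A ρ hA hρ
    rw [lintegral_indicator_one (measurableSet_box _ _ _ _)]
    exact volume_box_le d t hA hρ
  have hpos : ∀ i, 0 ≤ (manyCells d * (R * ((scale m j : ℝ) / scale m i) ^ α)) ^ s := fun i => by
    have := hM j; have := hM i; positivity
  rw [ENNReal.ofReal_add (by have := hM j; positivity) (Finset.sum_nonneg fun i _ =>
    mul_nonneg (hpos i) (by have := hM j; have := hM (i + 1); positivity)),
    ENNReal.ofReal_mul (by positivity), ENNReal.ofReal_sum_of_nonneg (fun i _ =>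
    mul_nonneg (hpos i) (by have := hM j; have := hM (i + 1); positivity))]
  refine add_le_add ?_ (Finset.sum_le_sum fun i _ => ?_)
  · gcongr
    have hsum : ∀ l ∈ S j, ∫⁻ ξ, ∑ u ∈ Finset.range (2 ^ n + 1),
        (box d (l / scale m j + u / (2 ^ n * scale m j)) d (2 ^ n * scale m j)).indicator
          (1 : EuclideanSpace ℝ (Fin d) → ℝ≥0∞) ξ ≤ ENNReal.ofReal ((2 ^ n + 1) *
        ((2 * d) ^ d * (2 ^ n * scale m j) ^ (d * (d + 1) / 2))) := by
      intro l _
      rw [lintegral_finsetSum _ fun u _ => hmeas _ _ _]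
      refine (Finset.sum_le_card_nsmul _ _ _ fun u _ => hb _ _ _ (by positivity)
        (by have := hM j; positivity)).trans (le_of_eq ?_)
      rw [← ENNReal.ofReal_nsmul, nsmul_eq_mul, Finset.card_range]
      push_cast; rfl
    refine (Finset.sum_le_card_nsmul _ _ _ hsum).trans (le_of_eq ?_)
    rw [← ENNReal.ofReal_nsmul, nsmul_eq_mul]
  · rw [lintegral_const_mul _ (Finset.measurable_sum _ fun u _ => hmeas _ _ _),
      ENNReal.ofReal_mul (hpos i), lintegral_finsetSum _ fun u _ => hmeas _ _ _]
    gcongr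
    refine (Finset.sum_le_card_nsmul _ _ _ fun a _ => hb _ _ _
      (by have := hM j; have := hM (i + 1); positivity) (hM _).le).trans (le_of_eq ?_)
    rw [← ENNReal.ofReal_nsmul, nsmul_eq_mul]

/-- The contribution of level `i` is a power of `M_{i+1}`, so it is at most the sum of the values of that
power at `1` and at `M_j`. -/
lemma level_sum_le {d : ℕ} {m : ℕ → ℕ} (hm : IsAdmissible m) {α : ℝ}
    (hα0 : 0 < α) (hα1 : α < 1) {S : ℕ → Finset ℕ} {j : ℕ} {R s : ℝ} (hR : 1 ≤ R) (hs : 0 < s)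
    (hS : IsRegularTree m α S j R) (n : ℕ) {i : ℕ} (hi : i < j) :
    (manyCells d * (R * ((scale m j : ℝ) / scale m i) ^ α)) ^ s *
        ((S (i + 1)).card * ((2 * (d * 2 ^ d * (2 ^ n * scale m j / scale m (i + 1)))) ^ d *
          (scale m (i + 1) : ℝ) ^ (d * (d + 1) / 2))) ≤
      manyCells d ^ s * (2 * (d * 2 ^ d)) ^ d * R ^ (s + 1) * (m (j + 1) : ℝ) ^ s *
        2 ^ (n * d) * ((scale m j : ℝ) ^ (α * s + d) +
          (scale m j : ℝ) ^ (α + (d * (d + 1) / 2 : ℕ))) := by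
  set D := d * (d + 1) / 2 with hD
  have hM := scale_pos_real hm j
  have hx := scale_pos_real hm (i + 1)
  have hx1 := one_le_scale_real hm (i + 1)
  have hy := scale_pos_real hm i
  set M : ℝ := (scale m j : ℝ) with hMdef
  set x : ℝ := (scale m (i + 1) : ℝ) with hxdef
  have hxM : x ≤ M := Nat.cast_le.2 (scale_mono hm (by omega : i + 1 ≤ j))
  set μ : ℝ := (m (j + 1) : ℝ) with hμ
  have hμ1 : 1 ≤ μ := by
    have := hm.two_le (j + 1) (by omega)
    exact Nat.one_le_cast.2 (by omega)
  have hR0 : 0 < R := by linarith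
  have hratio : M / scale m i ≤ μ * (M / x) := by
    have e : x = scale m i * m (i + 1) := by rw [hxdef, scale_succ]; push_cast; rfl
    have hmi : (0 : ℝ) < m (i + 1) := by
      have := hm.two_le (i + 1) (by omega)
      exact_mod_cast (by omega : 0 < m (i + 1))
    have h2 : (m (i + 1) : ℝ) ≤ μ := by
      exact Nat.cast_le.2 (le_of_le_admissible hm (by omega) (by omega : i + 1 ≤ j + 1))
    have : M / scale m i = m (i + 1) * (M / x) := by rw [e]; field_simp
    rw [this]
    gcongr
  have hcard := hS.card_le (i + 1) (by omega)
  -- As the `m_i` are nondecreasing, passing from level `i` to `i + 1` costs at most `m_{j+1}`.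
  have h1 : (manyCells d * (R * (M / scale m i) ^ α)) ^ s ≤
      manyCells d ^ s * R ^ s * μ ^ s * (M ^ (α * s) * x ^ (-(α * s))) := by
    calc (manyCells d * (R * (M / scale m i) ^ α)) ^ s
        ≤ (manyCells d * (R * (μ * (M / x)) ^ α)) ^ s := by gcongr
      _ = manyCells d ^ s * R ^ s * (μ ^ α) ^ s * (M ^ (α * s) * x ^ (-(α * s))) := by
          rw [Real.mul_rpow (by positivity) (by positivity), Real.mul_rpow (by positivity)
            (by positivity), Real.mul_rpow (by positivity) (by positivity),
            Real.mul_rpow (by positivity) (by positivity), Real.div_rpow hM.le hx.le,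
            Real.div_rpow (by positivity) (by positivity), ← Real.rpow_mul hM.le,
            ← Real.rpow_mul hx.le, Real.rpow_neg hx.le]
          ring
      _ ≤ _ := by
          gcongr
          calc μ ^ α ≤ μ ^ (1 : ℝ) := Real.rpow_le_rpow_of_exponent_le hμ1 hα1.le
            _ = μ := Real.rpow_one μ
  have h2 : (2 * (d * 2 ^ d * (2 ^ n * M / x))) ^ d * x ^ D =
      (2 * (d * 2 ^ d)) ^ d * 2 ^ (n * d) * (M ^ (d : ℝ) * x ^ ((D : ℝ) - d)) := by
    rw [Real.rpow_sub hx, Real.rpow_natCast, Real.rpow_natCast, Real.rpow_natCast, pow_mul]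
    have : 2 * (d * 2 ^ d * (2 ^ n * M / x)) = (2 * (d * 2 ^ d)) * (2 ^ n * M / x) := by ring
    rw [this, mul_pow _ (2 ^ n * M / x), div_pow, mul_pow (2 ^ n) M]
    ring
  -- The exponent `κ` may have either sign, hence both endpoints in the bound.
  set κ : ℝ := (D : ℝ) - d + α - α * s with hκ
  have hxκ : x ^ κ ≤ 1 + M ^ κ := by
    rcases le_total 0 κ with h | h
    · have : x ^ κ ≤ M ^ κ := Real.rpow_le_rpow hx.le hxM h
      linarith
    · have : x ^ κ ≤ 1 := Real.rpow_le_one_of_one_le_of_nonpos hx1 h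
      have := Real.rpow_nonneg hM.le κ
      linarith
  calc _ ≤ (manyCells d ^ s * R ^ s * μ ^ s * (M ^ (α * s) * x ^ (-(α * s)))) *
        ((R * x ^ α) * ((2 * (d * 2 ^ d)) ^ d * 2 ^ (n * d) * (M ^ (d : ℝ) * x ^ ((D : ℝ) - d)))) := by
        rw [h2]
        gcongr
    _ = manyCells d ^ s * (2 * (d * 2 ^ d)) ^ d * R ^ (s + 1) * μ ^ s *
        2 ^ (n * d) * (M ^ (α * s + d) * x ^ κ) := by
        rw [Real.rpow_add hR0, Real.rpow_one, Real.rpow_add hM,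
          show κ = -(α * s) + α + ((D : ℝ) - d) by rw [hκ]; ring, Real.rpow_add hx, Real.rpow_add hx]
        ring
    _ ≤ manyCells d ^ s * (2 * (d * 2 ^ d)) ^ d * R ^ (s + 1) * μ ^ s *
        2 ^ (n * d) * (M ^ (α * s + d) * (1 + M ^ κ)) := by gcongr
    _ = _ := by
        rw [mul_add, mul_one, ← Real.rpow_add hM]
        rw [show α * s + d + κ = α + (D : ℝ) by rw [hκ]; ring]

lemma le_triangle (d : ℕ) : d ≤ d * (d + 1) / 2 := by
  rcases Nat.eq_zero_or_pos d with rfl | h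
  · simp
  · rw [Nat.le_div_iff_mul_le (by norm_num)]
    exact Nat.mul_le_mul_left d (by omega)

lemma lintegral_resonanceMajorant_le {d : ℕ} {m : ℕ → ℕ} (hm : IsAdmissible m) {α : ℝ}
    (hα0 : 0 < α) (hα1 : α < 1) {S : ℕ → Finset ℕ} {j : ℕ} {R s : ℝ} (hR : 1 ≤ R) (hs : 0 < s)
    (hS : IsRegularTree m α S j R) (n : ℕ) :
    ∫⁻ ξ, resonanceMajorant d m S j n α R s ξ ≤ ENNReal.ofReal (
      manyCells d ^ s * (2 * (2 * d) ^ d + (2 * (d * 2 ^ d)) ^ d) * (R ^ (s + 1) *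
        (m (j + 1) : ℝ) ^ s * (j + 1) * ((scale m j : ℝ) ^ (α * s + d) +
          (scale m j : ℝ) ^ (α + (d * (d + 1) / 2 : ℕ)))) * (2 ^ (d * (d + 1) / 2 + 1)) ^ n) := by
  refine (lintegral_resonanceMajorant_le_sum hm (by linarith) n).trans (ENNReal.ofReal_le_ofReal ?_)
  have hM := scale_pos_real hm j
  have hsum := Finset.sum_le_card_nsmul (Finset.range j) _ _ fun i hi =>
    level_sum_le (d := d) hm hα0 hα1 hR hs hS n (Finset.mem_range.1 hi)
  have hcard := hS.card_le j le_rfl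
  have hdD := le_triangle d
  set D := d * (d + 1) / 2 with hD
  set M : ℝ := (scale m j : ℝ) with hMdef
  set μ : ℝ := (m (j + 1) : ℝ) with hμ
  have hμ1 : 1 ≤ μ := by
    have := hm.two_le (j + 1) (by omega)
    exact Nat.one_le_cast.2 (by omega)
  rw [Finset.card_range, nsmul_eq_mul] at hsum
  set T : ℝ := M ^ (α * s + d) + M ^ (α + (D : ℝ)) with hT
  have hT0 : 0 ≤ T := by positivity
  have hR0 : 0 < R := by linarith
  have hμs : 1 ≤ μ ^ s := Real.one_le_rpow hμ1 hs.le
  have hRR : R ≤ R ^ (s + 1) := by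
    calc R = R ^ (1 : ℝ) := (Real.rpow_one R).symm
      _ ≤ _ := Real.rpow_le_rpow_of_exponent_le hR (by linarith)
  have hK : (0 : ℝ) ≤ (manyCells d : ℝ) ^ s := by positivity
  have hpw : (2 : ℝ) ^ (n * d) ≤ (2 ^ (D + 1)) ^ n := by
    rw [← pow_mul, mul_comm n d]
    refine pow_le_pow_right₀ (by norm_num) (Nat.mul_le_mul_right _ (by omega))
  have h1 : manyCells d ^ s * ((S j).card * ((2 ^ n + 1) * ((2 * d) ^ d * (2 ^ n * M) ^ D))) ≤
      manyCells d ^ s * (2 * (2 * d) ^ d) * (R ^ (s + 1) * μ ^ s * 1 * T) * (2 ^ (D + 1)) ^ n := by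
    calc _ ≤ manyCells d ^ s * ((R * M ^ α) * ((2 * 2 ^ n) * ((2 * d) ^ d * (2 ^ n * M) ^ D))) := by
          gcongr
          have : (1 : ℝ) ≤ 2 ^ n := one_le_pow₀ (by norm_num)
          linarith
      _ = manyCells d ^ s * (2 * (2 * d) ^ d) * (R * 1 * 1 * M ^ (α + (D : ℝ))) * (2 ^ (D + 1)) ^ n := by
          rw [Real.rpow_add hM, Real.rpow_natCast, mul_pow]; ring
      _ ≤ _ := by
          gcongr
          rw [hT]
          have : 0 ≤ M ^ (α * s + d) := by positivity
          linarith
  refine (add_le_add h1 hsum).trans ?_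
  have h2 : (j : ℝ) * (manyCells d ^ s * (2 * (d * 2 ^ d)) ^ d * R ^ (s + 1) * μ ^ s *
      2 ^ (n * d) * T) ≤ manyCells d ^ s * (2 * (d * 2 ^ d)) ^ d *
        (R ^ (s + 1) * μ ^ s * (j + 1) * T) * (2 ^ (D + 1)) ^ n := by
    calc _ ≤ ((j : ℝ) + 1) * (manyCells d ^ s * (2 * (d * 2 ^ d)) ^ d * R ^ (s + 1) * μ ^ s *
          (2 ^ (D + 1)) ^ n * T) := by
          gcongr
          linarith
      _ = _ := by ring
  have h3 : manyCells d ^ s * (2 * (2 * d) ^ d) * (R ^ (s + 1) * μ ^ s * 1 * T) * (2 ^ (D + 1)) ^ n ≤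
      manyCells d ^ s * (2 * (2 * d) ^ d) * (R ^ (s + 1) * μ ^ s * (j + 1) * T) *
        (2 ^ (D + 1)) ^ n := by
    gcongr
    have : (0 : ℝ) ≤ j := Nat.cast_nonneg j
    linarith
  calc _ ≤ _ := add_le_add h3 h2
    _ = _ := by ring

/-- Superposition of the resonance counts over the frequencies `2ⁿ M_j`. -/
def resonanceSum {d : ℕ} (m : ℕ → ℕ) (S : ℕ → Finset ℕ) (j : ℕ)
    (ξ : EuclideanSpace ℝ (Fin d)) : ℝ≥0∞ :=
  ∑' n, ENNReal.ofReal ((1 / 4) ^ n) * (resonanceCount m S j n ξ : ℝ≥0∞)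

/-- A crude form of Hölder's inequality, valid for every `s > 0`: each `b n` is at most the `ℓ^s` norm. -/
lemma tsum_mul_rpow_le {w b : ℕ → ℝ≥0∞} {s : ℝ} (hs : 0 < s) :
    (∑' n, w n * b n) ^ s ≤ (∑' n, w n) ^ s * ∑' n, b n ^ s := by
  have hb : ∀ n, b n ≤ (∑' n, b n ^ s) ^ (1 / s) := by
    intro n
    calc b n = (b n ^ s) ^ (1 / s) := by
          rw [← ENNReal.rpow_mul, mul_one_div_cancel hs.ne', ENNReal.rpow_one]
      _ ≤ _ := ENNReal.rpow_le_rpow (ENNReal.le_tsum n) (by positivity)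
  calc (∑' n, w n * b n) ^ s ≤ (∑' n, w n * (∑' n, b n ^ s) ^ (1 / s)) ^ s := by
        refine ENNReal.rpow_le_rpow (ENNReal.tsum_le_tsum fun n => ?_) hs.le
        gcongr
        exact hb n
    _ = _ := by
        rw [ENNReal.tsum_mul_right, ENNReal.mul_rpow_of_nonneg _ _ hs.le, ← ENNReal.rpow_mul,
          one_div_mul_cancel hs.ne', ENNReal.rpow_one]

/-- For a tree that is `α`-dimensional at all scales, the `s`-th power of the resonance sum is
integrable, with a bound in which only the two extreme scales contribute. -/
lemma exists_lintegral_resonanceSum_le {d : ℕ} (hd : 1 ≤ d) {s α : ℝ}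
    (hs : ((d * (d + 1) / 2 : ℕ) : ℝ) + 1 < 2 * s) (hα0 : 0 < α) (hα1 : α < 1) :
    ∃ C : ℝ, 0 ≤ C ∧ ∀ (m : ℕ → ℕ) (S : ℕ → Finset ℕ) (j : ℕ) (R : ℝ), IsAdmissible m → 1 ≤ R →
      IsRegularTree m α S j R → ∃ U : EuclideanSpace ℝ (Fin d) → ℝ≥0∞, Measurable U ∧
        (∀ ξ, resonanceSum m S j ξ ^ s ≤ U ξ) ∧
        ∫⁻ ξ, U ξ ≤ ENNReal.ofReal (C * (R ^ (s + 1) *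
          (m (j + 1) : ℝ) ^ s * (j + 1) * ((scale m j : ℝ) ^ (α * s + d) +
          (scale m j : ℝ) ^ (α + (d * (d + 1) / 2 : ℕ))))) := by
  set D := d * (d + 1) / 2 with hD
  have hs0 : 0 < s := by
    have : (0 : ℝ) ≤ D := Nat.cast_nonneg D
    linarith
  -- The weight `4⁻ⁿ` is split as `θⁿ (4θ)⁻ⁿ`: the `s`-th power of the second factor still beats the
  -- growth `2^{(D + 1) n}` of the integrals, because `D + 1 < 2 s`.
  set κ : ℝ := (2 * s - D - 1) / (2 * s) with hκ
  have hκ0 : 0 < κ := div_pos (by linarith) (by linarith)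
  set θ : ℝ := 2 ^ (-κ) with hθ
  have hθ0 : 0 < θ := by positivity
  have hθ1 : θ < 1 := Real.rpow_lt_one_of_one_lt_of_neg (by norm_num) (by linarith)
  set ϑ : ℝ := 2 ^ (D + 1) / (4 * θ) ^ s with hϑ
  have hϑ0 : 0 ≤ ϑ := by positivity
  have hϑ1 : ϑ < 1 := by
    rw [hϑ, div_lt_one (by positivity)]
    have e1 : (4 * θ) ^ s = 2 ^ ((2 - κ) * s) := by
      rw [Real.rpow_mul (by norm_num), Real.rpow_sub (by norm_num), hθ, Real.rpow_neg (by norm_num)]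
      norm_num [div_eq_mul_inv]
    have e2 : ((2 : ℝ) ^ (D + 1)) = 2 ^ ((D : ℝ) + 1) := by
      rw [← Real.rpow_natCast]; push_cast; rfl
    rw [e1, e2]
    refine Real.rpow_lt_rpow_of_exponent_lt (by norm_num) ?_
    have : (2 - κ) * s = 2 * s - (2 * s - D - 1) / 2 := by rw [hκ]; field_simp
    rw [this]; linarith
  set C₀ : ℝ := manyCells d ^ s * (2 * (2 * d) ^ d + (2 * (d * 2 ^ d)) ^ d) with hC₀
  refine ⟨(1 / (1 - θ)) ^ s * (C₀ * (1 / (1 - ϑ))), ?_, ?_⟩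
  · have : 0 < 1 - θ := by linarith
    have : 0 < 1 - ϑ := by linarith
    positivity
  intro m S j R hm hR hS
  have hM := scale_pos_real hm j
  set X : ℝ := R ^ (s + 1) * (m (j + 1) : ℝ) ^ s * (j + 1) * ((scale m j : ℝ) ^ (α * s + d) +
          (scale m j : ℝ) ^ (α + (D : ℝ))) with hX
  have hX0 : 0 ≤ X := by
    have : 0 ≤ R := by linarith
    positivity
  refine ⟨fun ξ => ENNReal.ofReal ((1 / (1 - θ)) ^ s) * ∑' n,
    ENNReal.ofReal (((1 / (4 * θ)) ^ s) ^ n) * resonanceMajorant d m S j n α R s ξ, ?_, ?_, ?_⟩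
  · exact (Measurable.tsum fun n =>
      (measurable_resonanceMajorant d m S j n α R s).const_mul _).const_mul _
  · intro ξ
    have e : resonanceSum m S j ξ = ∑' n, ENNReal.ofReal (θ ^ n) *
        (ENNReal.ofReal ((1 / (4 * θ)) ^ n) * (resonanceCount m S j n ξ : ℝ≥0∞)) := by
      refine tsum_congr fun n => ?_
      rw [← mul_assoc, ← ENNReal.ofReal_mul (by positivity), ← mul_pow]
      congr 3
      field_simp
    rw [e]
    refine (tsum_mul_rpow_le hs0).trans ?_
    have e2 : ∑' n, ENNReal.ofReal (θ ^ n) = ENNReal.ofReal (1 / (1 - θ)) := by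
      rw [← ENNReal.ofReal_tsum_of_nonneg (fun n => by positivity)
        (summable_geometric_of_lt_one hθ0.le hθ1), tsum_geometric_of_lt_one hθ0.le hθ1, one_div]
    rw [e2, ENNReal.ofReal_rpow_of_nonneg (by
      have : 0 < 1 - θ := by linarith
      positivity) hs0.le]
    refine mul_le_mul' le_rfl (ENNReal.tsum_le_tsum fun n => ?_)
    rw [ENNReal.mul_rpow_of_nonneg _ _ hs0.le, ENNReal.ofReal_rpow_of_nonneg (by positivity) hs0.le]
    have e3 : ((1 / (4 * θ)) ^ n) ^ s = ((1 / (4 * θ)) ^ s) ^ n := by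
      rw [← Real.rpow_natCast, ← Real.rpow_natCast, ← Real.rpow_mul (by positivity),
        ← Real.rpow_mul (by positivity), mul_comm (n : ℝ)]
    rw [e3]
    gcongr
    exact resonanceCount_rpow_le hd hm hs0 hS n ξ
  · rw [lintegral_const_mul _ (Measurable.tsum fun n =>
      (measurable_resonanceMajorant d m S j n α R s).const_mul _),
      lintegral_tsum fun n => ((measurable_resonanceMajorant d m S j n α R s).const_mul _).aemeasurable,
      mul_assoc, ENNReal.ofReal_mul (by
        have : 0 < 1 - θ := by linarith
        positivity)]
    gcongr
    have e4 : ∑' n, ENNReal.ofReal (C₀ * X * ϑ ^ n) = ENNReal.ofReal (C₀ * (1 / (1 - ϑ)) * X) := by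
      rw [← ENNReal.ofReal_tsum_of_nonneg (fun n => by positivity)
        ((summable_geometric_of_lt_one hϑ0 hϑ1).mul_left _), tsum_mul_left,
        tsum_geometric_of_lt_one hϑ0 hϑ1]
      congr 1; ring
    rw [← e4]
    refine ENNReal.tsum_le_tsum fun n => ?_
    rw [lintegral_const_mul _ (measurable_resonanceMajorant d m S j n α R s)]
    calc _ ≤ ENNReal.ofReal (((1 / (4 * θ)) ^ s) ^ n) *
          ENNReal.ofReal (C₀ * X * (2 ^ (D + 1)) ^ n) := by
          gcongr
          exact lintegral_resonanceMajorant_le hm hα0 hα1 hR hs0 hS n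
      _ = _ := by
          rw [← ENNReal.ofReal_mul (by positivity)]
          congr 1
          rw [hϑ, Real.div_rpow (by norm_num) (by positivity), Real.one_rpow, div_pow, div_pow]
          ring

/-! ### Fourier transforms of cells -/

/-- The indices of the level `j + 1` cells contained in the `k`-th cell of level `j`. -/
def children (m : ℕ → ℕ) (j k : ℕ) : Finset ℕ := Finset.Ico (k * m (j + 1)) ((k + 1) * m (j + 1))

lemma div_of_mem_children {m : ℕ → ℕ} {j k l : ℕ} (hl : l ∈ children m j k) :
    l / m (j + 1) = k := by
  rw [children, Finset.mem_Ico] at hl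
  exact Nat.div_eq_of_lt_le hl.1 hl.2

lemma card_children (m : ℕ → ℕ) (j k : ℕ) : (children m j k).card = m (j + 1) := by
  rw [children, Nat.card_Ico, add_mul, one_mul, Nat.add_sub_cancel_left]

lemma sum_range_mul {M : Type*} [AddCommMonoid M] (f : ℕ → M) (a b : ℕ) :
    ∑ l ∈ Finset.range (a * b), f l =
      ∑ k ∈ Finset.range a, ∑ l ∈ Finset.Ico (k * b) ((k + 1) * b), f l := by
  induction a with
  | zero => simp
  | succ a ih =>
    rw [Finset.sum_range_succ, ← ih, Finset.range_eq_Ico, Finset.range_eq_Ico,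
      Finset.sum_Ico_consecutive _ (Nat.zero_le _) (Nat.mul_le_mul_right _ (Nat.le_succ a))]

lemma sum_range_scale_succ {M : Type*} [AddCommMonoid M] (m : ℕ → ℕ) (j : ℕ) (f : ℕ → M) :
    ∑ l ∈ Finset.range (scale m (j + 1)), f l =
      ∑ k ∈ Finset.range (scale m j), ∑ l ∈ children m j k, f l := by
  rw [scale_succ, sum_range_mul]; rfl

/-- The Fourier transform at `ξ` of arc length, in the parameter, on the `l`-th cell of level `j`
of the moment curve. -/
def cellFourier {d : ℕ} (m : ℕ → ℕ) (j : ℕ) (ξ : EuclideanSpace ℝ (Fin d)) (l : ℕ) : ℂ :=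
  ∫ t in (l : ℝ) / scale m j..((l : ℝ) + 1) / scale m j, osc (phase ξ) t

lemma norm_cellFourier_le {d : ℕ} {m : ℕ → ℕ} (hm : IsAdmissible m) (j : ℕ)
    (ξ : EuclideanSpace ℝ (Fin d)) (l : ℕ) : ‖cellFourier m j ξ l‖ ≤ 1 / scale m j := by
  have hM := scale_pos_real hm j
  refine (norm_integral_osc_le (phase ξ) (by gcongr; linarith)).trans (le_of_eq ?_)
  ring

lemma scale_succ_real (m : ℕ → ℕ) (j : ℕ) :
    (scale m (j + 1) : ℝ) = scale m j * m (j + 1) := by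
  rw [scale_succ]; push_cast; rfl

lemma m_pos_real {m : ℕ → ℕ} (hm : IsAdmissible m) (j : ℕ) : (0 : ℝ) < m (j + 1) := by
  have := hm.two_le (j + 1) (by omega)
  exact Nat.cast_pos.2 (by omega)

lemma one_le_m_real {m : ℕ → ℕ} (hm : IsAdmissible m) (j : ℕ) : (1 : ℝ) ≤ m (j + 1) := by
  have := hm.two_le (j + 1) (by omega)
  exact Nat.one_le_cast.2 (by omega)

lemma sum_children_norm_le {d : ℕ} {m : ℕ → ℕ} (hm : IsAdmissible m) (j : ℕ)
    (ξ : EuclideanSpace ℝ (Fin d)) (k : ℕ) :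
    ∑ l ∈ children m j k, ‖cellFourier m (j + 1) ξ l‖ ≤ 1 / scale m j := by
  refine (Finset.sum_le_card_nsmul _ _ _ fun l _ =>
    norm_cellFourier_le hm (j + 1) ξ l).trans (le_of_eq ?_)
  have hM := scale_pos_real hm j
  have hmj := m_pos_real hm j
  rw [card_children, nsmul_eq_mul, scale_succ_real]
  field_simp

lemma subcell_subset {m : ℕ → ℕ} (hm : IsAdmissible m) {j k l : ℕ} (hl : l ∈ children m j k) :
    Icc ((l : ℝ) / scale m (j + 1)) (((l : ℝ) + 1) / scale m (j + 1)) ⊆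
      Icc ((k : ℝ) / scale m j) (((k : ℝ) + 1) / scale m j) := by
  have h := cell_subset_ancestor hm (Nat.le_succ j) l
  rwa [Nat.succ_eq_add_one, ancestor_succ le_rfl, ancestor_self hm, div_of_mem_children hl] at h

lemma sum_children_norm_le_of_not_resonates {d : ℕ} {m : ℕ → ℕ} (hm : IsAdmissible m) {j : ℕ}
    {ξ : EuclideanSpace ℝ (Fin d)} {k : ℕ} {h : ℝ} (hh : 0 < h)
    (H : ¬ Resonates (scale m j) h ξ k) :
    ∑ l ∈ children m j k, ‖cellFourier m (j + 1) ξ l‖ ≤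
      m (j + 1) * (2 ^ (d + d * (2 * d)) * (2 / h)) := by
  have hM := scale_pos_real hm (j + 1)
  refine (Finset.sum_le_card_nsmul _ _ (2 ^ (d + d * (2 * d)) * (2 / h)) fun l hl => ?_).trans
    (le_of_eq ?_)
  · refine norm_integral_osc_le_of_large (natDegree_phase_le ξ) (by gcongr; linarith) hh ?_
    intro t ht
    by_contra! hcon
    refine H ⟨t, subcell_subset hm hl ht, fun e h1 h2 => ?_⟩
    rw [one_mul]
    exact hcon e h1 h2
  · rw [card_children, nsmul_eq_mul]

/-- Every cell resonates at some frequency, because the derivatives at its left end point are finite. -/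
lemma exists_resonates {d : ℕ} {ρ : ℝ} (hρ : 1 ≤ ρ) (ξ : EuclideanSpace ℝ (Fin d)) (k : ℕ) :
    ∃ n : ℕ, Resonates ρ (2 ^ n * ρ) ξ k := by
  set t : ℝ := k / ρ
  obtain ⟨n, hn⟩ := pow_unbounded_of_one_lt
    (∑ e ∈ Finset.range (d + 1), |(Polynomial.derivative^[e] (phase ξ)).eval t|) one_lt_two
  refine ⟨n, t, left_mem_Icc.2 (by gcongr; linarith), fun e h1 h2 => ?_⟩
  have h3 : |(Polynomial.derivative^[e] (phase ξ)).eval t| ≤ 2 ^ n :=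
    (Finset.single_le_sum (f := fun e => |(Polynomial.derivative^[e] (phase ξ)).eval t|)
      (fun _ _ => abs_nonneg _) (Finset.mem_range.2 (by omega))).trans hn.le
  have h4 : (1 : ℝ) ≤ 2 ^ n := one_le_pow₀ one_le_two
  have h5 : (1 : ℝ) ≤ 2 ^ n * ρ := one_le_mul_of_one_le_of_one_le h4 hρ
  rw [one_mul]
  calc _ ≤ (2 : ℝ) ^ n := h3
    _ ≤ 2 ^ n * ρ := le_mul_of_one_le_right (by positivity) hρ
    _ ≤ _ := le_self_pow₀ h5 (by omega)

/-- The square function of the cells of `S j` is dominated by the resonance sum. -/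
lemma sum_sq_le_resonanceSum {d : ℕ} {m : ℕ → ℕ} (hm : IsAdmissible m) (S : ℕ → Finset ℕ) (j : ℕ)
    (ξ : EuclideanSpace ℝ (Fin d)) :
    ENNReal.ofReal (∑ k ∈ S j, (∑ l ∈ children m j k, ‖cellFourier m (j + 1) ξ l‖) ^ 2) ≤
      ENNReal.ofReal ((4 * 2 ^ (d + d * (2 * d)) * m (j + 1) / scale m j) ^ 2) *
        resonanceSum m S j ξ := by
  classical
  have hM := scale_pos_real hm j
  set M : ℝ := (scale m j : ℝ) with hMdef
  set K : ℝ := 2 ^ (d + d * (2 * d)) with hK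
  have hK1 : 1 ≤ K := one_le_pow₀ one_le_two
  have hm1 := one_le_m_real hm j
  set μ : ℝ := (m (j + 1) : ℝ) with hμ
  set B : ℝ := 4 * K * μ / M with hB
  have key : ∀ k, ENNReal.ofReal ((∑ l ∈ children m j k, ‖cellFourier m (j + 1) ξ l‖) ^ 2) ≤
      ENNReal.ofReal (B ^ 2) * ∑' n : ℕ, ENNReal.ofReal ((1 / 4) ^ n) *
        (if Resonates M (2 ^ n * M) ξ k then 1 else 0) := by
    intro k
    -- If `2ⁿ M_j` is the first frequency at which the cell resonates, then it does not resonate at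
    -- half of it, so the sum over its children is at most `B 2⁻ⁿ`.
    have hex := exists_resonates (one_le_scale_real hm j) ξ k
    have hspec := Nat.find_spec hex
    have hmin := fun n => Nat.find_min hex (m := n)
    set n := Nat.find hex
    have h0 : 0 ≤ ∑ l ∈ children m j k, ‖cellFourier m (j + 1) ξ l‖ :=
      Finset.sum_nonneg fun _ _ => norm_nonneg _
    have hle : ∑ l ∈ children m j k, ‖cellFourier m (j + 1) ξ l‖ ≤ B * (1 / 2) ^ n := by
      rcases Nat.eq_zero_or_pos n with hn | hn
      · rw [hn, pow_zero, mul_one]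
        refine (sum_children_norm_le hm j ξ k).trans ?_
        rw [hB]
        have : 1 ≤ 4 * K * μ := by nlinarith
        gcongr
      · have h1 := sum_children_norm_le_of_not_resonates hm (by positivity)
          (hmin (n - 1) (by omega))
        refine h1.trans (le_of_eq ?_)
        have : (2 : ℝ) ^ n = 2 ^ (n - 1) * 2 := by rw [← pow_succ]; congr 1; omega
        rw [hB, one_div, inv_pow, this, ← hK, ← hμ, ← hMdef]
        field_simp
        norm_num
    refine le_trans ?_ (mul_le_mul' le_rfl (ENNReal.le_tsum n))
    rw [if_pos hspec, mul_one, ← ENNReal.ofReal_mul (by positivity)]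
    refine ENNReal.ofReal_le_ofReal ?_
    calc _ ≤ (B * (1 / 2) ^ n) ^ 2 := by gcongr
      _ = _ := by rw [mul_pow, ← pow_mul, mul_comm n 2, pow_mul]; norm_num
  rw [ENNReal.ofReal_sum_of_nonneg fun _ _ => by positivity]
  refine (Finset.sum_le_sum fun k _ => key k).trans (le_of_eq ?_)
  rw [← Finset.mul_sum, ← Summable.tsum_finsetSum (fun _ _ => ENNReal.summable)]
  congr 1
  refine tsum_congr fun n => ?_
  rw [← Finset.mul_sum, Finset.sum_boole, resonanceCount]

/-! ### The cells of the random sets -/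

open Classical in
/-- The indices of the level `j` cells whose left end point lies in `A`. -/
def activeCells (m : ℕ → ℕ) (j : ℕ) (A : Set ℝ) : Finset ℕ :=
  (Finset.range (scale m j)).filter fun k => (k : ℝ) / scale m j ∈ A

lemma mem_activeCells {m : ℕ → ℕ} {j : ℕ} {A : Set ℝ} {k : ℕ} :
    k ∈ activeCells m j A ↔ k < scale m j ∧ (k : ℝ) / scale m j ∈ A := by
  simp [activeCells]

lemma eq_of_mem_cells {M : ℝ} (hM : 0 < M) {k k' : ℕ} {t : ℝ}
    (h : t ∈ Ico ((k : ℝ) / M) (((k : ℝ) + 1) / M))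
    (h' : t ∈ Ico ((k' : ℝ) / M) (((k' : ℝ) + 1) / M)) : k = k' := by
  have h1 : (k : ℝ) / M < ((k' : ℝ) + 1) / M := h.1.trans_lt h'.2
  have h2 : (k' : ℝ) / M < ((k : ℝ) + 1) / M := h'.1.trans_lt h.2
  rw [div_lt_div_iff_of_pos_right hM] at h1 h2
  have h3 : k < k' + 1 := by exact_mod_cast h1
  have h4 : k' < k + 1 := by exact_mod_cast h2
  omega

lemma left_mem_cell {M : ℝ} (hM : 0 < M) (k : ℕ) :
    (k : ℝ) / M ∈ Ico ((k : ℝ) / M) (((k : ℝ) + 1) / M) := by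
  refine left_mem_Ico.2 ?_
  gcongr
  linarith

lemma measurableSet_activeCells_eq (m : ℕ → ℕ) (j : ℕ) (T : Finset ℕ) :
    MeasurableSet {A : Set ℝ | activeCells m j A = T} := by
  by_cases hT : T ⊆ Finset.range (scale m j)
  · have : {A : Set ℝ | activeCells m j A = T} = ⋂ k ∈ Finset.range (scale m j),
        {A : Set ℝ | (k : ℝ) / scale m j ∈ A ↔ k ∈ T} := by
      ext A
      simp only [mem_ofPred_eq, mem_iInter]
      constructor
      · rintro rfl k hk
        rw [mem_activeCells]
        exact ⟨fun h => ⟨Finset.mem_range.1 hk, h⟩, fun h => h.2⟩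
      · intro h
        ext k
        rw [mem_activeCells]
        constructor
        · rintro ⟨h1, h2⟩
          exact (h k (Finset.mem_range.2 h1)).1 h2
        · intro hk
          exact ⟨Finset.mem_range.1 (hT hk), (h k (hT hk)).2 hk⟩
    rw [this]
    refine Finset.measurableSet_biInter _ fun k _ => ?_
    have h1 : MeasurableSet {A : Set ℝ | (k : ℝ) / scale m j ∈ A} :=
      measurableSet_setOfPred.2 (measurable_set_mem _)
    by_cases hk : k ∈ T
    · simpa [hk] using h1
    · have : {A : Set ℝ | (k : ℝ) / scale m j ∈ A ↔ k ∈ T} =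
          {A : Set ℝ | (k : ℝ) / scale m j ∈ A}ᶜ := by
        ext A; simp [hk]
      rw [this]
      exact h1.compl
  · have : {A : Set ℝ | activeCells m j A = T} = ∅ := by
      ext A
      simp only [mem_ofPred_eq, mem_empty_iff_false, iff_false]
      rintro rfl
      exact hT fun k hk => Finset.mem_range.2 (mem_activeCells.1 hk).1
    rw [this]
    exact MeasurableSet.empty

open Classical in
/-- The indicator that the `k`-th cell of level `j` is contained in `E_j`. -/
def activity {Ω : Type*} (m : ℕ → ℕ) (E : ℕ → Ω → Set ℝ) (j k : ℕ) (ω : Ω) : ℝ :=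
  if k ∈ activeCells m j (E j ω) then 1 else 0

lemma activity_nonneg {Ω : Type*} (m : ℕ → ℕ) (E : ℕ → Ω → Set ℝ) (j k : ℕ) (ω : Ω) :
    0 ≤ activity m E j k ω := by unfold activity; split_ifs <;> norm_num

lemma activity_le_one {Ω : Type*} (m : ℕ → ℕ) (E : ℕ → Ω → Set ℝ) (j k : ℕ) (ω : Ω) :
    activity m E j k ω ≤ 1 := by unfold activity; split_ifs <;> norm_num

section
variable {Ω : Type*} [MeasurableSpace Ω] {P : Measure Ω} {m : ℕ → ℕ} {β : ℕ → ℝ}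
  {E : ℕ → Ω → Set ℝ}

lemma IsRandomCantor.mem_iff (hE : IsRandomCantor P m β E) (hm : IsAdmissible m) {j k : ℕ}
    (hk : k < scale m j) {t : ℝ}
    (ht : t ∈ Ico ((k : ℝ) / scale m j) (((k : ℝ) + 1) / scale m j)) (ω : Ω) :
    t ∈ E j ω ↔ k ∈ activeCells m j (E j ω) := by
  have hM := scale_pos_real hm j
  obtain ⟨S, hS⟩ := hE.union j ω
  have key : ∀ s ∈ Ico ((k : ℝ) / scale m j) (((k : ℝ) + 1) / scale m j),
      s ∈ E j ω ↔ (⟨k, hk⟩ : Fin (scale m j)) ∈ S := by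
    intro s hs
    rw [hS, mem_iUnion₂]
    constructor
    · rintro ⟨k', hk', hs'⟩
      have := eq_of_mem_cells hM hs hs'
      rwa [show (⟨k, hk⟩ : Fin (scale m j)) = k' from Fin.ext this]
    · exact fun h => ⟨_, h, hs⟩
  rw [mem_activeCells, key t ht, key _ (left_mem_cell hM k)]
  exact ⟨fun h => ⟨hk, h⟩, fun h => h.2⟩

lemma IsRandomCantor.eq_iff (hE : IsRandomCantor P m β E) (hm : IsAdmissible m) {j : ℕ}
    (ω ω' : Ω) : E j ω = E j ω' ↔ activeCells m j (E j ω) = activeCells m j (E j ω') := by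
  refine ⟨fun h => by rw [h], fun h => ?_⟩
  have key : ∀ ω ω', activeCells m j (E j ω) = activeCells m j (E j ω') → E j ω ⊆ E j ω' := by
    intro ω ω' h t ht
    obtain ⟨S, hS⟩ := hE.union j ω
    have ht' := ht
    rw [hS, mem_iUnion₂] at ht
    obtain ⟨k, -, htk⟩ := ht
    rw [hE.mem_iff hm k.2 htk] at ht' ⊢
    rwa [← h]
  exact (key _ _ h).antisymm (key _ _ h.symm)

lemma IsRandomCantor.measurableSet_active (hE : IsRandomCantor P m β E) (j : ℕ) (T : Finset ℕ) :
    MeasurableSet {ω | activeCells m j (E j ω) = T} :=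
  hE.measurable j (measurableSet_activeCells_eq m j T)

lemma IsRandomCantor.measurable_activity (hE : IsRandomCantor P m β E) (j k : ℕ) :
    Measurable (activity m E j k) := by
  classical
  have h1 : MeasurableSet {ω | k ∈ activeCells m j (E j ω)} := by
    by_cases hk : k < scale m j
    · have : {ω | k ∈ activeCells m j (E j ω)} =
          E j ⁻¹' {A : Set ℝ | (k : ℝ) / scale m j ∈ A} := by
        ext ω; simp [mem_activeCells, hk]
      rw [this]
      exact hE.measurable j (measurableSet_setOfPred.2 (measurable_set_mem _))
    · have : {ω | k ∈ activeCells m j (E j ω)} = ∅ := by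
        ext ω; simp [mem_activeCells, hk]
      rw [this]; exact MeasurableSet.empty
  exact Measurable.ite h1 measurable_const measurable_const

lemma IsRandomCantor.density_eq (hE : IsRandomCantor P m β E) (hm : IsAdmissible m) {j k : ℕ}
    (hk : k < scale m j) {t : ℝ}
    (ht : t ∈ Ico ((k : ℝ) / scale m j) (((k : ℝ) + 1) / scale m j)) (ω : Ω) :
    density (β j) (E j ω) t = β j * activity m E j k ω := by
  unfold density activity
  by_cases h : t ∈ E j ω
  · rw [indicator_of_mem h, if_pos ((hE.mem_iff hm hk ht ω).1 h), mul_one]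
  · rw [indicator_of_notMem h, if_neg (fun h' => h ((hE.mem_iff hm hk ht ω).2 h')), mul_zero]

lemma IsRandomCantor.one_le_beta (hE : IsRandomCantor P m β E) (j : ℕ) : 1 ≤ β j := by
  rw [← hE.beta_zero]; exact hE.mono (Nat.zero_le j)

lemma cell_point_mem_Icc (hm : IsAdmissible m) {j k : ℕ} (hk : k < scale m j) :
    (k : ℝ) / scale m j ∈ Icc (0 : ℝ) 1 := by
  have hM := scale_pos_real hm j
  refine ⟨by positivity, ?_⟩
  rw [div_le_one hM]
  exact Nat.cast_le.2 hk.le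

lemma parent_lt {j l : ℕ} (hl : l < scale m (j + 1)) : l / m (j + 1) < scale m j := by
  rw [scale_succ] at hl
  exact Nat.div_lt_of_lt_mul (by rwa [mul_comm])

lemma mem_children_parent (hm : IsAdmissible m) {j l : ℕ} : l ∈ children m j (l / m (j + 1)) := by
  have h2 := hm.two_le (j + 1) (by omega)
  rw [children, Finset.mem_Ico]
  refine ⟨Nat.div_mul_le_self _ _, ?_⟩
  have := Nat.lt_div_mul_add (by omega : 0 < m (j + 1)) (a := l)
  rw [add_mul, one_mul]; omega

lemma lt_scale_of_mem_children {j k l : ℕ} (hk : k < scale m j) (hl : l ∈ children m j k) :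
    l < scale m (j + 1) := by
  rw [children, Finset.mem_Ico] at hl
  rw [scale_succ]
  exact hl.2.trans_le (Nat.mul_le_mul_right _ hk)

lemma subcell_point_mem (hm : IsAdmissible m) {j k l : ℕ} (hl : l ∈ children m j k) :
    (l : ℝ) / scale m (j + 1) ∈ Ico ((k : ℝ) / scale m j) (((k : ℝ) + 1) / scale m j) := by
  have hM := scale_pos_real hm (j + 1)
  have hlt : (l : ℝ) / scale m (j + 1) < ((l : ℝ) + 1) / scale m (j + 1) := by gcongr; linarith
  have h := subcell_subset hm hl
  exact ⟨(h (left_mem_Icc.2 hlt.le)).1, hlt.trans_le (h (right_mem_Icc.2 hlt.le)).2⟩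

/-- The martingale property at the left end points of the cells, conditioned on `E_j`. -/
lemma IsRandomCantor.setIntegral_activity (hE : IsRandomCantor P m β E) [IsProbabilityMeasure P]
    (hm : IsAdmissible m) {j l : ℕ} (hl : l < scale m (j + 1)) (T : Finset ℕ) :
    ∫ ω in {ω | activeCells m j (E j ω) = T}, β (j + 1) * activity m E (j + 1) l ω ∂P =
      ∫ ω in {ω | activeCells m j (E j ω) = T}, β j * activity m E j (l / m (j + 1)) ω ∂P := by
  set x : ℝ := (l : ℝ) / scale m (j + 1) with hx
  have h1 : ∀ ω, density (β (j + 1)) (E (j + 1) ω) x = β (j + 1) * activity m E (j + 1) l ω :=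
    fun ω => hE.density_eq hm hl (left_mem_cell (scale_pos_real hm _) l) ω
  have h2 : ∀ ω, density (β j) (E j ω) x = β j * activity m E j (l / m (j + 1)) ω :=
    fun ω => hE.density_eq hm (parent_lt hl) (subcell_point_mem hm (mem_children_parent hm)) ω
  have h3 := hE.condExp_eq j x (cell_point_mem_Icc hm hl)
  simp only [h1, h2] at h3
  rw [← setIntegral_condExp (hE.measurable j).comap_le]
  · refine setIntegral_congr_ae (hE.measurableSet_active j T) ?_
    filter_upwards [h3] with ω hω _
    exact hω
  · refine Integrable.const_mul ?_ _
    refine Integrable.of_bound (hE.measurable_activity _ _).aestronglyMeasurable 1 ?_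
    refine ae_of_all _ fun ω => ?_
    rw [Real.norm_of_nonneg (activity_nonneg _ _ _ _ _)]
    exact activity_le_one _ _ _ _ _
  · exact ⟨_, measurableSet_activeCells_eq m j T, rfl⟩

/-! ### A conditional moment inequality -/

/-- The increment `∑ (β_{j+1} 1_{l ⊆ E_{j+1}} - β_j 1_{l ⊆ E_j}) c_l` of a linear statistic. -/
def increment (m : ℕ → ℕ) (β : ℕ → ℝ) (E : ℕ → Ω → Set ℝ) (j : ℕ) (c : ℕ → ℂ) (ω : Ω) : ℂ :=
  ∑ l ∈ Finset.range (scale m (j + 1)),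
    ((β (j + 1) * activity m E (j + 1) l ω - β j * activity m E j (l / m (j + 1)) ω : ℝ) : ℂ) * c l

/-- The square function that controls the moments of `increment`. -/
def squareSum (m : ℕ → ℕ) (β : ℕ → ℝ) (j : ℕ) (c : ℕ → ℂ) (T : Finset ℕ) : ℝ :=
  β (j + 1) ^ 2 * ∑ k ∈ T, (∑ l ∈ children m j k, ‖c l‖) ^ 2

lemma abs_rpow_le_exp_add {p : ℝ} (hp : 0 ≤ p) (y : ℝ) :
    |y| ^ p ≤ (1 + (⌈p⌉₊.factorial : ℝ)) * (Real.exp y + Real.exp (-y)) := by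
  set n := ⌈p⌉₊
  have h1 : |y| ^ p ≤ 1 + |y| ^ n := by
    rcases le_total |y| 1 with h | h
    · have := Real.rpow_le_one (abs_nonneg y) h hp
      have : 0 ≤ |y| ^ n := by positivity
      linarith
    · have : |y| ^ p ≤ |y| ^ (n : ℝ) := Real.rpow_le_rpow_of_exponent_le h (Nat.le_ceil p)
      rw [Real.rpow_natCast] at this
      linarith
  have h2 := Real.pow_div_factorial_le_exp |y| (abs_nonneg y) n
  have hn : (0 : ℝ) < n.factorial := by exact_mod_cast Nat.factorial_pos n
  rw [div_le_iff₀ hn] at h2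
  have h3 : Real.exp |y| ≤ Real.exp y + Real.exp (-y) := by
    rcases abs_cases y with ⟨h, _⟩ | ⟨h, _⟩ <;> rw [h]
    · linarith [Real.exp_pos (-y)]
    · linarith [Real.exp_pos y]
  have h4 : 1 ≤ Real.exp |y| := Real.one_le_exp (abs_nonneg y)
  nlinarith

/-- Moments of a sub-Gaussian variable, by optimizing the exponential bound. -/
lemma HasSubgaussianMGF.lintegral_rpow_le {X : Ω → ℝ} {c : NNReal} {μ : Measure Ω}
    [IsProbabilityMeasure μ] (hX : ProbabilityTheory.HasSubgaussianMGF X c μ) {p : ℝ} (hp : 0 < p) :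
    ∫⁻ ω, ‖X ω‖ₑ ^ p ∂μ ≤ ENNReal.ofReal ((1 + (⌈p⌉₊.factorial : ℝ)) * (2 * Real.exp (1 / 2))) *
      (c : ℝ≥0∞) ^ (p / 2) := by
  set K : ℝ := 1 + (⌈p⌉₊.factorial : ℝ) with hK
  rcases eq_or_ne c 0 with rfl | hc
  · have h0 := hX.ae_eq_zero_of_hasSubgaussianMGF_zero
    rw [lintegral_congr_ae (g := fun _ => 0)]
    · simp
    · filter_upwards [h0] with ω hω
      simp [hω, hp]
  · have hc0 : (0 : ℝ) < c := NNReal.coe_pos.2 (pos_iff_ne_zero.2 hc)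
    -- The optimal parameter in the exponential bound.
    set t : ℝ := (Real.sqrt c)⁻¹ with ht
    have hs : 0 < Real.sqrt c := Real.sqrt_pos.2 hc0
    have hsq : (c : ℝ) * t ^ 2 = 1 := by
      rw [ht, inv_pow, Real.sq_sqrt hc0.le, mul_inv_cancel₀ hc0.ne']
    have hpt : ∀ ω, ‖X ω‖ₑ ^ p ≤ ENNReal.ofReal ((c : ℝ) ^ (p / 2) *
        (K * (Real.exp (t * X ω) + Real.exp (-t * X ω)))) := by
      intro ω
      rw [← ofReal_norm, ENNReal.ofReal_rpow_of_nonneg (norm_nonneg _) hp.le]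
      refine ENNReal.ofReal_le_ofReal ?_
      have h1 := abs_rpow_le_exp_add hp.le (t * X ω)
      rw [abs_mul, abs_of_pos (by positivity : 0 < t), Real.mul_rpow (by positivity)
        (abs_nonneg _)] at h1
      have h2 : (c : ℝ) ^ (p / 2) * t ^ p = 1 := by
        rw [ht, Real.inv_rpow hs.le, Real.sqrt_eq_rpow, ← Real.rpow_mul hc0.le,
          show 1 / 2 * p = p / 2 by ring]
        exact mul_inv_cancel₀ (by positivity)
      calc ‖X ω‖ ^ p = (c : ℝ) ^ (p / 2) * (t ^ p * |X ω| ^ p) := by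
            rw [← mul_assoc, h2, one_mul, Real.norm_eq_abs]
        _ ≤ _ := by
            rw [neg_mul]
            gcongr
    refine (lintegral_mono hpt).trans ?_
    have i1 := hX.integrable_exp_mul t
    have i2 := hX.integrable_exp_mul (-t)
    have i3 : Integrable (fun ω => (c : ℝ) ^ (p / 2) *
        (K * (Real.exp (t * X ω) + Real.exp (-t * X ω)))) μ :=
      ((i1.add i2).const_mul K).const_mul _
    rw [← ofReal_integral_eq_lintegral_ofReal i3 (ae_of_all _ fun ω => by positivity), integral_const_mul, integral_const_mul,
      integral_add i1 i2, mul_comm ((c : ℝ) ^ (p / 2)), ENNReal.ofReal_mul' (by positivity),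
      ← ENNReal.ofReal_rpow_of_nonneg hc0.le (by positivity), ENNReal.ofReal_coe_nnreal]
    gcongr
    have m1 := hX.mgf_le t
    have m2 := hX.mgf_le (-t)
    rw [neg_sq] at m2
    rw [hsq] at m1 m2
    unfold mgf at m1 m2
    linarith

end

/-- The contribution of the `k`-th cell of level `j` to the increment of a real linear statistic. -/
def cellIncrement {Ω : Type*} (m : ℕ → ℕ) (β : ℕ → ℝ) (E : ℕ → Ω → Set ℝ) (j : ℕ) (c : ℕ → ℝ)
    (k : ℕ) (ω : Ω) : ℝ :=
  ∑ l ∈ children m j k, (β (j + 1) * activity m E (j + 1) l ω - β j * activity m E j k ω) * c l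

lemma increment_eq {Ω : Type*} {m : ℕ → ℕ} {β : ℕ → ℝ} {E : ℕ → Ω → Set ℝ} (j : ℕ) (c : ℕ → ℂ) (ω : Ω) :
    increment m β E j c ω =
      ((∑ k ∈ Finset.range (scale m j), cellIncrement m β E j (fun l => (c l).re) k ω : ℝ) : ℂ) +
      ((∑ k ∈ Finset.range (scale m j), cellIncrement m β E j (fun l => (c l).im) k ω : ℝ) : ℂ) *
        Complex.I := by
  unfold increment cellIncrement
  rw [sum_range_scale_succ]
  push_cast
  rw [Finset.sum_mul, ← Finset.sum_add_distrib]
  refine Finset.sum_congr rfl fun k _ => ?_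
  rw [Finset.sum_mul, ← Finset.sum_add_distrib]
  refine Finset.sum_congr rfl fun l hl => ?_
  rw [div_of_mem_children hl]
  conv_lhs => rw [← Complex.re_add_im (c l)]
  ring

section
variable {Ω : Type*} [MeasurableSpace Ω] {P : Measure Ω} {m : ℕ → ℕ} {β : ℕ → ℝ}
  {E : ℕ → Ω → Set ℝ}

lemma IsRandomCantor.measurable_cellIncrement (hE : IsRandomCantor P m β E) (j : ℕ) (c : ℕ → ℝ)
    (k : ℕ) : Measurable (cellIncrement m β E j c k) :=
  Finset.measurable_sum _ fun l _ => (((hE.measurable_activity (j + 1) l).const_mul _).sub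
    ((hE.measurable_activity j k).const_mul _)).mul_const _

lemma integral_cond_eq_zero {A : Set Ω} {f : Ω → ℝ} (h : ∫ ω in A, f ω ∂P = 0) :
    ∫ ω, f ω ∂P[|A] = 0 := by
  rw [ProbabilityTheory.cond, integral_smul_measure, h, smul_zero]

lemma IsRandomCantor.integrable_activity (hE : IsRandomCantor P m β E) {μ : Measure Ω}
    [IsFiniteMeasure μ] (j k : ℕ) : Integrable (activity m E j k) μ := by
  refine Integrable.of_bound (hE.measurable_activity _ _).aestronglyMeasurable 1 ?_
  refine ae_of_all _ fun ω => ?_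
  rw [Real.norm_of_nonneg (activity_nonneg _ _ _ _ _)]
  exact activity_le_one _ _ _ _ _

lemma IsRandomCantor.integral_sub_activity (hE : IsRandomCantor P m β E) [IsProbabilityMeasure P]
    (hm : IsAdmissible m) {j k l : ℕ} (hk : k < scale m j) (hl : l ∈ children m j k)
    (T : Finset ℕ) :
    ∫ ω in {ω | activeCells m j (E j ω) = T},
      (β (j + 1) * activity m E (j + 1) l ω - β j * activity m E j k ω) ∂P = 0 := by
  have h := hE.setIntegral_activity hm (lt_scale_of_mem_children hk hl) T
  rw [div_of_mem_children hl] at h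
  rw [integral_sub ((hE.integrable_activity _ _).const_mul _)
    ((hE.integrable_activity _ _).const_mul _), h, sub_self]

/-- A cell outside `E_j` has almost surely no descendants in `E_{j+1}`. -/
lemma IsRandomCantor.ae_activity_eq_zero (hE : IsRandomCantor P m β E) [IsProbabilityMeasure P]
    (hm : IsAdmissible m) {j k l : ℕ} (hk : k < scale m j) (hl : l ∈ children m j k)
    {T : Finset ℕ} (hkT : k ∉ T) :
    ∀ᵐ ω ∂P, activeCells m j (E j ω) = T → activity m E (j + 1) l ω = 0 := by
  have h := hE.setIntegral_activity hm (lt_scale_of_mem_children hk hl) T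
  rw [div_of_mem_children hl] at h
  have hA := hE.measurableSet_active j T
  have h0 : ∫ ω in {ω | activeCells m j (E j ω) = T}, β j * activity m E j k ω ∂P = 0 := by
    rw [setIntegral_congr_fun (g := fun _ => (0 : ℝ)) hA]
    · simp
    · intro ω hω
      have hω' : activeCells m j (E j ω) = T := hω
      simp [activity, hω', hkT]
  have hβ : 0 < β (j + 1) := lt_of_lt_of_le one_pos (hE.one_le_beta _)
  rw [h0, setIntegral_eq_zero_iff_of_nonneg_ae
    (ae_of_all _ fun ω => mul_nonneg hβ.le (activity_nonneg _ _ _ _ _))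
    ((hE.integrable_activity _ _).const_mul _).integrableOn] at h
  rw [Filter.EventuallyEq, ae_restrict_iff' hA] at h
  filter_upwards [h] with ω hω hT
  have := hω hT
  simpa [hβ.ne'] using this

/-- Almost surely the cells of `E_{j+1}` lie in cells of `E_j`. -/
lemma IsRandomCantor.ae_parent_mem (hE : IsRandomCantor P m β E) [IsProbabilityMeasure P]
    (hm : IsAdmissible m) :
    ∀ᵐ ω ∂P, ∀ j, ∀ l ∈ activeCells m (j + 1) (E (j + 1) ω),
      l / m (j + 1) ∈ activeCells m j (E j ω) := by
  rw [ae_all_iff]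
  intro j
  have key : ∀ T ∈ (Finset.range (scale m j)).powerset, ∀ l ∈ Finset.range (scale m (j + 1)),
      ∀ᵐ ω ∂P, l / m (j + 1) ∉ T → activeCells m j (E j ω) = T →
        activity m E (j + 1) l ω = 0 := by
    intro T _ l hl
    by_cases h : l / m (j + 1) ∈ T
    · exact ae_of_all _ fun ω h' => absurd h h'
    · filter_upwards [hE.ae_activity_eq_zero hm (parent_lt (Finset.mem_range.1 hl))
        (mem_children_parent hm) h] with ω hω _
      exact hω
  have key' := (Filter.eventually_all_finset _).2 fun T hT =>
    (Filter.eventually_all_finset _).2 (key T hT)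
  filter_upwards [key'] with ω hω l hl
  by_contra hcon
  have hT : activeCells m j (E j ω) ∈ (Finset.range (scale m j)).powerset :=
    Finset.mem_powerset.2 fun k hk => Finset.mem_range.2 (mem_activeCells.1 hk).1
  have := hω _ hT l (Finset.mem_range.2 (mem_activeCells.1 hl).1) hcon rfl
  simp [activity, hl] at this

open Classical in
/-- Conditioned on `E_j`, the increment of a real linear statistic is sub-Gaussian (Hoeffding). -/
lemma IsRandomCantor.hasSubgaussianMGF (hE : IsRandomCantor P m β E) [IsProbabilityMeasure P]
    (hm : IsAdmissible m) (j : ℕ) (c : ℕ → ℝ) (T : Finset ℕ)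
    (hT : P {ω | activeCells m j (E j ω) = T} ≠ 0) :
    ∃ v : NNReal, (v : ℝ) = squareSum m β j (fun l => (c l : ℂ)) T ∧
      HasSubgaussianMGF (fun ω => ∑ k ∈ Finset.range (scale m j), cellIncrement m β E j c k ω) v
        P[|{ω | activeCells m j (E j ω) = T}] := by
  have hA := hE.measurableSet_active j T
  obtain ⟨ω₀, hω₀⟩ : {ω | activeCells m j (E j ω) = T}.Nonempty :=
    nonempty_of_measure_ne_zero hT
  have hω₀ : activeCells m j (E j ω₀) = T := hω₀
  have hTr : T ⊆ Finset.range (scale m j) := by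
    rw [← hω₀]
    exact fun k hk => Finset.mem_range.2 (mem_activeCells.1 hk).1
  have hset : {ω | E j ω = E j ω₀} = {ω | activeCells m j (E j ω) = T} := by
    ext ω
    simp only [mem_ofPred_eq]
    rw [hE.eq_iff hm, hω₀]
  set μ := P[|{ω | activeCells m j (E j ω) = T}] with hμ
  have : IsProbabilityMeasure μ := cond_isProbabilityMeasure hT
  have hTae : ∀ᵐ ω ∂μ, activeCells m j (E j ω) = T := ae_cond_mem hA
  have hβ0 : 0 ≤ β (j + 1) := zero_le_one.trans (hE.one_le_beta _)
  have hβj : 0 ≤ β j := zero_le_one.trans (hE.one_le_beta _)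
  have hββ : β j ≤ β (j + 1) := hE.mono (Nat.le_succ j)
  -- independence of the contributions of the cells
  set F : Fin (scale m j) → Set ℝ → ℝ := fun k A => ∑ l ∈ children m j k,
    (β (j + 1) * (if (l : ℝ) / scale m (j + 1) ∈ A then 1 else 0) -
      β j * (if (k : ℕ) ∈ T then 1 else 0)) * c l with hF
  have hFm : ∀ k, Measurable (F k) := fun k => Finset.measurable_sum _ fun l _ =>
    ((((Measurable.ite (measurableSet_setOfPred.2 (measurable_set_mem _)) measurable_const
      measurable_const).const_mul _).sub measurable_const).mul_const _)
  have hind : iIndepFun (fun (k : Fin (scale m j)) ω => cell m j k ∩ E (j + 1) ω) μ := by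
    have := hE.indep j (E j ω₀) (by rwa [hset])
    rwa [hset] at this
  have hind2 := hind.comp F hFm
  have hcongr : ∀ k : Fin (scale m j), (F k ∘ fun ω => cell m j k ∩ E (j + 1) ω) =ᵐ[μ]
      cellIncrement m β E j c k := by
    intro k
    filter_upwards [hTae] with ω hω
    simp only [Function.comp, hF, cellIncrement]
    refine Finset.sum_congr rfl fun l hl => ?_
    have h1 : (l : ℝ) / scale m (j + 1) ∈ cell m j k := subcell_point_mem hm hl
    have h2 : (l : ℝ) / scale m (j + 1) ∈ cell m j k ∩ E (j + 1) ω ↔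
        l ∈ activeCells m (j + 1) (E (j + 1) ω) := by
      rw [mem_inter_iff, mem_activeCells]
      exact ⟨fun h => ⟨lt_scale_of_mem_children k.2 hl, h.2⟩, fun h => ⟨h1, h.2⟩⟩
    simp only [activity, hω, h2]
  have hind3 : iIndepFun (fun k : Fin (scale m j) => cellIncrement m β E j c k) μ :=
    iIndepFun.congr hcongr hind2
  -- each contribution is centred and bounded
  set a : ℕ → ℝ := fun k => if k ∈ T then β (j + 1) * ∑ l ∈ children m j k, |c l| else 0 with ha
  have ha0 : ∀ k, 0 ≤ a k := fun k => by
    rw [ha]; dsimp only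
    split_ifs
    · exact mul_nonneg hβ0 (Finset.sum_nonneg fun _ _ => abs_nonneg _)
    · exact le_rfl
  have hsub : ∀ k : Fin (scale m j), HasSubgaussianMGF (cellIncrement m β E j c k)
      ((‖a k - (-a k)‖₊ / 2) ^ 2) μ := by
    intro k
    refine hasSubgaussianMGF_of_mem_Icc_of_integral_eq_zero
      (hE.measurable_cellIncrement j c k).aemeasurable ?_ ?_
    · by_cases hk : (k : ℕ) ∈ T
      · refine ae_of_all _ fun ω => ?_
        rw [mem_Icc, ← abs_le, ha]
        simp only [if_pos hk]
        refine (Finset.abs_sum_le_sum_abs _ _).trans ?_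
        rw [Finset.mul_sum]
        refine Finset.sum_le_sum fun l _ => ?_
        rw [abs_mul]
        refine mul_le_mul_of_nonneg_right ?_ (abs_nonneg _)
        have p1 := mul_nonneg hβ0 (activity_nonneg m E (j + 1) l ω)
        have p2 := mul_nonneg hβj (activity_nonneg m E j k ω)
        have p3 := mul_le_of_le_one_right hβ0 (activity_le_one m E (j + 1) l ω)
        have p4 := mul_le_of_le_one_right hβj (activity_le_one m E j k ω)
        rw [abs_le]
        constructor <;> linarith
      · have hz : ∀ᵐ ω ∂P, ∀ l ∈ children m j k, activeCells m j (E j ω) = T →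
            activity m E (j + 1) l ω = 0 :=
          (Filter.eventually_all_finset _).2 fun l hl => hE.ae_activity_eq_zero hm k.2 hl hk
        have hz' : ∀ᵐ ω ∂μ, ∀ l ∈ children m j k, activeCells m j (E j ω) = T →
            activity m E (j + 1) l ω = 0 := cond_absolutelyContinuous hz
        filter_upwards [hz', hTae] with ω h1 h2
        have : cellIncrement m β E j c k ω = 0 := by
          refine Finset.sum_eq_zero fun l hl => ?_
          rw [h1 l hl h2]
          simp [activity, h2, hk]
        rw [this]
        simp [ha, hk]
    · unfold cellIncrement
      have hint : ∀ l ∈ children m j k, Integrable (fun ω => (β (j + 1) * activity m E (j + 1) l ω -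
          β j * activity m E j k ω) * c l) μ := fun l _ =>
        (((hE.integrable_activity _ _).const_mul _).sub
          ((hE.integrable_activity _ _).const_mul _)).mul_const _
      rw [integral_finsetSum _ hint]
      refine Finset.sum_eq_zero fun l hl => ?_
      rw [integral_mul_const, integral_cond_eq_zero (hE.integral_sub_activity hm k.2 hl T), zero_mul]
  have hsum := HasSubgaussianMGF.sum_of_iIndepFun hind3 (s := Finset.univ) fun k _ => hsub k
  refine ⟨_, ?_, hsum.congr (ae_of_all _ fun ω => ?_)⟩
  · push_cast
    have e1 : ∀ k : ℕ, (‖a k - -a k‖ / 2) ^ 2 = a k ^ 2 := fun k => by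
      rw [Real.norm_of_nonneg (by linarith [ha0 k])]; ring
    simp only [e1]
    rw [Fin.sum_univ_eq_sum_range (fun k => a k ^ 2), squareSum, Finset.mul_sum,
      ← Finset.sum_subset hTr]
    · refine Finset.sum_congr rfl fun k hk => ?_
      simp only [ha, if_pos hk, Complex.norm_real, Real.norm_eq_abs]
      ring
    · intro k _ hk
      simp [ha, hk]
  · exact Fin.sum_univ_eq_sum_range (fun k => cellIncrement m β E j c k ω) _

lemma squareSum_mono {j : ℕ} {c c' : ℕ → ℂ} (h : ∀ l, ‖c l‖ ≤ ‖c' l‖) (T : Finset ℕ) :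
    squareSum m β j c T ≤ squareSum m β j c' T := by
  unfold squareSum
  gcongr with k _ l _
  exact h l

lemma enorm_add_rpow_le (a b : ℂ) {p : ℝ} (hp : 0 < p) :
    ‖a + b‖ₑ ^ p ≤ ENNReal.ofReal (2 ^ p) * (‖a‖ₑ ^ p + ‖b‖ₑ ^ p) := by
  have h2 : ENNReal.ofReal (2 ^ p) = 2 ^ p := by
    rw [← ENNReal.ofReal_rpow_of_nonneg (by norm_num) hp.le]; norm_num
  rw [h2]
  calc ‖a + b‖ₑ ^ p ≤ (2 * max ‖a‖ₑ ‖b‖ₑ) ^ p := by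
        refine ENNReal.rpow_le_rpow ((enorm_add_le _ _).trans ?_) hp.le
        rw [two_mul]
        exact add_le_add (le_max_left _ _) (le_max_right _ _)
    _ = 2 ^ p * (max ‖a‖ₑ ‖b‖ₑ) ^ p := ENNReal.mul_rpow_of_nonneg _ _ hp.le
    _ ≤ _ := by
        gcongr
        rcases max_choice ‖a‖ₑ ‖b‖ₑ with h | h <;> rw [h]
        · exact le_self_add
        · exact le_add_self

lemma IsRandomCantor.lintegral_real_cond_le (hE : IsRandomCantor P m β E) [IsProbabilityMeasure P]
    (hm : IsAdmissible m) {p : ℝ} (hp : 0 < p) (j : ℕ) (c : ℕ → ℝ) (c' : ℕ → ℂ)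
    (hc : ∀ l, |c l| ≤ ‖c' l‖) (T : Finset ℕ)
    (hT : P {ω | activeCells m j (E j ω) = T} ≠ 0) :
    ∫⁻ ω, ‖∑ k ∈ Finset.range (scale m j), cellIncrement m β E j c k ω‖ₑ ^ p
        ∂P[|{ω | activeCells m j (E j ω) = T}] ≤
      ENNReal.ofReal ((1 + (⌈p⌉₊.factorial : ℝ)) * (2 * Real.exp (1 / 2))) *
        ENNReal.ofReal (squareSum m β j c' T) ^ (p / 2) := by
  obtain ⟨v, hv, hsub⟩ := hE.hasSubgaussianMGF hm j c T hT
  have : IsProbabilityMeasure P[|{ω | activeCells m j (E j ω) = T}] := cond_isProbabilityMeasure hT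
  refine (HasSubgaussianMGF.lintegral_rpow_le hsub hp).trans ?_
  gcongr
  rw [← ENNReal.ofReal_coe_nnreal, hv]
  refine ENNReal.ofReal_le_ofReal (squareSum_mono (fun l => ?_) T)
  simpa using hc l

/-- The `p`-th moment of an increment is controlled by that of its square function. -/
lemma IsRandomCantor.lintegral_increment_le (hE : IsRandomCantor P m β E) [IsProbabilityMeasure P]
    (hm : IsAdmissible m) {p : ℝ} (hp : 0 < p) :
    ∃ C : ℝ, 0 ≤ C ∧ ∀ (j : ℕ) (c : ℕ → ℂ), ∫⁻ ω, ‖increment m β E j c ω‖ₑ ^ p ∂P ≤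
      ENNReal.ofReal C *
        ∫⁻ ω, ENNReal.ofReal (squareSum m β j c (activeCells m j (E j ω))) ^ (p / 2) ∂P := by
  set K : ℝ := (1 + (⌈p⌉₊.factorial : ℝ)) * (2 * Real.exp (1 / 2)) with hK
  have hK0 : 0 ≤ K := by positivity
  refine ⟨2 ^ p * (K + K), by positivity, fun j c => ?_⟩
  set A : Finset ℕ → Set Ω := fun T => {ω | activeCells m j (E j ω) = T} with hA
  have hAm : ∀ T, MeasurableSet (A T) := fun T => hE.measurableSet_active j T
  have hcover : (⋃ T ∈ (Finset.range (scale m j)).powerset, A T) = univ := by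
    refine eq_univ_of_forall fun ω => mem_iUnion₂.2 ⟨activeCells m j (E j ω), ?_, rfl⟩
    exact Finset.mem_powerset.2 fun k hk => Finset.mem_range.2 (mem_activeCells.1 hk).1
  have hdisj : ((Finset.range (scale m j)).powerset : Set (Finset ℕ)).PairwiseDisjoint A := by
    intro T _ T' _ hne
    refine Set.disjoint_left.2 fun ω h h' => hne ?_
    have h1 : activeCells m j (E j ω) = T := h
    have h2 : activeCells m j (E j ω) = T' := h'
    rw [← h1, h2]
  have hdec : ∀ f : Ω → ℝ≥0∞, ∫⁻ ω, f ω ∂P =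
      ∑ T ∈ (Finset.range (scale m j)).powerset, ∫⁻ ω in A T, f ω ∂P := by
    intro f
    rw [← lintegral_biUnion_finset hdisj (fun T _ => hAm T), hcover, Measure.restrict_univ]
  rw [hdec, hdec, Finset.mul_sum]
  refine Finset.sum_le_sum fun T _ => ?_
  rcases eq_or_ne (P (A T)) 0 with h0 | h0
  · rw [setLIntegral_measure_zero _ _ h0]
    exact zero_le
  have hres : P.restrict (A T) = P (A T) • P[|A T] := by
    rw [ProbabilityTheory.cond, smul_smul, ENNReal.mul_inv_cancel h0 (measure_ne_top _ _), one_smul]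
  have hR : ∫⁻ ω in A T, ENNReal.ofReal (squareSum m β j c (activeCells m j (E j ω))) ^ (p / 2) ∂P =
      P (A T) * ENNReal.ofReal (squareSum m β j c T) ^ (p / 2) := by
    rw [setLIntegral_congr_fun (g := fun _ => ENNReal.ofReal (squareSum m β j c T) ^ (p / 2)) (hAm T)]
    · rw [setLIntegral_const, mul_comm]
    · intro ω hω
      have hω' : activeCells m j (E j ω) = T := hω
      simp only [hω']
  rw [hR, hres, lintegral_smul_measure, smul_eq_mul, mul_left_comm]
  refine mul_le_mul' le_rfl ?_
  have hre := hE.lintegral_real_cond_le hm hp j (fun l => (c l).re) c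
    (fun l => Complex.abs_re_le_norm _) T h0
  have him := hE.lintegral_real_cond_le hm hp j (fun l => (c l).im) c
    (fun l => Complex.abs_im_le_norm _) T h0
  have hmeas : ∀ c' : ℕ → ℝ, Measurable fun ω =>
      ‖∑ k ∈ Finset.range (scale m j), cellIncrement m β E j c' k ω‖ₑ ^ p := fun c' =>
    (Finset.measurable_sum _ fun k _ => hE.measurable_cellIncrement j c' k).enorm.pow_const _
  calc ∫⁻ ω, ‖increment m β E j c ω‖ₑ ^ p ∂P[|A T]
      ≤ ∫⁻ ω, ENNReal.ofReal (2 ^ p) *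
          (‖∑ k ∈ Finset.range (scale m j), cellIncrement m β E j (fun l => (c l).re) k ω‖ₑ ^ p +
          ‖∑ k ∈ Finset.range (scale m j), cellIncrement m β E j (fun l => (c l).im) k ω‖ₑ ^ p)
          ∂P[|A T] := by
        refine lintegral_mono fun ω => ?_
        rw [increment_eq]
        refine (enorm_add_rpow_le _ _ hp).trans (le_of_eq ?_)
        have e1 : ∀ x : ℝ, ‖(x : ℂ)‖ₑ = ‖x‖ₑ := fun x => by
          rw [← ofReal_norm, ← ofReal_norm, Complex.norm_real]
        have e2 : ‖Complex.I‖ₑ = 1 := by rw [← ofReal_norm, Complex.norm_I]; simp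
        rw [enorm_mul, e1, e1, e2, mul_one]
    _ ≤ ENNReal.ofReal (2 ^ p) * (ENNReal.ofReal K *
          ENNReal.ofReal (squareSum m β j c T) ^ (p / 2) + ENNReal.ofReal K *
          ENNReal.ofReal (squareSum m β j c T) ^ (p / 2)) := by
        rw [lintegral_const_mul' _ _ ENNReal.ofReal_ne_top, lintegral_add_left (hmeas _)]
        gcongr
    _ = _ := by
        rw [← add_mul, ← ENNReal.ofReal_add hK0 hK0, ← mul_assoc,
          ← ENNReal.ofReal_mul (by positivity)]

end

/-! ### Growth of the scales and of the heights -/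

/-- Quantitative form of `m_{j+1} = M_j^{o(1)}` and `β_j = M_j^{1-α+o(1)}`, with a loss `ε`. -/
structure IsGrowth (m : ℕ → ℕ) (β : ℕ → ℝ) (α ε C : ℝ) : Prop where
  one_le : 1 ≤ C
  beta_le : ∀ j, β j ≤ C * (scale m j : ℝ) ^ (1 - α + ε)
  le_beta : ∀ j, (scale m j : ℝ) ^ (1 - α - ε) ≤ C * β j
  m_le : ∀ j, (m (j + 1) : ℝ) ≤ C * (scale m j : ℝ) ^ ε
  beta_succ_le : ∀ j, β (j + 1) ≤ C * (scale m j : ℝ) ^ (1 - α + 3 * ε)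
  index_le : ∀ j : ℕ, (j : ℝ) + 1 ≤ C * (scale m j : ℝ) ^ ε

lemma exists_forall_le_of_eventually {f g : ℕ → ℝ} (hg : ∀ j, 0 < g j)
    (h : ∀ᶠ j in atTop, f j ≤ g j) : ∃ C : ℝ, 1 ≤ C ∧ ∀ j, f j ≤ C * g j := by
  obtain ⟨J, hJ⟩ := eventually_atTop.1 h
  have h0 : ∀ i, 0 ≤ |f i| / g i := fun i => div_nonneg (abs_nonneg _) (hg i).le
  have hs : 0 ≤ ∑ i ∈ Finset.range J, |f i| / g i := Finset.sum_nonneg fun i _ => h0 i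
  refine ⟨1 + ∑ i ∈ Finset.range J, |f i| / g i, by linarith, fun j => ?_⟩
  rcases le_or_gt J j with hj | hj
  · refine (hJ j hj).trans (le_mul_of_one_le_left (hg j).le (by linarith))
  · have h1 : |f j| / g j ≤ 1 + ∑ i ∈ Finset.range J, |f i| / g i :=
      (Finset.single_le_sum (f := fun i => |f i| / g i) (fun i _ => h0 i)
        (Finset.mem_range.2 hj)).trans (by linarith)
    exact (le_abs_self _).trans ((div_le_iff₀ (hg j)).1 h1)

lemma index_le_rpow {m : ℕ → ℕ} (hm : IsAdmissible m) {ε : ℝ} (hε : 0 < ε) (j : ℕ) :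
    (j : ℝ) + 1 ≤ (1 + 1 / (ε * Real.log 2)) * (scale m j : ℝ) ^ ε := by
  have hx : 0 < ε * Real.log 2 := mul_pos hε (Real.log_pos one_lt_two)
  set x := ε * Real.log 2 with hxd
  have h1 : 1 + j * x ≤ (scale m j : ℝ) ^ ε := by
    calc 1 + j * x ≤ Real.exp (j * x) := by linarith [Real.add_one_le_exp (j * x)]
      _ = ((2 : ℝ) ^ j) ^ ε := by
          rw [← Real.rpow_natCast, ← Real.rpow_mul (by norm_num), Real.rpow_def_of_pos (by norm_num),
            hxd]
          congr 1; ring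
      _ ≤ _ := by
          gcongr
          exact_mod_cast two_pow_le_scale hm j
  have hj : (0 : ℝ) ≤ j := Nat.cast_nonneg j
  calc (j : ℝ) + 1 ≤ (1 + 1 / x) * (1 + j * x) := by
        have : (1 + 1 / x) * (1 + j * x) = (j + 1) + (j * x + 1 / x) := by field_simp; ring
        rw [this]
        have : 0 ≤ j * x + 1 / x := by positivity
        linarith
    _ ≤ _ := by gcongr

lemma exists_isGrowth {m : ℕ → ℕ} (hm : IsAdmissible m) {β : ℕ → ℝ} (hβ : ∀ j, 1 ≤ β j) {α : ℝ}
    (hα0 : 0 < α) (hα1 : α < 1)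
    (hα : Tendsto (fun j => Real.log (β j) / Real.log (scale m j)) atTop (𝓝 (1 - α)))
    {ε : ℝ} (hε : 0 < ε) (hε1 : ε ≤ 1) : ∃ C, IsGrowth m β α ε C := by
  have hM := scale_pos_real hm
  have hM1 := one_le_scale_real hm
  have hlog : ∀ᶠ j in atTop, 0 < Real.log (scale m j) := by
    filter_upwards [eventually_ge_atTop 1] with j hj
    refine Real.log_pos ?_
    have h2 := two_pow_le_scale hm j
    have h3 : 2 ^ 1 ≤ 2 ^ j := Nat.pow_le_pow_right (by norm_num) hj
    exact Nat.one_lt_cast.2 (by omega)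
  obtain ⟨C₁, hC₁, h1⟩ : ∃ C : ℝ, 1 ≤ C ∧ ∀ j, β j ≤ C * (scale m j : ℝ) ^ (1 - α + ε) := by
    refine exists_forall_le_of_eventually (fun j => by have := hM j; positivity) ?_
    filter_upwards [hlog, hα.eventually_lt_const (by linarith : 1 - α < 1 - α + ε)] with j hj h
    rw [div_lt_iff₀ hj] at h
    rw [← Real.log_le_log_iff (by linarith [hβ j]) (by have := hM j; positivity),
      Real.log_rpow (hM j)]
    exact h.le
  obtain ⟨C₂, hC₂, h2⟩ : ∃ C : ℝ, 1 ≤ C ∧ ∀ j, (scale m j : ℝ) ^ (1 - α - ε) ≤ C * β j := by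
    refine exists_forall_le_of_eventually (fun j => by linarith [hβ j]) ?_
    filter_upwards [hlog, hα.eventually_const_lt (by linarith : 1 - α - ε < 1 - α)] with j hj h
    rw [lt_div_iff₀ hj] at h
    rw [← Real.log_le_log_iff (by have := hM j; positivity) (by linarith [hβ j]),
      Real.log_rpow (hM j)]
    exact h.le
  obtain ⟨C₃, h3⟩ := hm.growth ε hε
  set C₄ := 1 + 1 / (ε * Real.log 2) with hC₄
  have hl2 : 0 < Real.log 2 := Real.log_pos one_lt_two
  have hC₄' : 1 ≤ C₄ := by
    have : 0 < 1 / (ε * Real.log 2) := by positivity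
    linarith
  set C₅ := max C₃ 1 with hC₅
  have hC₅1 : 1 ≤ C₅ := le_max_right _ _
  have h3' : ∀ j, (m (j + 1) : ℝ) ≤ C₅ * (scale m j : ℝ) ^ ε := fun j =>
    (h3 j).trans (mul_le_mul_of_nonneg_right (le_max_left _ _) (by have := hM j; positivity))
  have h4 : ∀ j, β (j + 1) ≤ C₁ * C₅ ^ (1 - α + ε) * (scale m j : ℝ) ^ (1 - α + 3 * ε) := by
    intro j
    have hMj := hM j
    have e0 : (0 : ℝ) ≤ 1 - α + ε := by linarith
    calc β (j + 1) ≤ C₁ * (scale m (j + 1) : ℝ) ^ (1 - α + ε) := h1 _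
      _ ≤ C₁ * (C₅ * ((scale m j : ℝ) * (scale m j : ℝ) ^ ε)) ^ (1 - α + ε) := by
          gcongr
          rw [scale_succ_real]
          calc (scale m j : ℝ) * m (j + 1) ≤ scale m j * (C₅ * (scale m j : ℝ) ^ ε) := by
                gcongr; exact h3' j
            _ = _ := by ring
      _ = C₁ * C₅ ^ (1 - α + ε) * (scale m j : ℝ) ^ ((1 + ε) * (1 - α + ε)) := by
          rw [Real.mul_rpow (by positivity) (by positivity), Real.rpow_mul hMj.le,
            Real.rpow_add hMj, Real.rpow_one]
          ring
      _ ≤ _ := by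
          gcongr
          · exact hM1 j
          · nlinarith
  refine ⟨C₁ * C₂ * C₄ * C₅ * C₅ ^ (1 - α + ε), ?_⟩
  have hC₆ : 1 ≤ C₅ ^ (1 - α + ε) := Real.one_le_rpow hC₅1 (by linarith)
  set C₆ := C₅ ^ (1 - α + ε)
  have hmul : ∀ {a b : ℝ}, 1 ≤ a → 1 ≤ b → 1 ≤ a * b := fun ha hb =>
    one_le_mul_of_one_le_of_one_le ha hb
  have up : ∀ {a b x : ℝ}, 0 ≤ x → a ≤ b → a * x ≤ b * x := fun hx h =>
    mul_le_mul_of_nonneg_right h hx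
  refine ⟨hmul (hmul (hmul (hmul hC₁ hC₂) hC₄') hC₅1) hC₆, fun j => ?_, fun j => ?_, fun j => ?_,
    fun j => ?_, fun j => ?_⟩
  · refine (h1 j).trans (up (by have := hM j; positivity) ?_)
    rw [show C₁ * C₂ * C₄ * C₅ * C₆ = C₁ * (C₂ * C₄ * C₅ * C₆) by ring]
    exact le_mul_of_one_le_right (by linarith) (hmul (hmul (hmul hC₂ hC₄') hC₅1) hC₆)
  · refine (h2 j).trans (up (by linarith [hβ j]) ?_)
    rw [show C₁ * C₂ * C₄ * C₅ * C₆ = C₂ * (C₁ * C₄ * C₅ * C₆) by ring]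
    exact le_mul_of_one_le_right (by linarith) (hmul (hmul (hmul hC₁ hC₄') hC₅1) hC₆)
  · refine (h3' j).trans (up (by have := hM j; positivity) ?_)
    rw [show C₁ * C₂ * C₄ * C₅ * C₆ = C₅ * (C₁ * C₂ * C₄ * C₆) by ring]
    exact le_mul_of_one_le_right (by linarith) (hmul (hmul (hmul hC₁ hC₂) hC₄') hC₆)
  · refine (h4 j).trans (up (by have := hM j; positivity) ?_)
    rw [show C₁ * C₂ * C₄ * C₅ * C₆ = C₁ * C₆ * (C₂ * C₄ * C₅) by ring]
    exact le_mul_of_one_le_right (by nlinarith) (hmul (hmul hC₂ hC₄') hC₅1)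
  · refine (index_le_rpow hm hε j).trans (up (by have := hM j; positivity) ?_)
    rw [show C₁ * C₂ * C₄ * C₅ * C₆ = C₄ * (C₁ * C₂ * C₅ * C₆) by ring]
    exact le_mul_of_one_le_right (by linarith) (hmul (hmul (hmul hC₁ hC₂) hC₅1) hC₆)

/-- The ratio `β_{r+1}² / (β_r M_r)` controls the variance of the increments from level `r`, relative
to the mass `β_k / M_k` of a cell of an earlier level `k`. -/
lemma IsGrowth.variance_le {m : ℕ → ℕ} (hm : IsAdmissible m) {β : ℕ → ℝ} (hβ : ∀ j, 1 ≤ β j)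
    {α ε C : ℝ} (hα0 : 0 < α) (hε : 0 < ε) (h : IsGrowth m β α ε C) {k r : ℕ} (hkr : k ≤ r) :
    β (r + 1) ^ 2 / (β r * scale m r) ≤
      C ^ 4 * (β k / scale m k) * (scale m r : ℝ) ^ (8 * ε) := by
  have hC : 0 < C := lt_of_lt_of_le one_pos h.one_le
  have hMr := scale_pos_real hm r
  have hMk := scale_pos_real hm k
  have hkM : (scale m k : ℝ) ≤ scale m r := Nat.cast_le.2 (scale_mono hm hkr)
  have b1 := h.beta_succ_le r
  have b2 := h.le_beta r
  have b3 := h.le_beta k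
  have hβr : 0 < β r := by linarith [hβ r]
  have hβk : 0 < β k := by linarith [hβ k]
  have hβr' : 0 < β (r + 1) := by linarith [hβ (r + 1)]
  set M : ℝ := (scale m r : ℝ)
  set N : ℝ := (scale m k : ℝ)
  have e1 : 1 ≤ C * (β k / N) * M ^ (α + ε) := by
    have : N ^ (1 - α - ε) * N ^ (α + ε) = N := by
      rw [← Real.rpow_add hMk]; norm_num
    have h5 : N ≤ C * β k * N ^ (α + ε) := by
      calc N = N ^ (1 - α - ε) * N ^ (α + ε) := this.symm
        _ ≤ _ := by gcongr
    have h6 : N ^ (α + ε) ≤ M ^ (α + ε) := Real.rpow_le_rpow hMk.le hkM (by linarith)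
    calc 1 ≤ C * β k * N ^ (α + ε) / N := by rwa [le_div_iff₀ hMk, one_mul]
      _ = C * (β k / N) * N ^ (α + ε) := by ring
      _ ≤ _ := by gcongr
  rw [div_le_iff₀ (by positivity)]
  have e2 : M ^ (2 * (1 - α + 3 * ε)) = M ^ (7 * ε - α) * M ^ (1 - α - ε) * M := by
    rw [← Real.rpow_add hMr, ← Real.rpow_add_one hMr.ne']
    congr 1; ring
  have e3 : M ^ (α + ε) * M ^ (7 * ε - α) = M ^ (8 * ε) := by
    rw [← Real.rpow_add hMr]; congr 1; ring
  calc β (r + 1) ^ 2 ≤ (C * M ^ (1 - α + 3 * ε)) ^ 2 := by gcongr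
    _ = C ^ 2 * (M ^ (7 * ε - α) * M ^ (1 - α - ε) * M) := by
        rw [← e2, mul_pow, ← Real.rpow_natCast (M ^ _), ← Real.rpow_mul hMr.le]
        congr 2; push_cast; ring
    _ ≤ C ^ 2 * (M ^ (7 * ε - α) * (C * β r) * M) * (C * (β k / N) * M ^ (α + ε)) := by
        refine le_trans ?_ (le_mul_of_one_le_right (by positivity) e1)
        gcongr
    _ = C ^ 4 * (β k / N) * (M ^ (α + ε) * M ^ (7 * ε - α)) * (β r * M) := by ring
    _ = _ := by rw [e3]

/-- The ratio of the masses of a level `k` and a level `i` cell is the number of descendants that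
dimension `α` predicts. -/
lemma IsGrowth.mass_ratio_le {m : ℕ → ℕ} (hm : IsAdmissible m) {β : ℕ → ℝ} (hβ : ∀ j, 1 ≤ β j)
    {α ε C : ℝ} (hε : 0 < ε) (h : IsGrowth m β α ε C) {k i : ℕ} (hki : k ≤ i) :
    (β k / scale m k) / (β i / scale m i) ≤
      C ^ 2 * ((scale m i : ℝ) / scale m k) ^ α * (scale m i : ℝ) ^ (2 * ε) := by
  have hC : 0 < C := lt_of_lt_of_le one_pos h.one_le
  have hM := scale_pos_real hm i
  have hN := scale_pos_real hm k
  have hkM : (scale m k : ℝ) ≤ scale m i := Nat.cast_le.2 (scale_mono hm hki)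
  have b1 := h.beta_le k
  have b2 := h.le_beta i
  have hβi : 0 < β i := by linarith [hβ i]
  have hβk : 0 < β k := by linarith [hβ k]
  set M : ℝ := (scale m i : ℝ)
  set N : ℝ := (scale m k : ℝ)
  have e1 : M ≤ C * β i * M ^ (α + ε) := by
    calc M = M ^ (1 - α - ε) * M ^ (α + ε) := by rw [← Real.rpow_add hM]; norm_num
      _ ≤ _ := by gcongr
  have e2 : β k / N ≤ C * N ^ (-α) * M ^ ε := by
    rw [div_le_iff₀ hN]
    calc β k ≤ C * N ^ (1 - α + ε) := b1
      _ = C * N ^ (-α) * N ^ ε * N := by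
          rw [mul_assoc, mul_assoc, ← Real.rpow_add_one hN.ne', ← Real.rpow_add hN]
          congr 2; ring
      _ ≤ _ := by gcongr
  have e3 : M / β i ≤ C * M ^ (α + ε) := by
    rw [div_le_iff₀ hβi]; linarith [e1]
  calc (β k / N) / (β i / M) = (β k / N) * (M / β i) := by rw [div_div_eq_mul_div, mul_div_assoc]
    _ ≤ (C * N ^ (-α) * M ^ ε) * (C * M ^ (α + ε)) := by gcongr
    _ = _ := by
        rw [Real.div_rpow hM.le hN.le, Real.rpow_neg hN.le, Real.rpow_add hM,
          two_mul, Real.rpow_add hM]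
        field_simp

/-! ### Moments of the number of descendants of a cell -/

/-- The number of level `i` cells of `E_i` that lie in the `a`-th cell of level `k`. -/
def descCount {Ω : Type*} (m : ℕ → ℕ) (E : ℕ → Ω → Set ℝ) (k i a : ℕ) (ω : Ω) : ℕ :=
  ((activeCells m i (E i ω)).filter fun l => ancestor m k i l = a).card

/-- The `μ_i`-mass of the `a`-th cell of level `k`, for `k ≤ i`. -/
def cellMass {Ω : Type*} (m : ℕ → ℕ) (β : ℕ → ℝ) (E : ℕ → Ω → Set ℝ) (k i a : ℕ) (ω : Ω) : ℝ :=
  β i / scale m i * descCount m E k i a ω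

/-- The coefficients for which `increment` is the increment of `cellMass`. -/
def massCoeff (m : ℕ → ℕ) (k i a l : ℕ) : ℝ :=
  if ancestor m k (i + 1) l = a then 1 / scale m (i + 1) else 0

lemma descCount_eq_sum {Ω : Type*} (m : ℕ → ℕ) (E : ℕ → Ω → Set ℝ) (k i a : ℕ) (ω : Ω) :
    (descCount m E k i a ω : ℝ) = ∑ l ∈ Finset.range (scale m i),
      activity m E i l ω * (if ancestor m k i l = a then 1 else 0) := by
  classical
  have hsub : (activeCells m i (E i ω)).filter (fun l => ancestor m k i l = a) ⊆
      Finset.range (scale m i) := fun l hl =>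
    Finset.mem_range.2 (mem_activeCells.1 (Finset.mem_filter.1 hl).1).1
  rw [descCount, Finset.card_eq_sum_ones, Nat.cast_sum, ← Finset.sum_subset hsub]
  · refine Finset.sum_congr rfl fun l hl => ?_
    obtain ⟨h1, h2⟩ := Finset.mem_filter.1 hl
    simp [activity, h1, h2]
  · intro l _ hl
    rw [Finset.mem_filter, not_and] at hl
    unfold activity
    by_cases h : l ∈ activeCells m i (E i ω)
    · simp [hl h]
    · simp [h]

lemma sum_children_massCoeff {m : ℕ → ℕ} (hm : IsAdmissible m) {k i : ℕ} (hki : k ≤ i) (a k' : ℕ) :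
    ∑ l ∈ children m i k', massCoeff m k i a l =
      if ancestor m k i k' = a then 1 / (scale m i : ℝ) else 0 := by
  have : ∀ l ∈ children m i k', massCoeff m k i a l =
      if ancestor m k i k' = a then 1 / (scale m (i + 1) : ℝ) else 0 := by
    intro l hl
    rw [massCoeff, ancestor_succ hki, div_of_mem_children hl]
  rw [Finset.sum_congr rfl this, Finset.sum_const, card_children, nsmul_eq_mul, scale_succ_real]
  have h1 := scale_pos_real hm i
  have h2 := m_pos_real hm i
  split_ifs
  · field_simp
  · simp

lemma cellMass_succ_sub {Ω : Type*} {m : ℕ → ℕ} (hm : IsAdmissible m) (β : ℕ → ℝ)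
    (E : ℕ → Ω → Set ℝ) {k i : ℕ} (hki : k ≤ i) (a : ℕ) (ω : Ω) :
    ((cellMass m β E k (i + 1) a ω - cellMass m β E k i a ω : ℝ) : ℂ) =
      increment m β E i (fun l => (massCoeff m k i a l : ℂ)) ω := by
  have key : cellMass m β E k (i + 1) a ω - cellMass m β E k i a ω =
      ∑ l ∈ Finset.range (scale m (i + 1)), (β (i + 1) * activity m E (i + 1) l ω -
        β i * activity m E i (l / m (i + 1)) ω) * massCoeff m k i a l := by
    unfold cellMass
    simp only [sub_mul, Finset.sum_sub_distrib]
    congr 1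
    · rw [descCount_eq_sum, Finset.mul_sum]
      refine Finset.sum_congr rfl fun l _ => ?_
      rw [massCoeff]
      split_ifs
      · ring
      · simp
    · rw [descCount_eq_sum, Finset.mul_sum, sum_range_scale_succ]
      refine Finset.sum_congr rfl fun k' _ => ?_
      have : ∀ l ∈ children m i k', β i * activity m E i (l / m (i + 1)) ω * massCoeff m k i a l =
          β i * activity m E i k' ω * massCoeff m k i a l := fun l hl => by
        rw [div_of_mem_children hl]
      rw [Finset.sum_congr rfl this, ← Finset.mul_sum, sum_children_massCoeff hm hki]
      split_ifs
      · ring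
      · simp
  rw [key, increment]
  push_cast
  rfl

lemma massCoeff_nonneg (m : ℕ → ℕ) (k i a l : ℕ) : 0 ≤ massCoeff m k i a l := by
  unfold massCoeff; split_ifs <;> positivity

lemma squareSum_massCoeff {m : ℕ → ℕ} (hm : IsAdmissible m) (β : ℕ → ℝ) {k i : ℕ} (hki : k ≤ i)
    (a : ℕ) (T : Finset ℕ) :
    squareSum m β i (fun l => (massCoeff m k i a l : ℂ)) T =
      β (i + 1) ^ 2 / (scale m i : ℝ) ^ 2 * ((T.filter fun l => ancestor m k i l = a).card : ℝ) := by
  unfold squareSum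
  have : ∀ k' ∈ T, (∑ l ∈ children m i k', ‖(massCoeff m k i a l : ℂ)‖) ^ 2 =
      (1 / (scale m i : ℝ) ^ 2) * if ancestor m k i k' = a then 1 else 0 := by
    intro k' _
    have h1 : ∀ l ∈ children m i k', ‖(massCoeff m k i a l : ℂ)‖ = massCoeff m k i a l := fun l _ => by
      rw [Complex.norm_real, Real.norm_of_nonneg (massCoeff_nonneg _ _ _ _ _)]
    rw [Finset.sum_congr rfl h1, sum_children_massCoeff hm hki]
    split_ifs
    · simp
    · simp
  rw [Finset.sum_congr rfl this, ← Finset.mul_sum, Finset.sum_boole]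
  ring

lemma descCount_self_le {Ω : Type*} {m : ℕ → ℕ} (hm : IsAdmissible m) (E : ℕ → Ω → Set ℝ)
    (k a : ℕ) (ω : Ω) : descCount m E k k a ω ≤ 1 := by
  unfold descCount
  refine Finset.card_le_one.2 fun l hl l' hl' => ?_
  have h1 := (Finset.mem_filter.1 hl).2
  have h2 := (Finset.mem_filter.1 hl').2
  rw [ancestor_self hm] at h1 h2
  rw [h1, h2]

section
variable {Ω : Type*} [MeasurableSpace Ω] {P : Measure Ω} {m : ℕ → ℕ} {β : ℕ → ℝ}
  {E : ℕ → Ω → Set ℝ}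

lemma IsRandomCantor.measurable_descCount (hE : IsRandomCantor P m β E) (k i a : ℕ) :
    Measurable fun ω => (descCount m E k i a ω : ℝ) := by
  simp only [descCount_eq_sum]
  exact Finset.measurable_sum _ fun l _ => (hE.measurable_activity i l).mul_const _

lemma IsRandomCantor.measurable_cellMass (hE : IsRandomCantor P m β E) (k i a : ℕ) :
    Measurable (cellMass m β E k i a) := (hE.measurable_descCount k i a).const_mul _

lemma IsRandomCantor.cellMass_nonneg (hE : IsRandomCantor P m β E) (k i a : ℕ) (ω : Ω) :
    0 ≤ cellMass m β E k i a ω := by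
  have := hE.one_le_beta i
  unfold cellMass; positivity

/-- Completing the square: `A + x √A ≤ (√A + x) ^ 2`. -/
lemma sq_le_of_le_add_mul {A A' x : ℝ≥0∞} (h : A' ≤ A + x * A ^ (1 / 2 : ℝ)) :
    A' ^ (1 / 2 : ℝ) ≤ A ^ (1 / 2 : ℝ) + x := by
  set B := A ^ (1 / 2 : ℝ) with hB
  have hA : A = B ^ 2 := by
    rw [hB, ← ENNReal.rpow_natCast, ← ENNReal.rpow_mul]; norm_num
  have h2 : A' ≤ (B + x) ^ 2 := by
    refine h.trans ?_
    rw [hA, add_sq]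
    calc B ^ 2 + x * B ≤ B ^ 2 + 2 * B * x := by
          refine add_le_add le_rfl ?_
          rw [mul_assoc, two_mul, mul_comm]
          exact le_self_add
      _ ≤ _ := le_self_add
  calc A' ^ (1 / 2 : ℝ) ≤ ((B + x) ^ 2) ^ (1 / 2 : ℝ) := ENNReal.rpow_le_rpow h2 (by norm_num)
    _ = B + x := by rw [← ENNReal.rpow_natCast, ← ENNReal.rpow_mul]; norm_num

lemma IsRandomCantor.lintegral_sub_cellMass_le (hE : IsRandomCantor P m β E) (hm : IsAdmissible m)
    {q C : ℝ}
    (hC : ∀ (j : ℕ) (c : ℕ → ℂ), ∫⁻ ω, ‖increment m β E j c ω‖ₑ ^ q ∂P ≤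
      ENNReal.ofReal C *
        ∫⁻ ω, ENNReal.ofReal (squareSum m β j c (activeCells m j (E j ω))) ^ (q / 2) ∂P)
    {k i : ℕ} (hki : k ≤ i) (a : ℕ) :
    ∫⁻ ω, ‖cellMass m β E k (i + 1) a ω - cellMass m β E k i a ω‖ₑ ^ q ∂P ≤
      ENNReal.ofReal C * ∫⁻ ω, ENNReal.ofReal (β (i + 1) ^ 2 / (β i * scale m i) *
        cellMass m β E k i a ω) ^ (q / 2) ∂P := by
  have h := hC i fun l => (massCoeff m k i a l : ℂ)
  have e1 : ∀ ω, ‖increment m β E i (fun l => (massCoeff m k i a l : ℂ)) ω‖ₑ =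
      ‖cellMass m β E k (i + 1) a ω - cellMass m β E k i a ω‖ₑ := fun ω => by
    rw [← cellMass_succ_sub hm β E hki a ω, ← ofReal_norm, ← ofReal_norm, Complex.norm_real]
  simp only [e1] at h
  refine h.trans (le_of_eq ?_)
  congr 2
  funext ω
  rw [squareSum_massCoeff hm β hki, cellMass, descCount]
  have h1 : β i ≠ 0 := by linarith [hE.one_le_beta i]
  have h2 := (scale_pos_real hm i).ne'
  congr 2
  field_simp

/-- Minkowski's inequality and the moment bound for increments turn into a linear recursion for
the square root of the `L^q` norm of the mass of a cell. -/
lemma IsRandomCantor.norm_cellMass_succ_le (hE : IsRandomCantor P m β E) [IsProbabilityMeasure P]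
    (hm : IsAdmissible m) {q C : ℝ} (hq : 1 ≤ q) (hC0 : 0 ≤ C)
    (hC : ∀ (j : ℕ) (c : ℕ → ℂ), ∫⁻ ω, ‖increment m β E j c ω‖ₑ ^ q ∂P ≤
      ENNReal.ofReal C *
        ∫⁻ ω, ENNReal.ofReal (squareSum m β j c (activeCells m j (E j ω))) ^ (q / 2) ∂P)
    {k i : ℕ} (hki : k ≤ i) (a : ℕ) :
    ((∫⁻ ω, ENNReal.ofReal (cellMass m β E k (i + 1) a ω) ^ q ∂P) ^ (1 / q)) ^ (1 / 2 : ℝ) ≤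
      ((∫⁻ ω, ENNReal.ofReal (cellMass m β E k i a ω) ^ q ∂P) ^ (1 / q)) ^ (1 / 2 : ℝ) +
        ENNReal.ofReal (C ^ (1 / q) * Real.sqrt (β (i + 1) ^ 2 / (β i * scale m i))) := by
  have hq0 : 0 < q := by linarith
  refine sq_le_of_le_add_mul ?_
  have hmeas := fun i => hE.measurable_cellMass k i a
  set v : ℝ := β (i + 1) ^ 2 / (β i * scale m i) with hv
  have hv0 : 0 ≤ v := by
    have := hE.one_le_beta i
    have := scale_pos_real hm i
    positivity
  set Y : Ω → ℝ≥0∞ := fun ω => ENNReal.ofReal (cellMass m β E k i a ω) with hY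
  have hYm : Measurable Y := (hmeas i).ennreal_ofReal
  set g : Ω → ℝ≥0∞ := fun ω => ‖cellMass m β E k (i + 1) a ω - cellMass m β E k i a ω‖ₑ with hg
  have hgm : Measurable g := ((hmeas (i + 1)).sub (hmeas i)).enorm
  have hpt : ∀ ω, ENNReal.ofReal (cellMass m β E k (i + 1) a ω) ≤ (Y + g) ω := by
    intro ω
    simp only [Pi.add_apply, hY, hg]
    rw [← ofReal_norm, ← ENNReal.ofReal_add (hE.cellMass_nonneg _ _ _ _) (norm_nonneg _)]
    refine ENNReal.ofReal_le_ofReal ?_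
    have := Real.le_norm_self (cellMass m β E k (i + 1) a ω - cellMass m β E k i a ω)
    linarith
  calc (∫⁻ ω, ENNReal.ofReal (cellMass m β E k (i + 1) a ω) ^ q ∂P) ^ (1 / q)
      ≤ (∫⁻ ω, (Y + g) ω ^ q ∂P) ^ (1 / q) := by
        gcongr with ω
        exact hpt ω
    _ ≤ (∫⁻ ω, Y ω ^ q ∂P) ^ (1 / q) + (∫⁻ ω, g ω ^ q ∂P) ^ (1 / q) :=
        ENNReal.lintegral_Lp_add_le hYm.aemeasurable hgm.aemeasurable hq
    _ ≤ _ := by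
        gcongr
        have h1 := hE.lintegral_sub_cellMass_le hm hC hki a
        rw [← hv] at h1
        -- Jensen: `∫ Y^(q/2) ≤ (∫ Y^q)^(1/2)`
        have h2 : ∫⁻ ω, Y ω ^ (q / 2) ∂P ≤ (∫⁻ ω, Y ω ^ q ∂P) ^ (1 / 2 : ℝ) := by
          have := ENNReal.lintegral_mul_le_Lp_mul_Lq P Real.HolderConjugate.two_two
            (f := fun ω => Y ω ^ (q / 2)) (g := fun _ => 1) (hYm.pow_const _).aemeasurable
            aemeasurable_const
          simp only [Pi.mul_apply, mul_one, ENNReal.one_rpow, lintegral_one, measure_univ] at this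
          refine this.trans (le_of_eq ?_)
          congr 2
          funext ω
          rw [← ENNReal.rpow_mul]; congr 1; ring
        calc (∫⁻ ω, g ω ^ q ∂P) ^ (1 / q)
            ≤ (ENNReal.ofReal C * (ENNReal.ofReal v ^ (q / 2) *
                (∫⁻ ω, Y ω ^ q ∂P) ^ (1 / 2 : ℝ))) ^ (1 / q) := by
              refine ENNReal.rpow_le_rpow (h1.trans ?_) (by positivity)
              gcongr
              have : ∀ ω, ENNReal.ofReal (v * cellMass m β E k i a ω) ^ (q / 2) =
                  ENNReal.ofReal v ^ (q / 2) * Y ω ^ (q / 2) := fun ω => by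
                rw [ENNReal.ofReal_mul hv0, ENNReal.mul_rpow_of_nonneg _ _ (by positivity)]
              simp only [this]
              rw [lintegral_const_mul _ (hYm.pow_const _)]
              gcongr
          _ = _ := by
              rw [ENNReal.mul_rpow_of_nonneg _ _ (by positivity),
                ENNReal.mul_rpow_of_nonneg _ _ (by positivity), ← ENNReal.rpow_mul,
                ← ENNReal.rpow_mul, ← ENNReal.rpow_mul, ENNReal.ofReal_mul (by positivity),
                ← ENNReal.ofReal_rpow_of_nonneg hC0 (by positivity), Real.sqrt_eq_rpow,
                ← ENNReal.ofReal_rpow_of_nonneg hv0 (by positivity), mul_assoc]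
              congr 3
              · field_simp
              · ring

/-- All moments of the number of descendants of a cell are what dimension `α` predicts, up to a
factor `M_i^{O(ε)}`. -/
lemma IsRandomCantor.lintegral_descCount_le (hE : IsRandomCantor P m β E) [IsProbabilityMeasure P]
    (hm : IsAdmissible m) {α ε G q : ℝ} (hα0 : 0 < α) (hε : 0 < ε) (hG : IsGrowth m β α ε G)
    (hq : 1 ≤ q) :
    ∃ C : ℝ, 0 ≤ C ∧ ∀ k i a, k ≤ i → ∫⁻ ω, ENNReal.ofReal (descCount m E k i a ω) ^ q ∂P ≤
      ENNReal.ofReal ((C * ((scale m i : ℝ) / scale m k) ^ α * (scale m i : ℝ) ^ (12 * ε)) ^ q) := by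
  have hq0 : 0 < q := by linarith
  obtain ⟨C₀, hC₀, hmom⟩ := hE.lintegral_increment_le hm hq0
  have hG0 : 0 < G := lt_of_lt_of_le one_pos hG.one_le
  set D : ℝ := C₀ ^ (1 / q) * G ^ 2 with hD
  have hD0 : 0 ≤ D := by positivity
  refine ⟨((1 + D) * G) ^ 2 * G ^ 2, by positivity, fun k i a hki => ?_⟩
  set A : ℕ → ℝ≥0∞ := fun i =>
    (∫⁻ ω, ENNReal.ofReal (cellMass m β E k i a ω) ^ q ∂P) ^ (1 / q) with hA
  have hMk := scale_pos_real hm k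
  have hMi := scale_pos_real hm i
  have hβk := hE.one_le_beta k
  have hβi := hE.one_le_beta i
  set b : ℝ := β k / scale m k with hb
  have hb0 : 0 < b := by positivity
  have hbase : A k ^ (1 / 2 : ℝ) ≤ ENNReal.ofReal (Real.sqrt b) := by
    rw [Real.sqrt_eq_rpow, ← ENNReal.ofReal_rpow_of_nonneg hb0.le (by norm_num)]
    refine ENNReal.rpow_le_rpow ?_ (by norm_num)
    calc A k ≤ (∫⁻ _, ENNReal.ofReal b ^ q ∂P) ^ (1 / q) := by
          rw [hA]; dsimp only
          gcongr with ω
          rw [cellMass]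
          refine mul_le_of_le_one_right hb0.le ?_
          exact_mod_cast descCount_self_le hm E k a ω
      _ = ENNReal.ofReal b := by
          rw [lintegral_const, measure_univ, mul_one, ← ENNReal.rpow_mul,
            mul_one_div_cancel hq0.ne', ENNReal.rpow_one]
  have hstep : ∀ r, k ≤ r → A (r + 1) ^ (1 / 2 : ℝ) ≤ A r ^ (1 / 2 : ℝ) +
      ENNReal.ofReal (Real.sqrt b * (D * (scale m r : ℝ) ^ (4 * ε))) := by
    intro r hr
    refine (hE.norm_cellMass_succ_le hm hq hC₀ hmom hr a).trans
      (add_le_add le_rfl (ENNReal.ofReal_le_ofReal ?_))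
    have hv := hG.variance_le hm hE.one_le_beta hα0 hε hr
    have hMr := scale_pos_real hm r
    have : Real.sqrt (β (r + 1) ^ 2 / (β r * scale m r)) ≤
        Real.sqrt b * (G ^ 2 * (scale m r : ℝ) ^ (4 * ε)) := by
      rw [Real.sqrt_le_left (by positivity), mul_pow, Real.sq_sqrt hb0.le, mul_pow,
        ← Real.rpow_natCast ((scale m r : ℝ) ^ (4 * ε)), ← Real.rpow_mul hMr.le]
      refine hv.trans (le_of_eq ?_)
      rw [show 4 * ε * ((2 : ℕ) : ℝ) = 8 * ε by push_cast; ring]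
      ring
    calc _ ≤ C₀ ^ (1 / q) * (Real.sqrt b * (G ^ 2 * (scale m r : ℝ) ^ (4 * ε))) := by gcongr
      _ = _ := by rw [hD]; ring
  have hind : ∀ r, k ≤ r → r ≤ i → A r ^ (1 / 2 : ℝ) ≤
      ENNReal.ofReal (Real.sqrt b * (1 + r * (D * (scale m i : ℝ) ^ (4 * ε)))) := by
    intro r hr
    induction r, hr using Nat.le_induction with
    | base =>
      intro _
      refine hbase.trans (ENNReal.ofReal_le_ofReal ?_)
      refine le_mul_of_one_le_right (by positivity) ?_
      have : 0 ≤ (k : ℝ) * (D * (scale m i : ℝ) ^ (4 * ε)) := by positivity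
      linarith
    | succ r hr ih =>
      intro hri
      refine (hstep r hr).trans ((add_le_add (ih (by omega)) le_rfl).trans ?_)
      rw [← ENNReal.ofReal_add (by positivity) (by
        have := scale_pos_real hm r; positivity)]
      refine ENNReal.ofReal_le_ofReal ?_
      have hMr := scale_pos_real hm r
      have : (scale m r : ℝ) ^ (4 * ε) ≤ (scale m i : ℝ) ^ (4 * ε) := by
        gcongr
        exact Nat.cast_le.2 (scale_mono hm (by omega))
      calc _ ≤ Real.sqrt b * (1 + r * (D * (scale m i : ℝ) ^ (4 * ε))) +
            Real.sqrt b * (D * (scale m i : ℝ) ^ (4 * ε)) := by gcongr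
        _ = _ := by push_cast; ring
  have hM1 := one_le_scale_real hm i
  have hM4 : 1 ≤ (scale m i : ℝ) ^ (4 * ε) := Real.one_le_rpow hM1 (by positivity)
  have hfin : A i ^ (1 / 2 : ℝ) ≤
      ENNReal.ofReal (Real.sqrt b * ((1 + D) * G * (scale m i : ℝ) ^ (5 * ε))) := by
    refine (hind i hki le_rfl).trans (ENNReal.ofReal_le_ofReal ?_)
    gcongr
    have hidx := hG.index_le i
    calc 1 + i * (D * (scale m i : ℝ) ^ (4 * ε))
        ≤ (1 + D) * ((i : ℝ) + 1) * (scale m i : ℝ) ^ (4 * ε) := by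
          have hi0 : (0 : ℝ) ≤ i := Nat.cast_nonneg i
          have : (1 + D) * ((i : ℝ) + 1) * (scale m i : ℝ) ^ (4 * ε) =
            (scale m i : ℝ) ^ (4 * ε) + i * (D * (scale m i : ℝ) ^ (4 * ε)) +
              (i * (scale m i : ℝ) ^ (4 * ε) + D * (scale m i : ℝ) ^ (4 * ε)) := by ring
          rw [this]
          have : 0 ≤ (i * (scale m i : ℝ) ^ (4 * ε) + D * (scale m i : ℝ) ^ (4 * ε)) := by positivity
          linarith
      _ ≤ (1 + D) * (G * (scale m i : ℝ) ^ ε) * (scale m i : ℝ) ^ (4 * ε) := by gcongr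
      _ = _ := by
          rw [show 5 * ε = ε + 4 * ε by ring, Real.rpow_add hMi]; ring
  have hAi : A i ≤ ENNReal.ofReal (b * ((1 + D) * G) ^ 2 * (scale m i : ℝ) ^ (10 * ε)) := by
    have h1 : A i = (A i ^ (1 / 2 : ℝ)) ^ (2 : ℝ) := by rw [← ENNReal.rpow_mul]; norm_num
    rw [h1]
    refine (ENNReal.rpow_le_rpow hfin (by norm_num)).trans (le_of_eq ?_)
    rw [ENNReal.ofReal_rpow_of_nonneg (by positivity) (by norm_num), Real.rpow_two, mul_pow,
      Real.sq_sqrt hb0.le, mul_pow, ← Real.rpow_natCast ((scale m i : ℝ) ^ (5 * ε)),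
      ← Real.rpow_mul hMi.le]
    rw [show 5 * ε * ((2 : ℕ) : ℝ) = 10 * ε by push_cast; ring]
    congr 1; ring
  set bi : ℝ := β i / scale m i with hbi
  have hbi0 : 0 < bi := by positivity
  have hN : ∀ ω, ENNReal.ofReal (descCount m E k i a ω) ^ q =
      ENNReal.ofReal bi⁻¹ ^ q * ENNReal.ofReal (cellMass m β E k i a ω) ^ q := by
    intro ω
    rw [← ENNReal.mul_rpow_of_nonneg _ _ hq0.le, ← ENNReal.ofReal_mul (by positivity), cellMass,
      inv_mul_cancel_left₀ hbi0.ne']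
  simp only [hN]
  rw [lintegral_const_mul' _ _ (ENNReal.rpow_ne_top_of_nonneg hq0.le ENNReal.ofReal_ne_top)]
  have h3 : ∫⁻ ω, ENNReal.ofReal (cellMass m β E k i a ω) ^ q ∂P = A i ^ q := by
    rw [hA]; dsimp only
    rw [← ENNReal.rpow_mul, one_div_mul_cancel hq0.ne', ENNReal.rpow_one]
  rw [h3, ← ENNReal.mul_rpow_of_nonneg _ _ hq0.le,
    ← ENNReal.ofReal_rpow_of_nonneg (by positivity) hq0.le]
  refine ENNReal.rpow_le_rpow ?_ hq0.le
  refine (mul_le_mul' le_rfl hAi).trans ?_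
  rw [← ENNReal.ofReal_mul (by positivity)]
  refine ENNReal.ofReal_le_ofReal ?_
  have hr := hG.mass_ratio_le hm hE.one_le_beta hε hki
  calc bi⁻¹ * (b * ((1 + D) * G) ^ 2 * (scale m i : ℝ) ^ (10 * ε))
      = b / bi * (((1 + D) * G) ^ 2 * (scale m i : ℝ) ^ (10 * ε)) := by ring
    _ ≤ (G ^ 2 * ((scale m i : ℝ) / scale m k) ^ α * (scale m i : ℝ) ^ (2 * ε)) *
        (((1 + D) * G) ^ 2 * (scale m i : ℝ) ^ (10 * ε)) := by gcongr
    _ = _ := by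
        rw [show 12 * ε = 2 * ε + 10 * ε by ring, Real.rpow_add hMi]; ring

end

section
variable {Ω : Type*} [MeasurableSpace Ω] {P : Measure Ω} {m : ℕ → ℕ} {β : ℕ → ℝ}
  {E : ℕ → Ω → Set ℝ}

/-! ### The regularity constant of the random tree -/

/-- The normalized number of descendants; it is bounded for a set of dimension `α`. -/
def descRatio {Ω : Type*} (m : ℕ → ℕ) (E : ℕ → Ω → Set ℝ) (α : ℝ) (k i a : ℕ) (ω : Ω) : ℝ :=
  descCount m E k i a ω / ((scale m i : ℝ) / scale m k) ^ α

/-- The `Q`-th power of an `ℓ^Q` norm that dominates all the normalized numbers of descendants. -/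
def regPower {Ω : Type*} (m : ℕ → ℕ) (E : ℕ → Ω → Set ℝ) (α Q : ℝ) (j : ℕ) (ω : Ω) : ℝ :=
  1 + (∑ i ∈ Finset.range (j + 1), ∑ a ∈ Finset.range (scale m i), descRatio m E α i j a ω ^ Q +
    ∑ i ∈ Finset.range (j + 1), descRatio m E α 0 i 0 ω ^ Q)

lemma descRatio_nonneg {Ω : Type*} (m : ℕ → ℕ) (E : ℕ → Ω → Set ℝ) (α : ℝ) (k i a : ℕ) (ω : Ω) :
    0 ≤ descRatio m E α k i a ω := by unfold descRatio; positivity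

lemma ancestor_lt {i j l : ℕ} (hij : i ≤ j) (hl : l < scale m j) :
    ancestor m i j l < scale m i := by
  unfold ancestor
  refine Nat.div_lt_of_lt_mul ?_
  rwa [Nat.div_mul_cancel (scale_dvd m hij)]

/-- The `ℓ^Q` norm dominates each of the finitely many normalized numbers of descendants. -/
lemma isRegularTree_regPower {Ω : Type*} (hm : IsAdmissible m) {E : ℕ → Ω → Set ℝ} {α Q : ℝ}
    (hQ : 0 < Q) (j : ℕ) {ω : Ω}
    (hω : ∀ j, ∀ l ∈ activeCells m (j + 1) (E (j + 1) ω),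
      l / m (j + 1) ∈ activeCells m j (E j ω)) :
    1 ≤ regPower m E α Q j ω ^ (1 / Q) ∧
      IsRegularTree m α (fun i => activeCells m i (E i ω)) j (regPower m E α Q j ω ^ (1 / Q)) := by
  have hX := descRatio_nonneg m E α
  have hXQ : ∀ k i a, 0 ≤ descRatio m E α k i a ω ^ Q := fun k i a =>
    Real.rpow_nonneg (hX k i a ω) Q
  have h1 : 0 ≤ ∑ i ∈ Finset.range (j + 1), ∑ a ∈ Finset.range (scale m i),
      descRatio m E α i j a ω ^ Q :=
    Finset.sum_nonneg fun i _ => Finset.sum_nonneg fun a _ => hXQ _ _ _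
  have h2 : 0 ≤ ∑ i ∈ Finset.range (j + 1), descRatio m E α 0 i 0 ω ^ Q :=
    Finset.sum_nonneg fun i _ => hXQ _ _ _
  have hT : 1 ≤ regPower m E α Q j ω := by unfold regPower; linarith
  have hle : ∀ k i a, descRatio m E α k i a ω ^ Q ≤ regPower m E α Q j ω →
      (descCount m E k i a ω : ℝ) ≤
        regPower m E α Q j ω ^ (1 / Q) * ((scale m i : ℝ) / scale m k) ^ α := by
    intro k i a h
    have h3 : descRatio m E α k i a ω ≤ regPower m E α Q j ω ^ (1 / Q) := by
      calc descRatio m E α k i a ω = (descRatio m E α k i a ω ^ Q) ^ (1 / Q) := by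
            rw [← Real.rpow_mul (hX _ _ _ _), mul_one_div_cancel hQ.ne', Real.rpow_one]
        _ ≤ _ := Real.rpow_le_rpow (hXQ _ _ _) h (by positivity)
    have hMi := scale_pos_real hm i
    have hMk := scale_pos_real hm k
    rwa [descRatio, div_le_iff₀ (by positivity)] at h3
  refine ⟨Real.one_le_rpow hT (by positivity), ?_, ?_, ?_, ?_⟩
  · exact fun l hl => (mem_activeCells.1 hl).1
  · exact fun i _ l hl => hω i l hl
  · intro i hij a
    by_cases ha : a < scale m i
    · refine hle i j a ?_
      have h4 := Finset.single_le_sum (f := fun i => ∑ a ∈ Finset.range (scale m i),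
        descRatio m E α i j a ω ^ Q) (fun i _ => Finset.sum_nonneg fun a _ => hXQ _ _ _)
        (Finset.mem_range.2 (Nat.lt_succ_iff.2 hij))
      have h5 := Finset.single_le_sum (f := fun a => descRatio m E α i j a ω ^ Q)
        (fun a _ => hXQ _ _ _) (Finset.mem_range.2 ha)
      unfold regPower
      linarith
    · have : (activeCells m j (E j ω)).filter (fun l => ancestor m i j l = a) = ∅ := by
        refine Finset.filter_eq_empty_iff.2 fun l hl h => ha ?_
        rw [← h]
        exact ancestor_lt hij (mem_activeCells.1 hl).1
      rw [this]
      simp only [Finset.card_empty, Nat.cast_zero]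
      have hMi := scale_pos_real hm i
      have hMj := scale_pos_real hm j
      positivity
  · intro i hij
    have h3 := hle 0 i 0 (by
      have h5 := Finset.single_le_sum (f := fun i => descRatio m E α 0 i 0 ω ^ Q)
        (fun a _ => hXQ _ _ _) (Finset.mem_range.2 (Nat.lt_succ_iff.2 hij))
      unfold regPower
      linarith)
    have h4 : descCount m E 0 i 0 ω = (activeCells m i (E i ω)).card := by
      unfold descCount
      congr 1
      exact Finset.filter_true_of_mem fun l hl => ancestor_zero (mem_activeCells.1 hl).1
    rw [h4, scale_zero, Nat.cast_one, div_one] at h3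
    exact h3

lemma IsRandomCantor.measurable_regPower (hE : IsRandomCantor P m β E) (α Q : ℝ) (j : ℕ) :
    Measurable (regPower m E α Q j) := by
  have : ∀ k i a, Measurable fun ω => descRatio m E α k i a ω ^ Q := fun k i a =>
    ((hE.measurable_descCount k i a).div_const _).pow_const _
  exact measurable_const.add ((Finset.measurable_sum _ fun i _ =>
    Finset.measurable_sum _ fun a _ => this _ _ _).add (Finset.measurable_sum _ fun i _ => this _ _ _))

/-- There are at most `2 (j + 1) M_j` summands in `regPower`, each with expectation `M_j^{O(εQ)}`. -/
lemma IsRandomCantor.lintegral_regPower_le (hE : IsRandomCantor P m β E) [IsProbabilityMeasure P]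
    (hm : IsAdmissible m) {α ε G Q : ℝ} (hα0 : 0 < α) (hε : 0 < ε) (hG : IsGrowth m β α ε G)
    (hQ : 1 ≤ Q) :
    ∃ C : ℝ, 0 ≤ C ∧ ∀ j, ∫⁻ ω, ENNReal.ofReal (regPower m E α Q j ω) ∂P ≤
      ENNReal.ofReal (C * ((j : ℝ) + 1) * (scale m j : ℝ) ^ (1 + 12 * ε * Q)) := by
  obtain ⟨C, hC, H⟩ := hE.lintegral_descCount_le hm hα0 hε hG hQ
  refine ⟨1 + 2 * C ^ Q, by positivity, fun j => ?_⟩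
  have hM := scale_pos_real hm j
  have hM1 := one_le_scale_real hm j
  have hQ0 : 0 ≤ Q := by linarith
  have hX := descRatio_nonneg m E α
  have hXQ : ∀ k i a ω, 0 ≤ descRatio m E α k i a ω ^ Q := fun k i a ω =>
    Real.rpow_nonneg (hX k i a ω) Q
  set B : ℝ := C ^ Q * (scale m j : ℝ) ^ (12 * ε * Q) with hB
  have hB0 : 0 ≤ B := by positivity
  have hterm : ∀ k i a, k ≤ i → i ≤ j →
      ∫⁻ ω, ENNReal.ofReal (descRatio m E α k i a ω ^ Q) ∂P ≤ ENNReal.ofReal B := by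
    intro k i a hki hij
    have hMi := scale_pos_real hm i
    have hMk := scale_pos_real hm k
    set ρ : ℝ := ((scale m i : ℝ) / scale m k) ^ α with hρ
    have hρ0 : 0 < ρ := by positivity
    have e1 : ∀ ω, ENNReal.ofReal (descRatio m E α k i a ω ^ Q) =
        ENNReal.ofReal ((1 / ρ) ^ Q) * ENNReal.ofReal (descCount m E k i a ω) ^ Q := by
      intro ω
      rw [ENNReal.ofReal_rpow_of_nonneg (Nat.cast_nonneg _) hQ0, ← ENNReal.ofReal_mul (by positivity),
        ← Real.mul_rpow (by positivity) (Nat.cast_nonneg _), descRatio]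
      congr 2; ring
    simp only [e1]
    rw [lintegral_const_mul' _ _ ENNReal.ofReal_ne_top]
    refine (mul_le_mul' le_rfl (H k i a hki)).trans ?_
    rw [← ENNReal.ofReal_mul (by positivity), ← Real.mul_rpow (by positivity) (by positivity)]
    refine ENNReal.ofReal_le_ofReal ?_
    rw [hB, Real.rpow_mul hM.le, ← Real.mul_rpow hC (by positivity)]
    refine Real.rpow_le_rpow (by positivity) ?_ hQ0
    calc 1 / ρ * (C * ρ * (scale m i : ℝ) ^ (12 * ε)) = C * (scale m i : ℝ) ^ (12 * ε) := by
          field_simp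
      _ ≤ _ := by
          gcongr
          exact Nat.cast_le.2 (scale_mono hm hij)
  have hmeas : ∀ k i a, Measurable fun ω => ENNReal.ofReal (descRatio m E α k i a ω ^ Q) :=
    fun k i a => (((hE.measurable_descCount k i a).div_const _).pow_const _).ennreal_ofReal
  have e2 : ∀ ω, ENNReal.ofReal (regPower m E α Q j ω) =
      1 + (∑ i ∈ Finset.range (j + 1), ∑ a ∈ Finset.range (scale m i),
        ENNReal.ofReal (descRatio m E α i j a ω ^ Q) +
        ∑ i ∈ Finset.range (j + 1), ENNReal.ofReal (descRatio m E α 0 i 0 ω ^ Q)) := by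
    intro ω
    have n1 : ∀ i, 0 ≤ ∑ a ∈ Finset.range (scale m i), descRatio m E α i j a ω ^ Q := fun i =>
      Finset.sum_nonneg fun a _ => hXQ _ _ _ _
    have n2 := Finset.sum_nonneg (s := Finset.range (j + 1)) fun i _ => n1 i
    have n3 := Finset.sum_nonneg (s := Finset.range (j + 1)) fun i _ => hXQ 0 i 0 ω
    rw [regPower, ENNReal.ofReal_add zero_le_one (add_nonneg n2 n3), ENNReal.ofReal_one,
      ENNReal.ofReal_add n2 n3, ENNReal.ofReal_sum_of_nonneg fun i _ => n1 i,
      ENNReal.ofReal_sum_of_nonneg fun i _ => hXQ 0 i 0 ω]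
    congr 2
    exact Finset.sum_congr rfl fun i _ => ENNReal.ofReal_sum_of_nonneg fun a _ => hXQ _ _ _ _
  simp only [e2]
  rw [lintegral_add_left measurable_const, lintegral_add_left (Finset.measurable_sum _ fun i _ =>
    Finset.measurable_sum _ fun a _ => hmeas _ _ _), lintegral_finsetSum _ fun i _ =>
    Finset.measurable_sum _ fun a _ => hmeas _ _ _, lintegral_finsetSum _ fun i _ => hmeas _ _ _]
  simp only [lintegral_one, measure_univ]
  have s1 : ∑ i ∈ Finset.range (j + 1), ∫⁻ ω, ∑ a ∈ Finset.range (scale m i),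
      ENNReal.ofReal (descRatio m E α i j a ω ^ Q) ∂P ≤
        ENNReal.ofReal (((j : ℝ) + 1) * (scale m j * B)) := by
    refine (Finset.sum_le_card_nsmul _ _ (ENNReal.ofReal (scale m j * B)) fun i hi => ?_).trans
      (le_of_eq ?_)
    · have hij : i ≤ j := Nat.lt_succ_iff.1 (Finset.mem_range.1 hi)
      rw [lintegral_finsetSum _ fun a _ => hmeas _ _ _]
      refine (Finset.sum_le_card_nsmul _ _ _ fun a _ => hterm i j a hij le_rfl).trans ?_
      rw [← ENNReal.ofReal_nsmul, nsmul_eq_mul, Finset.card_range]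
      refine ENNReal.ofReal_le_ofReal ?_
      gcongr
      exact scale_mono hm hij
    · rw [← ENNReal.ofReal_nsmul, nsmul_eq_mul, Finset.card_range]; push_cast; rfl
  have s2 : ∑ i ∈ Finset.range (j + 1), ∫⁻ ω, ENNReal.ofReal (descRatio m E α 0 i 0 ω ^ Q) ∂P ≤
        ENNReal.ofReal (((j : ℝ) + 1) * B) := by
    refine (Finset.sum_le_card_nsmul _ _ (ENNReal.ofReal B) fun i hi =>
      hterm 0 i 0 (Nat.zero_le _) (Nat.lt_succ_iff.1 (Finset.mem_range.1 hi))).trans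
      (le_of_eq ?_)
    rw [← ENNReal.ofReal_nsmul, nsmul_eq_mul, Finset.card_range]; push_cast; rfl
  calc _ ≤ ENNReal.ofReal 1 + (ENNReal.ofReal (((j : ℝ) + 1) * (scale m j * B)) +
        ENNReal.ofReal (((j : ℝ) + 1) * B)) := by
        rw [ENNReal.ofReal_one]
        exact add_le_add le_rfl (add_le_add s1 s2)
    _ = ENNReal.ofReal (1 + (((j : ℝ) + 1) * (scale m j * B) + ((j : ℝ) + 1) * B)) := by
        rw [ENNReal.ofReal_add zero_le_one (by positivity), ENNReal.ofReal_add (by positivity)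
          (by positivity)]
    _ ≤ _ := by
        refine ENNReal.ofReal_le_ofReal ?_
        have hJ : (1 : ℝ) ≤ (j : ℝ) + 1 := by have : (0 : ℝ) ≤ j := Nat.cast_nonneg j; linarith
        have hp : 1 ≤ (scale m j : ℝ) ^ (12 * ε * Q) := Real.one_le_rpow hM1 (by positivity)
        rw [Real.rpow_add hM, Real.rpow_one]
        set M : ℝ := (scale m j : ℝ)
        set L : ℝ := M ^ (12 * ε * Q)
        set J : ℝ := (j : ℝ) + 1
        have hML : 1 ≤ M * L := one_le_mul_of_one_le_of_one_le hM1 hp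
        have hJML : 1 ≤ J * (M * L) := one_le_mul_of_one_le_of_one_le hJ hML
        have hBM : J * B ≤ J * (M * B) := by
          gcongr
          exact le_mul_of_one_le_left hB0 hM1
        have : J * (M * B) = C ^ Q * (J * (M * L)) := by rw [hB]; ring
        nlinarith

lemma lintegral_rpow_le_of_le_one [IsProbabilityMeasure P] {T : Ω → ℝ} (hT : Measurable T)
    (hT0 : ∀ ω, 0 ≤ T ω) {θ : ℝ} (hθ : 0 < θ) (hθ1 : θ ≤ 1) :
    ∫⁻ ω, ENNReal.ofReal (T ω ^ θ) ∂P ≤ (∫⁻ ω, ENNReal.ofReal (T ω) ∂P) ^ θ := by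
  have h := eLpNorm'_le_eLpNorm'_of_exponent_le hθ hθ1 P hT.aestronglyMeasurable
  unfold eLpNorm' at h
  simp only [ENNReal.rpow_one, div_one] at h
  have e : ∀ ω, ‖T ω‖ₑ = ENNReal.ofReal (T ω) := fun ω => by
    rw [← ofReal_norm, Real.norm_of_nonneg (hT0 ω)]
  simp only [e] at h
  have e2 : ∀ ω, ENNReal.ofReal (T ω ^ θ) = ENNReal.ofReal (T ω) ^ θ := fun ω =>
    (ENNReal.ofReal_rpow_of_nonneg (hT0 ω) hθ.le).symm
  simp only [e2]
  calc _ = ((∫⁻ ω, ENNReal.ofReal (T ω) ^ θ ∂P) ^ (1 / θ)) ^ θ := by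
        rw [← ENNReal.rpow_mul, one_div_mul_cancel hθ.ne', ENNReal.rpow_one]
    _ ≤ _ := ENNReal.rpow_le_rpow h hθ.le

lemma regPower_nonneg {Ω : Type*} (m : ℕ → ℕ) (E : ℕ → Ω → Set ℝ) (α Q : ℝ) (j : ℕ) (ω : Ω) :
    0 ≤ regPower m E α Q j ω := by
  have hXQ : ∀ k i a, 0 ≤ descRatio m E α k i a ω ^ Q := fun k i a =>
    Real.rpow_nonneg (descRatio_nonneg m E α k i a ω) Q
  exact add_nonneg zero_le_one (add_nonneg (Finset.sum_nonneg fun i _ =>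
    Finset.sum_nonneg fun a _ => hXQ _ _ _) (Finset.sum_nonneg fun i _ => hXQ _ _ _))

/-- A fixed power `r` of the regularity constant has expectation `M_j^{O(ε)}`: the number of cells
in the union bound costs only `M_j^ε` when the exponent of the `ℓ^Q` norm is `Q = r / ε`. -/
lemma IsRandomCantor.lintegral_regConst_le (hE : IsRandomCantor P m β E) [IsProbabilityMeasure P]
    (hm : IsAdmissible m) {α ε G r : ℝ} (hα0 : 0 < α) (hε : 0 < ε) (hε1 : ε ≤ 1)
    (hG : IsGrowth m β α ε G) (hr : 1 ≤ r) :
    ∃ C : ℝ, 0 ≤ C ∧ ∀ j, ∫⁻ ω, ENNReal.ofReal ((regPower m E α (r / ε) j ω ^ (1 / (r / ε))) ^ r) ∂P ≤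
      ENNReal.ofReal (C * (scale m j : ℝ) ^ (ε * (2 + 12 * r))) := by
  have hr0 : 0 < r := by linarith
  obtain ⟨C, hC, H⟩ := hE.lintegral_regPower_le hm hα0 hε hG (Q := r / ε) (by
    rw [le_div_iff₀ hε]; linarith)
  have hG0 : 0 < G := lt_of_lt_of_le one_pos hG.one_le
  refine ⟨(C * G) ^ ε, by positivity, fun j => ?_⟩
  have hM := scale_pos_real hm j
  have hM1 := one_le_scale_real hm j
  have e1 : ∀ ω, (regPower m E α (r / ε) j ω ^ (1 / (r / ε))) ^ r = regPower m E α (r / ε) j ω ^ ε :=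
    fun ω => by
      rw [← Real.rpow_mul (regPower_nonneg _ _ _ _ _ _)]
      congr 1; field_simp
  simp only [e1]
  refine (lintegral_rpow_le_of_le_one (hE.measurable_regPower _ _ _)
    (regPower_nonneg _ _ _ _ _) hε hε1).trans ?_
  refine (ENNReal.rpow_le_rpow (H j) hε.le).trans ?_
  rw [ENNReal.ofReal_rpow_of_nonneg (by positivity) hε.le]
  refine ENNReal.ofReal_le_ofReal ?_
  calc (C * ((j : ℝ) + 1) * (scale m j : ℝ) ^ (1 + 12 * ε * (r / ε))) ^ ε
      ≤ (C * (G * (scale m j : ℝ) ^ ε) * (scale m j : ℝ) ^ (1 + 12 * ε * (r / ε))) ^ ε := by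
        gcongr
        exact hG.index_le j
    _ = ((C * G) * (scale m j : ℝ) ^ (ε + (1 + 12 * r))) ^ ε := by
        rw [show 12 * ε * (r / ε) = 12 * r by field_simp, Real.rpow_add hM ε (1 + 12 * r)]
        congr 1
        ring
    _ = (C * G) ^ ε * (scale m j : ℝ) ^ ((ε + (1 + 12 * r)) * ε) := by
        rw [Real.mul_rpow (by positivity) (by positivity), ← Real.rpow_mul hM.le]
    _ ≤ _ := by
        refine mul_le_mul_of_nonneg_left (Real.rpow_le_rpow_of_exponent_le hM1 ?_) (by positivity)
        nlinarith

end

section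
variable {Ω : Type*} [MeasurableSpace Ω] {P : Measure Ω} {m : ℕ → ℕ} {β : ℕ → ℝ}
  {E : ℕ → Ω → Set ℝ}

/-! ### The moments of the frequency increments -/

/-- The deterministic estimate: for a tree that is `α`-dimensional at all scales, the `s`-th power of the
square function of the Fourier transforms of the cells is integrable over all frequencies. -/
lemma exists_lintegral_squareSum_le {d : ℕ} (hd : 1 ≤ d) {s α : ℝ}
    (hs : ((d * (d + 1) / 2 : ℕ) : ℝ) + 1 < 2 * s) (hα0 : 0 < α) (hα1 : α < 1) :
    ∃ C : ℝ, 0 ≤ C ∧ ∀ (m : ℕ → ℕ) (β : ℕ → ℝ) (S : ℕ → Finset ℕ) (j : ℕ) (R : ℝ),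
      IsAdmissible m → 0 ≤ β (j + 1) → 1 ≤ R → IsRegularTree m α S j R →
        ∫⁻ ξ : EuclideanSpace ℝ (Fin d),
          ENNReal.ofReal (squareSum m β j (cellFourier m (j + 1) ξ) (S j)) ^ s ≤
        ENNReal.ofReal (C * (((β (j + 1) * m (j + 1) / scale m j) ^ 2) ^ s * (R ^ (s + 1) *
          (m (j + 1) : ℝ) ^ s * (j + 1) * ((scale m j : ℝ) ^ (α * s + d) +
          (scale m j : ℝ) ^ (α + (d * (d + 1) / 2 : ℕ)))))) := by
  obtain ⟨C, hC, H⟩ := exists_lintegral_resonanceSum_le hd hs hα0 hα1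
  have hs0 : 0 < s := by
    have : (0 : ℝ) ≤ (d * (d + 1) / 2 : ℕ) := Nat.cast_nonneg _
    linarith
  set K : ℝ := 4 * 2 ^ (d + d * (2 * d)) with hK
  refine ⟨(K ^ 2) ^ s * C, by positivity, fun m β S j R hm hβ hR hS => ?_⟩
  obtain ⟨U, hU, hUle, hint⟩ := H m S j R hm hR hS
  have hM := scale_pos_real hm j
  set W : ℝ := R ^ (s + 1) * (m (j + 1) : ℝ) ^ s * (j + 1) * ((scale m j : ℝ) ^ (α * s + d) +
          (scale m j : ℝ) ^ (α + (d * (d + 1) / 2 : ℕ))) with hW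
  set b : ℝ := β (j + 1) * m (j + 1) / scale m j with hb
  have hb0 : 0 ≤ b := by positivity
  have hpt : ∀ ξ : EuclideanSpace ℝ (Fin d),
      ENNReal.ofReal (squareSum m β j (cellFourier m (j + 1) ξ) (S j)) ^ s ≤
        ENNReal.ofReal (((K * b) ^ 2) ^ s) * U ξ := by
    intro ξ
    have h1 : ENNReal.ofReal (squareSum m β j (cellFourier m (j + 1) ξ) (S j)) ≤
        ENNReal.ofReal ((K * b) ^ 2) * resonanceSum m S j ξ := by
      rw [squareSum, ENNReal.ofReal_mul (sq_nonneg _)]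
      refine (mul_le_mul' le_rfl (sum_sq_le_resonanceSum hm S j ξ)).trans (le_of_eq ?_)
      rw [← mul_assoc, ← ENNReal.ofReal_mul (sq_nonneg _), hb, hK]
      congr 2; ring
    refine (ENNReal.rpow_le_rpow h1 hs0.le).trans ?_
    rw [ENNReal.mul_rpow_of_nonneg _ _ hs0.le, ENNReal.ofReal_rpow_of_nonneg (sq_nonneg _) hs0.le]
    exact mul_le_mul' le_rfl (hUle ξ)
  refine (lintegral_mono hpt).trans ?_
  rw [lintegral_const_mul' _ _ ENNReal.ofReal_ne_top]
  refine (mul_le_mul' le_rfl hint).trans ?_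
  rw [← ENNReal.ofReal_mul (by positivity)]
  refine le_of_eq ?_
  rw [mul_pow, Real.mul_rpow (by positivity) (by positivity)]
  congr 1; ring

lemma continuous_cellFourier {d : ℕ} (m : ℕ → ℕ) (j l : ℕ) :
    Continuous fun ξ : EuclideanSpace ℝ (Fin d) => cellFourier m j ξ l := by
  unfold cellFourier
  refine intervalIntegral.continuous_parametric_intervalIntegral_of_continuous' ?_ _ _
  have : (fun x : EuclideanSpace ℝ (Fin d) × ℝ => osc (phase x.1) x.2) = fun x =>
      Complex.exp (-((2 * Real.pi * (∑ i : Fin d, x.2 ^ ((i : ℕ) + 1) * x.1 i) : ℝ) : ℂ) *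
        Complex.I) := by
    funext x
    rw [osc, eval_phase]
    congr 5
    simp [momentCurve, PiLp.inner_apply, mul_comm]
  change Continuous fun x : EuclideanSpace ℝ (Fin d) × ℝ => osc (phase x.1) x.2
  rw [this]
  fun_prop

lemma continuous_increment {Ω : Type*} {d : ℕ} (m : ℕ → ℕ) (β : ℕ → ℝ) (E : ℕ → Ω → Set ℝ) (j : ℕ) (ω : Ω) :
    Continuous fun ξ : EuclideanSpace ℝ (Fin d) =>
      increment m β E j (cellFourier m (j + 1) ξ) ω := by
  unfold increment
  exact continuous_finsetSum _ fun l _ => continuous_const.mul (continuous_cellFourier _ _ _)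

lemma IsRandomCantor.measurable_increment {d : ℕ} (hE : IsRandomCantor P m β E) (j : ℕ) :
    Measurable fun x : Ω × EuclideanSpace ℝ (Fin d) =>
      increment m β E j (cellFourier m (j + 1) x.2) x.1 := by
  unfold increment
  refine Finset.measurable_sum _ fun l _ => Measurable.mul ?_
    ((continuous_cellFourier _ _ _).measurable.comp measurable_snd)
  refine Complex.measurable_ofReal.comp (Measurable.sub ?_ ?_)
  · exact ((hE.measurable_activity _ _).comp measurable_fst).const_mul _
  · exact ((hE.measurable_activity _ _).comp measurable_fst).const_mul _

lemma sum_activeCells_eq {Ω : Type*} (m : ℕ → ℕ) (E : ℕ → Ω → Set ℝ) (j : ℕ) (ω : Ω) (f : ℕ → ℝ) :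
    ∑ k ∈ activeCells m j (E j ω), f k =
      ∑ k ∈ Finset.range (scale m j), activity m E j k ω * f k := by
  simp only [activity, ite_mul, one_mul, zero_mul]
  rw [← Finset.sum_filter]
  congr 1
  ext k
  simp only [Finset.mem_filter, Finset.mem_range]
  exact ⟨fun h => ⟨(mem_activeCells.1 h).1, h⟩, fun h => h.2⟩

lemma IsRandomCantor.measurable_squareSum {d : ℕ} (hE : IsRandomCantor P m β E) (j : ℕ) :
    Measurable fun x : EuclideanSpace ℝ (Fin d) × Ω =>
      squareSum m β j (cellFourier m (j + 1) x.1) (activeCells m j (E j x.2)) := by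
  unfold squareSum
  refine Measurable.const_mul ?_ _
  simp only [sum_activeCells_eq]
  refine Finset.measurable_sum _ fun l _ => Measurable.mul
    ((hE.measurable_activity _ _).comp measurable_snd) (Measurable.pow_const ?_ _)
  exact Finset.measurable_sum _ fun l _ =>
    ((continuous_cellFourier _ _ _).measurable.comp measurable_fst).norm

/-- The real-variable bookkeeping of all powers of `M` in the moment estimate. -/
lemma moment_bookkeeping {M G b μ J s α ε u v η : ℝ} (hM : 1 ≤ M) (hG : 1 ≤ G) (hb : 0 ≤ b)
    (hμ : 0 ≤ μ) (hJ : 0 ≤ J) (hs : 0 < s)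
    (hbG : b ≤ G * M ^ (1 - α + 3 * ε)) (hμG : μ ≤ G * M ^ ε) (hJG : J ≤ G * M ^ ε)
    (hu : u + η ≤ 2 * α * s) (hv : v + η ≤ 2 * α * s) :
    ((b * μ / M) ^ 2) ^ s * (M ^ (ε * (2 + 12 * (s + 1))) * μ ^ s * J * (M ^ u + M ^ v)) ≤
      (((G * G) ^ 2) ^ s * G ^ s * G * 2) * M ^ (ε * (21 * s + 15) - η) := by
  have hM0 : 0 < M := by linarith
  have hG0 : 0 < G := by linarith
  have h1 : b * μ / M ≤ (G * G) * M ^ (4 * ε - α) := by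
    rw [div_le_iff₀ hM0]
    calc b * μ ≤ (G * M ^ (1 - α + 3 * ε)) * (G * M ^ ε) := by gcongr
      _ = (G * G) * (M ^ (1 - α + 3 * ε) * M ^ ε) := by ring
      _ = (G * G) * (M ^ (4 * ε - α) * M ^ (1 : ℝ)) := by
          rw [← Real.rpow_add hM0, ← Real.rpow_add hM0]; congr 2; ring
      _ = _ := by rw [Real.rpow_one]; ring
  have h2 : ((b * μ / M) ^ 2) ^ s ≤ ((G * G) ^ 2) ^ s * M ^ ((4 * ε - α) * 2 * s) := by
    calc ((b * μ / M) ^ 2) ^ s ≤ (((G * G) * M ^ (4 * ε - α)) ^ 2) ^ s := by gcongr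
      _ = _ := by
          rw [mul_pow, Real.mul_rpow (by positivity) (by positivity), ← Real.rpow_mul_natCast hM0.le,
            ← Real.rpow_mul hM0.le]
          norm_num
  have h3 : μ ^ s ≤ G ^ s * M ^ (ε * s) := by
    calc μ ^ s ≤ (G * M ^ ε) ^ s := by gcongr
      _ = _ := by rw [Real.mul_rpow (by positivity) (by positivity), ← Real.rpow_mul hM0.le]
  have h4 : M ^ u + M ^ v ≤ 2 * M ^ (2 * α * s - η) := by
    have e1 := Real.rpow_le_rpow_of_exponent_le hM (show u ≤ 2 * α * s - η by linarith)
    have e2 := Real.rpow_le_rpow_of_exponent_le hM (show v ≤ 2 * α * s - η by linarith)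
    linarith
  calc _ ≤ (((G * G) ^ 2) ^ s * M ^ ((4 * ε - α) * 2 * s)) * (M ^ (ε * (2 + 12 * (s + 1))) *
        (G ^ s * M ^ (ε * s)) * (G * M ^ ε) * (2 * M ^ (2 * α * s - η))) := by gcongr
    _ = (((G * G) ^ 2) ^ s * G ^ s * G * 2) * (M ^ ((4 * ε - α) * 2 * s) *
        M ^ (ε * (2 + 12 * (s + 1))) * M ^ (ε * s) * M ^ ε * M ^ (2 * α * s - η)) := by ring
    _ = _ := by
        simp only [← Real.rpow_add hM0]
        congr 2; ring

/-- The `p`-th moment of the `j`-th increment of the Fourier transform, integrated over all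
frequencies, decays geometrically in the scale. -/
lemma IsRandomCantor.lintegral_lintegral_increment_le (hE : IsRandomCantor P m β E)
    [IsProbabilityMeasure P] (hm : IsAdmissible m) {d : ℕ} (hd : 1 ≤ d) {α : ℝ} (hα0 : 0 < α)
    (hα1 : α < 1)
    (hα : Tendsto (fun j => Real.log (β j) / Real.log (scale m j)) atTop (𝓝 (1 - α)))
    {p : ℝ} (h1 : (d : ℝ) < α * (p / 2)) (h2 : α + (d * (d + 1) / 2 : ℕ) < α * p) :
    ∃ C η : ℝ, 0 ≤ C ∧ 0 < η ∧ ∀ j, ∫⁻ ω, (∫⁻ ξ : EuclideanSpace ℝ (Fin d),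
      ‖increment m β E j (cellFourier m (j + 1) ξ) ω‖ₑ ^ p) ∂P ≤
        ENNReal.ofReal (C * (scale m j : ℝ) ^ (-η)) := by
  set D : ℕ := d * (d + 1) / 2 with hD
  have hD0 : (0 : ℝ) ≤ D := Nat.cast_nonneg _
  have hDp : (D : ℝ) + 1 < p := by nlinarith
  set s : ℝ := p / 2 with hs
  have hp2 : p = 2 * s := by rw [hs]; ring
  have hs0 : 0 < s := by linarith
  set η : ℝ := min (α * s - d) (2 * α * s - α - D) with hη
  have hη0 : 0 < η := lt_min (by linarith) (by rw [hp2] at h2; linarith)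
  have hηu : α * s + d + η ≤ 2 * α * s := by linarith [min_le_left (α * s - d) (2 * α * s - α - D)]
  have hηv : α + D + η ≤ 2 * α * s := by linarith [min_le_right (α * s - d) (2 * α * s - α - D)]
  -- The total loss is `M_j^{εL}`, and `ε` is chosen so that it costs half of the decay `M_j^{-η}`.
  set L : ℝ := 21 * s + 15 with hL
  have hL0 : 0 < L := by positivity
  set ε : ℝ := min 1 (η / (2 * L)) with hε
  have hε0 : 0 < ε := lt_min one_pos (by positivity)
  have hε1 : ε ≤ 1 := min_le_left _ _
  have hεL : ε * L ≤ η / 2 := by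
    have : ε ≤ η / (2 * L) := min_le_right _ _
    rw [le_div_iff₀ (by positivity)] at this
    linarith
  obtain ⟨G, hG⟩ := exists_isGrowth hm (fun j => hE.one_le_beta j) hα0 hα1 hα hε0 hε1
  obtain ⟨C₁, hC₁, H₁⟩ := hE.lintegral_increment_le hm (show 0 < p by linarith)
  obtain ⟨C₂, hC₂, H₂⟩ := exists_lintegral_squareSum_le (α := α) hd (s := s)
    (by rw [← hp2]; exact hDp) hα0 hα1
  obtain ⟨C₃, hC₃, H₃⟩ := hE.lintegral_regConst_le hm hα0 hε0 hε1 hG (r := s + 1) (by linarith)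
  set Q : ℝ := (s + 1) / ε with hQ
  have hQ0 : 0 < Q := by positivity
  set G' : ℝ := ((G * G) ^ 2) ^ s * G ^ s * G * 2 with hG'
  have hG1 := hG.one_le
  refine ⟨C₁ * (C₂ * C₃) * G', η / 2, by positivity, by positivity, fun j => ?_⟩
  have hM := scale_pos_real hm j
  have hM1 := one_le_scale_real hm j
  have hβ : 0 ≤ β (j + 1) := zero_le_one.trans (hE.one_le_beta _)
  set W : ℝ := (m (j + 1) : ℝ) ^ s * (j + 1) * ((scale m j : ℝ) ^ (α * s + d) +
          (scale m j : ℝ) ^ (α + D)) with hW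
  have hW0 : 0 ≤ W := by positivity
  set B : ℝ := ((β (j + 1) * m (j + 1) / scale m j) ^ 2) ^ s with hB
  have hB0 : 0 ≤ B := by positivity
  rw [lintegral_lintegral_swap ((hE.measurable_increment j).enorm.pow_const p).aemeasurable]
  calc _ ≤ ∫⁻ ξ : EuclideanSpace ℝ (Fin d), ENNReal.ofReal C₁ * ∫⁻ ω, ENNReal.ofReal (squareSum m β j
        (cellFourier m (j + 1) ξ) (activeCells m j (E j ω))) ^ s ∂P :=
        lintegral_mono fun ξ => H₁ j _
    _ = ENNReal.ofReal C₁ * ∫⁻ ω, (∫⁻ ξ : EuclideanSpace ℝ (Fin d), ENNReal.ofReal (squareSum m β j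
        (cellFourier m (j + 1) ξ) (activeCells m j (E j ω))) ^ s) ∂P := by
        rw [lintegral_const_mul' _ _ ENNReal.ofReal_ne_top, lintegral_lintegral_swap]
        exact ((hE.measurable_squareSum j).ennreal_ofReal.pow_const s).aemeasurable
    _ ≤ ENNReal.ofReal C₁ * ∫⁻ ω, ENNReal.ofReal (C₂ * (B * W)) *
        ENNReal.ofReal ((regPower m E α Q j ω ^ (1 / Q)) ^ (s + 1)) ∂P := by
        refine mul_le_mul' le_rfl (lintegral_mono_ae ?_)
        filter_upwards [hE.ae_parent_mem hm] with ω hω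
        obtain ⟨hR, hreg⟩ := isRegularTree_regPower (α := α) hm hQ0 j hω
        refine (H₂ m β _ j _ hm hβ hR hreg).trans (le_of_eq ?_)
        rw [← ENNReal.ofReal_mul (by positivity)]
        congr 1
        rw [hW]; ring
    _ ≤ ENNReal.ofReal C₁ * (ENNReal.ofReal (C₂ * (B * W)) *
        ENNReal.ofReal (C₃ * (scale m j : ℝ) ^ (ε * (2 + 12 * (s + 1))))) := by
        rw [lintegral_const_mul' _ _ ENNReal.ofReal_ne_top]
        exact mul_le_mul' le_rfl (mul_le_mul' le_rfl (H₃ j))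
    _ = ENNReal.ofReal (C₁ * (C₂ * C₃) * (B * ((scale m j : ℝ) ^ (ε * (2 + 12 * (s + 1))) *
        (m (j + 1) : ℝ) ^ s * (j + 1) * ((scale m j : ℝ) ^ (α * s + d) +
          (scale m j : ℝ) ^ (α + D))))) := by
        rw [← ENNReal.ofReal_mul (by positivity), ← ENNReal.ofReal_mul hC₁]
        congr 1
        rw [hW]; ring
    _ ≤ ENNReal.ofReal (C₁ * (C₂ * C₃) * (G' * (scale m j : ℝ) ^ (ε * (21 * s + 15) - η))) := by
        refine ENNReal.ofReal_le_ofReal (mul_le_mul_of_nonneg_left ?_ (by positivity))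
        exact moment_bookkeeping hM1 hG1 hβ (Nat.cast_nonneg _) (by positivity) hs0
          (hG.beta_succ_le j) (hG.m_le j) (hG.index_le j) hηu hηv
    _ ≤ _ := by
        refine ENNReal.ofReal_le_ofReal ?_
        rw [mul_assoc (C₁ * (C₂ * C₃))]
        refine mul_le_mul_of_nonneg_left (mul_le_mul_of_nonneg_left ?_ (by positivity))
          (by positivity)
        exact Real.rpow_le_rpow_of_exponent_le hM1 (by linarith)

end

section
variable {Ω : Type*} [MeasurableSpace Ω] {P : Measure Ω} {m : ℕ → ℕ} {β : ℕ → ℝ}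
  {E : ℕ → Ω → Set ℝ}

/-! ### Linear statistics of the random measures -/

/-- The integral of `f` over the `l`-th cell of level `j`. -/
def cellIntegral (m : ℕ → ℕ) (f : ℝ → ℂ) (j l : ℕ) : ℂ :=
  ∫ t in (l : ℝ) / scale m j..((l : ℝ) + 1) / scale m j, f t

lemma sum_cellIntegral_children (hm : IsAdmissible m) {f : ℝ → ℂ} (hf : Continuous f) (j k : ℕ) :
    ∑ l ∈ children m j k, cellIntegral m f (j + 1) l = cellIntegral m f j k := by
  have hM := scale_pos_real hm j
  have hmj := m_pos_real hm j
  have h := intervalIntegral.sum_integral_adjacent_intervals_Ico (μ := volume) (f := f)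
    (a := fun l : ℕ => (l : ℝ) / scale m (j + 1)) (m := k * m (j + 1)) (n := (k + 1) * m (j + 1))
    (Nat.mul_le_mul_right _ (Nat.le_succ k)) fun l _ => hf.intervalIntegrable _ _
  unfold cellIntegral children
  push_cast at h
  rw [h, scale_succ_real]
  congr 1 <;> field_simp

lemma norm_cellIntegral_le (hm : IsAdmissible m) {f : ℝ → ℂ} {K : ℝ}
    (hK : ∀ t ∈ Icc (0 : ℝ) 1, ‖f t‖ ≤ K) {j l : ℕ} (hl : l < scale m j) :
    ‖cellIntegral m f j l‖ ≤ K / scale m j := by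
  have hM := scale_pos_real hm j
  have hle : (l : ℝ) / scale m j ≤ ((l : ℝ) + 1) / scale m j := by gcongr; linarith
  have h1 : ((l : ℝ) + 1) / scale m j ≤ 1 := by
    rw [div_le_one hM]
    exact_mod_cast hl
  refine (intervalIntegral.norm_integral_le_of_norm_le_const (C := K) fun t ht => ?_).trans
    (le_of_eq ?_)
  · rw [uIoc_of_le hle] at ht
    have : (0 : ℝ) ≤ (l : ℝ) / scale m j := by positivity
    exact hK t ⟨this.trans ht.1.le, ht.2.trans h1⟩
  · rw [← sub_div, add_sub_cancel_left, abs_of_pos (by positivity)]; ring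

lemma integral_lineMeasure {b : ℝ} {A : Set ℝ} (hb : 0 ≤ b) (hA : MeasurableSet A) (f : ℝ → ℂ) :
    ∫ t, f t ∂(lineMeasure b A : Measure ℝ) = ∫ t in (0 : ℝ)..1, (density b A t : ℂ) * f t := by
  have hd : ∀ t, 0 ≤ density b A t := fun t => indicator_nonneg (fun _ _ => hb) t
  have hdm : Measurable (density b A) := measurable_const.indicator hA
  have h : (lineMeasure b A : Measure ℝ) =
    (volume.restrict (Icc (0 : ℝ) 1)).withDensity fun t => ENNReal.ofReal (density b A t) := rfl
  rw [h, integral_withDensity_eq_integral_toReal_smul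
    hdm.ennreal_ofReal (ae_of_all _ fun _ => ENNReal.ofReal_lt_top),
    intervalIntegral.integral_of_le zero_le_one, ← integral_Icc_eq_integral_Ioc]
  refine integral_congr_ae (ae_of_all _ fun t => ?_)
  dsimp only
  rw [ENNReal.toReal_ofReal (hd t), Complex.real_smul]

lemma IsRandomCantor.measurableSet (hE : IsRandomCantor P m β E) (j : ℕ) (ω : Ω) :
    MeasurableSet (E j ω) := by
  obtain ⟨S, hS⟩ := hE.union j ω
  rw [hS]
  exact MeasurableSet.biUnion S.to_countable fun k _ => measurableSet_Ico

/-- `μ_j` is constant on the cells of level `j`. -/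
lemma IsRandomCantor.integral_lineMeasure_eq (hE : IsRandomCantor P m β E) (hm : IsAdmissible m)
    {f : ℝ → ℂ} (hf : Continuous f) (j : ℕ) (ω : Ω) :
    ∫ t, f t ∂(lineMeasure (β j) (E j ω) : Measure ℝ) = ∑ k ∈ Finset.range (scale m j),
      ((β j * activity m E j k ω : ℝ) : ℂ) * cellIntegral m f j k := by
  have hβ := zero_le_one.trans (hE.one_le_beta j)
  have hM := scale_pos_real hm j
  rw [integral_lineMeasure hβ (hE.measurableSet j ω)]
  have hae : ∀ k < scale m j, ∀ᵐ t : ℝ, t ∈ uIoc ((k : ℝ) / scale m j) (((k : ℝ) + 1) / scale m j) →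
      (density (β j) (E j ω) t : ℂ) * f t = ((β j * activity m E j k ω : ℝ) : ℂ) * f t := by
    intro k hk
    filter_upwards [compl_mem_ae_iff.2 (measure_singleton (((k : ℝ) + 1) / scale m j))] with t ht ht'
    rw [uIoc_of_le (by gcongr; linarith)] at ht'
    rw [hE.density_eq hm hk ⟨ht'.1.le, lt_of_le_of_ne ht'.2 ht⟩]
  have h := intervalIntegral.sum_integral_adjacent_intervals (μ := volume)
    (f := fun t => (density (β j) (E j ω) t : ℂ) * f t)
    (a := fun l : ℕ => (l : ℝ) / scale m j) (n := scale m j) fun k hk => by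
      push_cast
      refine IntervalIntegrable.congr_ae (f := fun t => ((β j * activity m E j k ω : ℝ) : ℂ) * f t)
        ((continuous_const.mul hf).intervalIntegrable _ _) ?_
      rw [EventuallyEq, ae_restrict_iff' measurableSet_uIoc]
      filter_upwards [hae k hk] with t ht ht'
      exact (ht ht').symm
  rw [div_self hM.ne', Nat.cast_zero, zero_div] at h
  rw [← h]
  refine Finset.sum_congr rfl fun k hk => ?_
  push_cast
  rw [intervalIntegral.integral_congr_ae (hae k (Finset.mem_range.1 hk)),
    intervalIntegral.integral_const_mul]
  push_cast
  rfl

/-- The change of `∫ f dμ_j` from level `j` to `j + 1` is an `increment`, because the integral of `f` over a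
cell is the sum of its integrals over the children. -/
lemma IsRandomCantor.integral_succ_sub (hE : IsRandomCantor P m β E) (hm : IsAdmissible m)
    {f : ℝ → ℂ} (hf : Continuous f) (j : ℕ) (ω : Ω) :
    ∫ t, f t ∂(lineMeasure (β (j + 1)) (E (j + 1) ω) : Measure ℝ) -
      ∫ t, f t ∂(lineMeasure (β j) (E j ω) : Measure ℝ) =
        increment m β E j (cellIntegral m f (j + 1)) ω := by
  rw [hE.integral_lineMeasure_eq hm hf, hE.integral_lineMeasure_eq hm hf, increment]
  simp only [Complex.ofReal_sub, sub_mul, Finset.sum_sub_distrib]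
  congr 1
  rw [sum_range_scale_succ m j]
  refine Finset.sum_congr rfl fun k _ => ?_
  rw [← sum_cellIntegral_children hm hf, Finset.mul_sum]
  exact Finset.sum_congr rfl fun l hl => by rw [div_of_mem_children hl]

lemma measurable_momentCurve (d : ℕ) : Measurable (momentCurve d) := by
  unfold momentCurve
  have : Continuous fun t : ℝ => (WithLp.toLp 2 fun i : Fin d => t ^ ((i : ℕ) + 1) :
      EuclideanSpace ℝ (Fin d)) := by fun_prop
  exact this.measurable

lemma fourierMeasure_curveMeasure {d : ℕ} (b : ℝ) (A : Set ℝ) (ξ : EuclideanSpace ℝ (Fin d)) :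
    fourierMeasure (curveMeasure d b A) ξ =
      ∫ t, osc (phase ξ) t ∂(lineMeasure b A : Measure ℝ) := by
  have h : (curveMeasure d b A : Measure (EuclideanSpace ℝ (Fin d))) =
      (lineMeasure b A : Measure ℝ).map (momentCurve d) := rfl
  rw [fourierMeasure, h, integral_map (measurable_momentCurve d).aemeasurable]
  · simp only [osc, eval_phase]
  · exact Continuous.aestronglyMeasurable (by fun_prop)

lemma IsRandomCantor.fourierMeasure_succ_sub (hE : IsRandomCantor P m β E) (hm : IsAdmissible m)
    {d : ℕ} (ξ : EuclideanSpace ℝ (Fin d)) (j : ℕ) (ω : Ω) :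
    fourierMeasure (curveMeasure d (β (j + 1)) (E (j + 1) ω)) ξ -
      fourierMeasure (curveMeasure d (β j) (E j ω)) ξ =
        increment m β E j (cellFourier m (j + 1) ξ) ω := by
  rw [fourierMeasure_curveMeasure, fourierMeasure_curveMeasure,
    hE.integral_succ_sub hm (continuous_osc _)]
  rfl

lemma IsRandomCantor.fourierMeasure_eq_sum (hE : IsRandomCantor P m β E) (hm : IsAdmissible m)
    {d : ℕ} (ξ : EuclideanSpace ℝ (Fin d)) (j : ℕ) (ω : Ω) :
    fourierMeasure (curveMeasure d (β j) (E j ω)) ξ = fourierMeasure (curveMeasure d 1 (Ico 0 1)) ξ +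
      ∑ i ∈ Finset.range j, increment m β E i (cellFourier m (i + 1) ξ) ω := by
  induction j with
  | zero => rw [hE.beta_zero, hE.set_zero]; simp
  | succ j ih => rw [Finset.sum_range_succ, ← add_assoc, ← ih, ← hE.fourierMeasure_succ_sub hm]; ring

/-- The Fourier transform of arc length, in the parameter, is in `L^p` for `p > d (d + 1) / 2 + 1`;
this is the case of level `0` of the deterministic estimate. -/
lemma lintegral_fourierMeasure_unit_lt_top {d : ℕ} (hd : 1 ≤ d) {p : ℝ}
    (hp : ((d * (d + 1) / 2 : ℕ) : ℝ) + 1 < p) :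
    ∫⁻ ξ : EuclideanSpace ℝ (Fin d), ‖fourierMeasure (curveMeasure d 1 (Ico 0 1)) ξ‖ₑ ^ p < ∞ := by
  have hm : IsAdmissible fun _ => 2 := by
    refine ⟨fun _ _ => le_rfl, fun _ _ => le_rfl, fun ε hε => ⟨2, fun j => ?_⟩⟩
    have h1 : (1 : ℝ) ≤ scale (fun _ => 2) j := by
      exact Nat.one_le_cast.2 (show 0 < ∏ i ∈ Finset.Icc 1 j, 2 from
        Finset.prod_pos fun _ _ => two_pos)
    have := Real.one_le_rpow h1 hε.le
    push_cast
    linarith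
  have hp0 : 0 < p := by
    have : (0 : ℝ) ≤ (d * (d + 1) / 2 : ℕ) := Nat.cast_nonneg _
    linarith
  obtain ⟨C, -, H⟩ := exists_lintegral_squareSum_le hd (s := p / 2) (α := 1 / 2) (by linarith)
    (by norm_num) (by norm_num)
  have hreg : IsRegularTree (fun _ => 2) (1 / 2) (fun _ => {0}) 0 1 := by
    refine ⟨fun l hl => ?_, fun i hi => absurd hi (Nat.not_lt_zero i), fun i hi a => ?_,
      fun i hi => ?_⟩
    · rw [Finset.mem_singleton.1 hl, scale_zero]; exact one_pos
    · rw [Nat.le_zero.1 hi, scale_zero]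
      simpa using Finset.card_filter_le {0} fun l => ancestor (fun _ => 2) 0 0 l = a
    · rw [Nat.le_zero.1 hi, scale_zero]; simp
  refine lt_of_le_of_lt ?_ ((H (fun _ => 2) (fun _ => 1) (fun _ => {0}) 0 1 hm zero_le_one le_rfl
    hreg).trans_lt ENNReal.ofReal_lt_top)
  refine lintegral_mono fun ξ => ?_
  set F := fourierMeasure (curveMeasure d 1 (Ico 0 1)) ξ with hF
  have h1 : F = ∑ l ∈ children (fun _ => 2) 0 0, cellFourier (fun _ => 2) 1 ξ l := by
    have e := sum_cellIntegral_children hm (continuous_osc (phase ξ)) 0 0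
    refine Eq.trans ?_ e.symm
    rw [hF, fourierMeasure_curveMeasure, integral_lineMeasure zero_le_one measurableSet_Ico,
      cellIntegral, scale_zero]
    norm_num
    refine intervalIntegral.integral_congr_ae ?_
    filter_upwards [compl_mem_ae_iff.2 (measure_singleton (1 : ℝ))] with t ht ht'
    rw [uIoc_of_le zero_le_one] at ht'
    have : t ∈ Ico (0 : ℝ) 1 := ⟨ht'.1.le, lt_of_le_of_ne ht'.2 ht⟩
    simp [density, indicator_of_mem this]
  have h2 : ‖F‖ ^ 2 ≤ squareSum (fun _ => 2) (fun _ => 1) 0 (cellFourier (fun _ => 2) 1 ξ) {0} := by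
    rw [squareSum, Finset.sum_singleton, one_pow, one_mul, h1]
    gcongr
    exact norm_sum_le _ _
  calc ‖F‖ₑ ^ p = ENNReal.ofReal (‖F‖ ^ 2) ^ (p / 2) := by
        rw [ENNReal.ofReal_pow (norm_nonneg _), ofReal_norm, ← ENNReal.rpow_natCast,
          ← ENNReal.rpow_mul]
        congr 1; push_cast; ring
    _ ≤ _ := ENNReal.rpow_le_rpow (ENNReal.ofReal_le_ofReal h2) (by positivity)

/-- The second moment of the increment of a bounded linear statistic decays geometrically in the
scale. -/
lemma IsRandomCantor.lintegral_increment_cellIntegral_le (hE : IsRandomCantor P m β E)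
    [IsProbabilityMeasure P] (hm : IsAdmissible m) {α : ℝ} (hα0 : 0 < α) (hα1 : α < 1)
    (hα : Tendsto (fun j => Real.log (β j) / Real.log (scale m j)) atTop (𝓝 (1 - α)))
    {f : ℝ → ℂ} {K : ℝ} (hK0 : 0 ≤ K) (hK : ∀ t ∈ Icc (0 : ℝ) 1, ‖f t‖ ≤ K) :
    ∃ C : ℝ, 0 ≤ C ∧ ∀ j, ∫⁻ ω, ‖increment m β E j (cellIntegral m f (j + 1)) ω‖ₑ ^ (2 : ℝ) ∂P ≤
        ENNReal.ofReal (C * (scale m j : ℝ) ^ (-(α / 2))) := by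
  set ε : ℝ := α / 36 with hε
  have hε0 : 0 < ε := by positivity
  obtain ⟨G, hG⟩ := exists_isGrowth hm (fun j => hE.one_le_beta j) hα0 hα1 hα hε0 (by linarith)
  obtain ⟨C₁, hC₁, H₁⟩ := hE.lintegral_increment_le hm (show (0 : ℝ) < 2 by norm_num)
  obtain ⟨C₂, hC₂, H₂⟩ := hE.lintegral_descCount_le hm hα0 hε0 hG le_rfl
  have hG1 := hG.one_le
  refine ⟨C₁ * (K ^ 2 * G ^ 2 * C₂), by positivity, fun j => ?_⟩
  have hM := scale_pos_real hm j
  have hβ : 0 ≤ β (j + 1) := zero_le_one.trans (hE.one_le_beta _)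
  have hmj := m_pos_real hm j
  have hpt : ∀ ω, ENNReal.ofReal (squareSum m β j (cellIntegral m f (j + 1))
      (activeCells m j (E j ω))) ^ ((2 : ℝ) / 2) ≤
        ENNReal.ofReal ((β (j + 1) * (K / scale m j)) ^ 2) *
          ENNReal.ofReal (descCount m E 0 j 0 ω) ^ (1 : ℝ) := by
    intro ω
    rw [div_self two_ne_zero, ENNReal.rpow_one, ENNReal.rpow_one,
      ← ENNReal.ofReal_mul (sq_nonneg _)]
    refine ENNReal.ofReal_le_ofReal ?_
    have hcard : descCount m E 0 j 0 ω = (activeCells m j (E j ω)).card := by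
      unfold descCount
      congr 1
      exact Finset.filter_true_of_mem fun l hl => ancestor_zero (mem_activeCells.1 hl).1
    rw [squareSum, hcard, mul_pow, mul_assoc]
    refine mul_le_mul_of_nonneg_left ?_ (sq_nonneg _)
    refine (Finset.sum_le_card_nsmul _ _ ((K / scale m j) ^ 2) fun k hk => ?_).trans (le_of_eq ?_)
    · refine pow_le_pow_left₀ (Finset.sum_nonneg fun _ _ => norm_nonneg _) ?_ 2
      refine (Finset.sum_le_card_nsmul _ _ (K / scale m (j + 1)) fun l hl =>
        norm_cellIntegral_le hm hK
          (lt_scale_of_mem_children (mem_activeCells.1 hk).1 hl)).trans (le_of_eq ?_)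
      rw [card_children, nsmul_eq_mul, scale_succ_real]
      field_simp
    · rw [nsmul_eq_mul, mul_comm]
  refine (H₁ j _).trans ?_
  refine (mul_le_mul' le_rfl (lintegral_mono hpt)).trans ?_
  rw [lintegral_const_mul' _ _ ENNReal.ofReal_ne_top]
  refine (mul_le_mul' le_rfl (mul_le_mul' le_rfl (H₂ 0 j 0 (Nat.zero_le j)))).trans ?_
  rw [scale_zero, Nat.cast_one, div_one, Real.rpow_one, ← ENNReal.ofReal_mul (sq_nonneg _),
    ← ENNReal.ofReal_mul hC₁]
  refine ENNReal.ofReal_le_ofReal ?_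
  rw [mul_assoc C₁]
  refine mul_le_mul_of_nonneg_left ?_ hC₁
  set M : ℝ := (scale m j : ℝ) with hMd
  calc (β (j + 1) * (K / M)) ^ 2 * (C₂ * M ^ α * M ^ (12 * ε))
      ≤ ((G * M ^ (1 - α + 3 * ε)) * (K / M)) ^ 2 * (C₂ * M ^ α * M ^ (12 * ε)) := by
        gcongr
        exact hG.beta_succ_le j
    _ = (K ^ 2 * G ^ 2 * C₂) * (M ^ (1 - α + 3 * ε) * M ^ (1 - α + 3 * ε) * M ^ α * M ^ (12 * ε) *
        M ^ (-1 : ℝ) * M ^ (-1 : ℝ)) := by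
        rw [Real.rpow_neg_one]; ring
    _ = _ := by
        simp only [← Real.rpow_add hM]
        congr 2; rw [hε]; ring

end

/-! ### Weak limits of measures with convergent Fourier transforms -/

lemma fourierMeasure_eq_charFun {d : ℕ} (ν : FiniteMeasure (EuclideanSpace ℝ (Fin d)))
    (ξ : EuclideanSpace ℝ (Fin d)) :
    fourierMeasure ν ξ =
      charFun (ν : Measure (EuclideanSpace ℝ (Fin d))) (-(2 * Real.pi) • ξ) := by
  rw [fourierMeasure, charFun_apply]
  congr 1
  funext x
  rw [inner_smul_right]
  push_cast
  congr 1; ring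

lemma continuous_fourierMeasure {d : ℕ} (ν : FiniteMeasure (EuclideanSpace ℝ (Fin d))) :
    Continuous (fourierMeasure ν) := by
  unfold fourierMeasure
  refine continuous_of_dominated (bound := fun _ => 1) (fun ξ => ?_) (fun ξ => ?_)
    (integrable_const _) (ae_of_all _ fun x => by fun_prop)
  · exact Continuous.aestronglyMeasurable (by fun_prop)
  · refine ae_of_all _ fun x => ?_
    rw [← Complex.ofReal_neg, Complex.norm_exp_ofReal_mul_I]

lemma norm_fourierMeasure_le {d : ℕ} (ν : FiniteMeasure (EuclideanSpace ℝ (Fin d)))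
    (ξ : EuclideanSpace ℝ (Fin d)) : ‖fourierMeasure ν ξ‖ ≤ ν.mass := by
  rw [fourierMeasure_eq_charFun]
  exact norm_charFun_le _

lemma fourierMeasure_zero {d : ℕ} (ν : FiniteMeasure (EuclideanSpace ℝ (Fin d))) :
    fourierMeasure ν 0 = (ν.mass : ℝ) := by
  rw [fourierMeasure_eq_charFun, smul_zero, charFun_zero]
  rfl

lemma tendsto_fourierMeasure {d : ℕ} {ι : Type*} {l : Filter ι}
    {ν : ι → FiniteMeasure (EuclideanSpace ℝ (Fin d))} {ν' : FiniteMeasure (EuclideanSpace ℝ (Fin d))}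
    (h : Tendsto ν l (𝓝 ν')) (ξ : EuclideanSpace ℝ (Fin d)) :
    Tendsto (fun i => fourierMeasure (ν i) ξ) l (𝓝 (fourierMeasure ν' ξ)) := by
  rw [FiniteMeasure.tendsto_iff_forall_integral_rclike_tendsto ℂ] at h
  refine h (BoundedContinuousFunction.ofNormedAddCommGroup (fun x : EuclideanSpace ℝ (Fin d) =>
    Complex.exp (-(2 * Real.pi * (inner ℝ x ξ : ℝ) : ℝ) * Complex.I)) (by fun_prop) 1 fun x => ?_)
  rw [← Complex.ofReal_neg, Complex.norm_exp_ofReal_mul_I]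

/-- By compactness, measures on a compact set converge weakly as soon as their Fourier transforms
converge on a dense set that contains the origin. -/
lemma exists_tendsto_of_tendsto_fourierMeasure {d : ℕ} {K : Set (EuclideanSpace ℝ (Fin d))}
    (hK : IsCompact K) {ν : ℕ → FiniteMeasure (EuclideanSpace ℝ (Fin d))}
    (hν : ∀ j, ν j Kᶜ = 0) {S : Set (EuclideanSpace ℝ (Fin d))} (hS : Dense S) (h0 : 0 ∈ S)
    (h : ∀ ξ ∈ S, ∃ z, Tendsto (fun j => fourierMeasure (ν j) ξ) atTop (𝓝 z)) :
    ∃ ν', Tendsto ν atTop (𝓝 ν') ∧ ν' Kᶜ = 0 := by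
  obtain ⟨z₀, hz₀⟩ := h 0 h0
  obtain ⟨C, hC⟩ := hz₀.norm.bddAbove_range
  have hmass : ∀ j, (ν j).mass ≤ C.toNNReal := by
    intro j
    have h1 : ‖fourierMeasure (ν j) 0‖ ≤ C := hC ⟨j, rfl⟩
    rw [fourierMeasure_zero, Complex.norm_real, Real.norm_of_nonneg (NNReal.coe_nonneg _)] at h1
    exact NNReal.le_toNNReal_of_coe_le h1
  have hcpt := isCompact_setOfPred_finiteMeasure_le_of_isCompact C.toNNReal hK
  have hmem : ∀ j, ν j ∈ {μ : FiniteMeasure (EuclideanSpace ℝ (Fin d)) |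
      μ.mass ≤ C.toNNReal ∧ μ Kᶜ = 0} := fun j => ⟨hmass j, hν j⟩
  obtain ⟨ν', hν', hcl⟩ := hcpt.exists_mapClusterPt (f := atTop) (u := ν)
    (tendsto_principal.2 (Eventually.of_forall hmem))
  refine ⟨ν', hcpt.tendsto_nhds_of_unique_mapClusterPt (Eventually.of_forall hmem) ?_, hν'.2⟩
  intro ν'' _ hcl'
  have hlim : ∀ {τ : FiniteMeasure (EuclideanSpace ℝ (Fin d))}, MapClusterPt τ atTop ν →
      ∀ ξ ∈ S, Tendsto (fun j => fourierMeasure (ν j) ξ) atTop (𝓝 (fourierMeasure τ ξ)) := by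
    intro τ hτ ξ hξ
    obtain ⟨z, hz⟩ := h ξ hξ
    obtain ⟨U, hU, hUτ⟩ := mapClusterPt_iff_ultrafilter.1 hτ
    rwa [tendsto_nhds_unique (tendsto_fourierMeasure hUτ ξ) (hz.mono_left hU)]
  have heq : fourierMeasure ν'' = fourierMeasure ν' :=
    (continuous_fourierMeasure ν'').ext_on hS (continuous_fourierMeasure ν') fun ξ hξ =>
      tendsto_nhds_unique (hlim hcl' ξ hξ) (hlim hcl ξ hξ)
  refine FiniteMeasure.toMeasure_injective (Measure.ext_of_charFun (funext fun t => ?_))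
  have h1 := congrFun heq (-(2 * Real.pi)⁻¹ • t)
  rw [fourierMeasure_eq_charFun, fourierMeasure_eq_charFun, smul_smul, neg_mul_neg,
    mul_inv_cancel₀ (by positivity), one_smul] at h1
  exact h1

lemma curveMeasure_compl_momentArc (d : ℕ) (b : ℝ) (A : Set ℝ) :
    (curveMeasure d b A : Measure (EuclideanSpace ℝ (Fin d))) (momentArc d)ᶜ = 0 := by
  have hcont : Continuous (momentCurve d) := by unfold momentCurve; fun_prop
  have hK : IsCompact (momentArc d) := isCompact_Icc.image hcont
  have h : (curveMeasure d b A : Measure (EuclideanSpace ℝ (Fin d))) =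
      ((volume.restrict (Icc (0 : ℝ) 1)).withDensity fun t => ENNReal.ofReal (density b A t)).map
        (momentCurve d) := rfl
  rw [h, Measure.map_apply hcont.measurable hK.measurableSet.compl]
  refine withDensity_absolutelyContinuous _ _ ?_
  rw [Measure.restrict_apply (hcont.measurable hK.measurableSet.compl)]
  convert measure_empty (μ := (volume : Measure ℝ))
  ext t
  simp only [mem_inter_iff, mem_preimage, mem_compl_iff, mem_empty_iff_false, iff_false, not_and]
  exact fun h1 h2 => h1 ⟨t, h2, rfl⟩

section
variable {Ω : Type*} [MeasurableSpace Ω] {P : Measure Ω} {m : ℕ → ℕ} {β : ℕ → ℝ}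
  {E : ℕ → Ω → Set ℝ}

/-! ### Almost sure convergence -/

/-- Geometric decay of `p`-th moments gives almost sure summability, by Jensen's inequality and
`2ʲ ≤ M_j`. -/
lemma ae_tsum_lt_top [IsProbabilityMeasure P] (hm : IsAdmissible m) {Y : ℕ → Ω → ℝ≥0∞}
    (hY : ∀ j, Measurable (Y j)) {p C η : ℝ} (hp : 1 ≤ p) (hC : 0 ≤ C) (hη : 0 < η)
    (h : ∀ j, ∫⁻ ω, Y j ω ^ p ∂P ≤ ENNReal.ofReal (C * (scale m j : ℝ) ^ (-η))) :
    ∀ᵐ ω ∂P, ∑' j, Y j ω < ∞ := by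
  have hp0 : 0 < p := by linarith
  refine ae_lt_top (Measurable.tsum hY) ?_
  rw [lintegral_tsum fun j => (hY j).aemeasurable]
  have hj : ∀ j, ∫⁻ ω, Y j ω ∂P ≤
      ENNReal.ofReal (C ^ (1 / p) * ((2 : ℝ) ^ (-η * (1 / p))) ^ j) := by
    intro j
    have hM := scale_pos_real hm j
    have h1 := eLpNorm'_le_eLpNorm'_of_exponent_le one_pos hp P (hY j).aestronglyMeasurable
    simp only [eLpNorm', enorm_eq_self, ENNReal.rpow_one, div_one] at h1
    refine h1.trans ((ENNReal.rpow_le_rpow (h j) (by positivity)).trans ?_)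
    rw [ENNReal.ofReal_rpow_of_nonneg (by positivity) (by positivity)]
    refine ENNReal.ofReal_le_ofReal ?_
    rw [Real.mul_rpow hC (by positivity), ← Real.rpow_mul hM.le]
    refine mul_le_mul_of_nonneg_left ?_ (by positivity)
    rw [← Real.rpow_mul_natCast two_pos.le, mul_comm _ (j : ℝ), Real.rpow_mul two_pos.le,
      Real.rpow_natCast]
    refine Real.rpow_le_rpow_of_nonpos (by positivity) ?_ ?_
    · exact_mod_cast two_pow_le_scale hm j
    · have : 0 < η * (1 / p) := by positivity
      linarith
  refine ne_top_of_le_ne_top ?_ (ENNReal.tsum_le_tsum hj)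
  refine Summable.tsum_ofReal_ne_top (Summable.mul_left _ (summable_geometric_of_lt_one
    (by positivity) ?_))
  refine Real.rpow_lt_one_of_one_lt_of_neg one_lt_two ?_
  have : 0 < η * (1 / p) := by positivity
  linarith

lemma exists_tendsto_of_tsum_lt_top {F : ℕ → ℂ} (h : ∑' j, ‖F (j + 1) - F j‖ₑ < ∞) :
    ∃ z, Tendsto F atTop (𝓝 z) := by
  refine cauchySeq_tendsto_of_complete (cauchySeq_of_edist_le_of_tsum_ne_top _ (fun j => ?_) h.ne)
  rw [edist_comm, edist_eq_enorm_sub]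

/-- Almost surely, the measures `ν_j` converge weakly. -/
lemma IsRandomCantor.ae_exists_tendsto (hE : IsRandomCantor P m β E) [IsProbabilityMeasure P]
    (hm : IsAdmissible m) (d : ℕ) {α : ℝ} (hα0 : 0 < α) (hα1 : α < 1)
    (hα : Tendsto (fun j => Real.log (β j) / Real.log (scale m j)) atTop (𝓝 (1 - α))) :
    ∀ᵐ ω ∂P, ∃ ν : FiniteMeasure (EuclideanSpace ℝ (Fin d)),
      Tendsto (fun j => curveMeasure d (β j) (E j ω)) atTop (𝓝 ν) ∧ ν (momentArc d)ᶜ = 0 := by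
  set S : Set (EuclideanSpace ℝ (Fin d)) := insert 0 (range (TopologicalSpace.denseSeq _)) with hS
  have hcount : S.Countable := (countable_range _).insert 0
  have hdense : Dense S := (TopologicalSpace.denseRange_denseSeq _).mono (subset_insert _ _)
  have hae : ∀ᵐ ω ∂P, ∀ ξ ∈ S, ∃ z,
      Tendsto (fun j => fourierMeasure (curveMeasure d (β j) (E j ω)) ξ) atTop (𝓝 z) := by
    refine (ae_ball_iff hcount).2 fun ξ _ => ?_
    obtain ⟨C, hC, H⟩ := hE.lintegral_increment_cellIntegral_le hm hα0 hα1 hα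
      (f := osc (phase ξ)) zero_le_one fun t _ => (norm_osc _ _).le
    have hmeas : ∀ j, Measurable fun ω =>
        ‖increment m β E j (cellIntegral m (osc (phase ξ)) (j + 1)) ω‖ₑ := fun j =>
      ((hE.measurable_increment j).comp (measurable_id.prodMk measurable_const)).enorm
    filter_upwards [ae_tsum_lt_top hm hmeas one_le_two hC (by positivity) H] with ω hω
    refine exists_tendsto_of_tsum_lt_top ?_
    simp only [hE.fourierMeasure_succ_sub hm]
    exact hω
  filter_upwards [hae] with ω hω
  have hcont : Continuous (momentCurve d) := by unfold momentCurve; fun_prop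
  refine exists_tendsto_of_tendsto_fourierMeasure (isCompact_Icc.image hcont) (fun j => ?_) hdense
    (mem_insert _ _) hω
  rw [FiniteMeasure.null_iff_toMeasure_null]
  exact curveMeasure_compl_momentArc d _ _

/-- Almost surely, the Fourier transforms of the measures `ν_j` are bounded in `L^p`. -/
lemma IsRandomCantor.ae_exists_eLpNorm_le (hE : IsRandomCantor P m β E) [IsProbabilityMeasure P]
    (hm : IsAdmissible m) {d : ℕ} (hd : 1 ≤ d) {α : ℝ} (hα0 : 0 < α) (hα1 : α < 1)
    (hα : Tendsto (fun j => Real.log (β j) / Real.log (scale m j)) atTop (𝓝 (1 - α)))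
    {p : ℝ≥0∞} (hp : p ≠ ∞) (h1 : (d : ℝ) < α * (p.toReal / 2))
    (h2 : α + (d * (d + 1) / 2 : ℕ) < α * p.toReal) :
    ∀ᵐ ω ∂P, ∃ B : ℝ≥0∞, B < ∞ ∧
      ∀ j, eLpNorm (fourierMeasure (curveMeasure d (β j) (E j ω))) p volume ≤ B := by
  have hD0 : (0 : ℝ) ≤ (d * (d + 1) / 2 : ℕ) := Nat.cast_nonneg _
  have hDp : ((d * (d + 1) / 2 : ℕ) : ℝ) + 1 < p.toReal := by nlinarith
  have hp1 : 1 < p.toReal := by linarith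
  have hp1' : 1 ≤ p := by
    rw [← ENNReal.ofReal_toReal hp, ENNReal.one_le_ofReal]
    exact hp1.le
  have hp0 : p ≠ 0 := (one_pos.trans_le hp1').ne'
  obtain ⟨C, η, hC, hη, H⟩ := hE.lintegral_lintegral_increment_le hm hd hα0 hα1 hα h1 h2
  have hmeas : ∀ j, Measurable fun ω => eLpNorm (fun ξ : EuclideanSpace ℝ (Fin d) =>
      increment m β E j (cellFourier m (j + 1) ξ) ω) p volume := fun j => by
    simp only [eLpNorm_eq_lintegral_rpow_enorm_toReal hp0 hp]
    exact (((hE.measurable_increment j).enorm.pow_const _).lintegral_prod_right').pow_const _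
  have hpow : ∀ j ω, eLpNorm (fun ξ : EuclideanSpace ℝ (Fin d) =>
      increment m β E j (cellFourier m (j + 1) ξ) ω) p volume ^ p.toReal =
        ∫⁻ ξ : EuclideanSpace ℝ (Fin d),
          ‖increment m β E j (cellFourier m (j + 1) ξ) ω‖ₑ ^ p.toReal := fun j ω => by
    rw [eLpNorm_eq_lintegral_rpow_enorm_toReal hp0 hp, ← ENNReal.rpow_mul,
      one_div_mul_cancel (by linarith), ENNReal.rpow_one]
  filter_upwards [ae_tsum_lt_top hm hmeas hp1.le hC hη fun j => by simpa only [hpow] using H j]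
    with ω hω
  refine ⟨eLpNorm (fourierMeasure (curveMeasure d 1 (Ico 0 1))) p volume + _,
    ENNReal.add_lt_top.2 ⟨?_, hω⟩, fun j => ?_⟩
  · rw [eLpNorm_eq_lintegral_rpow_enorm_toReal hp0 hp]
    exact ENNReal.rpow_lt_top_of_nonneg (by positivity)
      (lintegral_fourierMeasure_unit_lt_top hd hDp).ne
  · have hsum : fourierMeasure (curveMeasure d (β j) (E j ω)) =
        fourierMeasure (curveMeasure d 1 (Ico 0 1)) + ∑ i ∈ Finset.range j,
          fun ξ => increment m β E i (cellFourier m (i + 1) ξ) ω := by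
      funext ξ
      rw [hE.fourierMeasure_eq_sum hm, Pi.add_apply, Finset.sum_apply]
    rw [hsum]
    refine (eLpNorm_add_le (continuous_fourierMeasure _).aestronglyMeasurable
      (Finset.aestronglyMeasurable_sum _ fun i _ =>
        (continuous_increment _ _ _ _ _).aestronglyMeasurable) hp1').trans ?_
    refine add_le_add le_rfl ((eLpNorm_sum_le (fun i _ =>
      (continuous_increment _ _ _ _ _).aestronglyMeasurable) hp1').trans ?_)
    exact ENNReal.sum_le_tsum _

end

/-- The two exponent conditions of the moment estimate. For `d = 2` the first one is decisive, and for
`d ≥ 3` the second one. -/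
lemma lt_of_criticalExponent_lt {d : ℕ} (hd : 2 ≤ d) {α p : ℝ} (hα0 : 0 < α) (hα1 : α < 1)
    (hp : criticalExponent d α < p) :
    (d : ℝ) < α * (p / 2) ∧ α + (d * (d + 1) / 2 : ℕ) < α * p := by
  have hD : ((d * (d + 1) / 2 : ℕ) : ℝ) = (d : ℝ) * (d + 1) / 2 := by
    rw [Nat.cast_div (Nat.even_mul_succ_self d).two_dvd (by norm_num)]
    push_cast
    rfl
  rw [hD]
  unfold criticalExponent at hp
  split_ifs at hp with h
  · subst h
    rw [div_lt_iff₀ hα0] at hp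
    constructor <;> push_cast <;> linarith
  · have hd3 : (3 : ℝ) ≤ d := by exact_mod_cast (show 3 ≤ d by omega)
    rw [div_lt_iff₀ (by positivity)] at hp
    constructor <;> nlinarith

end MomentCantor

end

theorem proposition3p1 {Ω : Type*} [MeasurableSpace Ω] (P : Measure Ω) [IsProbabilityMeasure P]
    (d : ℕ) (hd : 2 ≤ d) (α : ℝ) (hα0 : 0 < α) (hα1 : α < 1)
    (m : ℕ → ℕ) (hm : MomentCantor.IsAdmissible m)
    (β : ℕ → ℝ) (E : ℕ → Ω → Set ℝ) (hE : MomentCantor.IsRandomCantor P m β E)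
    (hα : Tendsto (fun j => Real.log (β j) / Real.log (MomentCantor.scale m j)) atTop
      (𝓝 (1 - α)))
    (p : ℝ≥0∞) (hp : ENNReal.ofReal (MomentCantor.criticalExponent d α) < p) :
    ∀ᵐ ω ∂P, ∃ ν : FiniteMeasure (EuclideanSpace ℝ (Fin d)),
      Tendsto (fun j => MomentCantor.curveMeasure d (β j) (E j ω)) atTop (𝓝 ν) ∧
      (ν : Measure (EuclideanSpace ℝ (Fin d))) (MomentCantor.momentArc d)ᶜ = 0 ∧
      MemLp (MomentCantor.fourierMeasure ν) p volume := by
  have hlim := hE.ae_exists_tendsto hm d hα0 hα1 hα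
  by_cases hp' : p = ∞
  · filter_upwards [hlim] with ω ⟨ν, hν, hν0⟩
    refine ⟨ν, hν, (FiniteMeasure.null_iff_toMeasure_null _ _).1 hν0, ?_⟩
    rw [hp']
    exact memLp_top_of_bound (MomentCantor.continuous_fourierMeasure ν).aestronglyMeasurable _
      (ae_of_all _ (MomentCantor.norm_fourierMeasure_le ν))
  · have hc : 0 ≤ MomentCantor.criticalExponent d α := by
      unfold MomentCantor.criticalExponent
      split_ifs <;> positivity
    obtain ⟨h1, h2⟩ := MomentCantor.lt_of_criticalExponent_lt hd hα0 hα1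
      ((ENNReal.ofReal_lt_iff_lt_toReal hc hp').1 hp)
    filter_upwards [hlim, hE.ae_exists_eLpNorm_le hm (by omega) hα0 hα1 hα hp' h1 h2]
      with ω ⟨ν, hν, hν0⟩ ⟨B, hB, hle⟩
    refine ⟨ν, hν, (FiniteMeasure.null_iff_toMeasure_null _ _).1 hν0,
      (MomentCantor.continuous_fourierMeasure ν).aestronglyMeasurable, ?_⟩
    -- Fatou's lemma passes the uniform bound to the limit.
    refine (Lp.eLpNorm_lim_le_liminf_eLpNorm (fun j =>
      (MomentCantor.continuous_fourierMeasure _).aestronglyMeasurable) _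
      (ae_of_all _ (MomentCantor.tendsto_fourierMeasure hν))).trans_lt (lt_of_le_of_lt ?_ hB)
    exact liminf_le_of_frequently_le' (Frequently.of_forall hle)
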